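/- \textbf{Lemma (Geodesics in a subsurface).} Let $S$ be a compact connected oriented surface, possibly with boundary, with $\chi(S)<0$, and let $R=\coprod_i R_i$ be a compact oriented surface with finitely many connected components $R_i$, possibly with boundary, with $\chi(R_i)<0$ for every $i$. Fix hyperbolic metrics (curvature $-1$, geodesic boundary) on $S$ and on $R$. The universal cover $\tilde S$ is identified by a local isometry with a subset of the hyperbolic plane $\mathbb{D}^2$; its ideal boundary $\partial_\infty\tilde S$ is the set of points of $\partial\mathbb{D}^2$ in the closure of $\tilde S$, and $\mathcal{G}(\tilde S)$ is the space of unordered pairs of distinct points of $\partial_\infty\tilde S$. Likewise for each $R_i$, and $\mathcal{G}(\tilde R):=\coprod_i\mathcal{G}(\tilde R_i)$. The group $\pi_1(S)$ acts on $\tilde S$ by deck transformations, and hence on $\partial_\infty\tilde S$ and on $\mathcal{G}(\tilde S)$. A geodesic of $R$ (or of $S$) is the projection of the complete geodesic of the universal cover with a given pair of endpoints, which is called a lift of it; geodesics are unoriented. Let $I:R\to S$ be a geodesic realization of $R$ in $S$, i.e.\ a continuous map that sends the interior of $R$ homeomorphically onto its image and each boundary curve of $R$ homeomorphically onto a closed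 geodesic of $S$ (two boundary curves may have the same image). Then $I$ lifts to maps $\tilde R_i\to\tilde S$. Every such choice of lifts extends continuously to maps $\partial_\infty\tilde R_i\to\partial_\infty\tilde S$, and these send distinct points of the same $\partial_\infty\tilde R_i$ to distinct points, so that they induce a map $\tilde I:\mathcal{G}(\tilde R)\to\mathcal{G}(\tilde S)$. The map $\tilde I$ is continuous and closed. If $R$ is connected, then \begin{itemize} \item $\tilde I$ is injective; \item given lifts $\tilde\gamma_1,\tilde\gamma_2\in\mathcal{G}(\tilde R)$ of two distinct geodesics $\gamma_1,\gamma_2\subset R$, the image $\tilde I(\tilde\gamma_1)$ is $\pi_1(S)$-conjugate to $\tilde I(\tilde\gamma_2)$ if and only if $\gamma_1,\gamma_2\subset\partial R$ and $I(\gamma_1)=I(\gamma_2)$. \end{itemize} -/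

import Mathlib

open Set Filter Topology
open scoped UpperHalfPlane MatrixGroups

/-- The closed half-plane `Re z ≥ 0` of the hyperbolic plane `ℍ` (with Mathlib's metric of curvature
`-1`); it is bounded by the complete geodesic `Re z = 0`. -/
abbrev HypHalfPlane : Type := {z : ℍ // 0 ≤ z.re}

/-- An orientation together with a hyperbolic metric (curvature `-1`, geodesic boundary) on the
surface `S`, given by an atlas of charts with values in a closed half-plane of `ℍ` whose
transition maps are locally orientation-preserving isometries of `ℍ`, i.e. Möbius transformations
in `SL(2, ℝ)`. -/
structure HyperbolicMetric (S : Type*) [TopologicalSpace S] where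
  charts : Set (OpenPartialHomeomorph S HypHalfPlane)
  cover : ∀ x : S, ∃ φ ∈ charts, x ∈ φ.source
  compatible : ∀ φ ∈ charts, ∀ ψ ∈ charts, ∀ x ∈ φ.source ∩ ψ.source,
    ∃ g : SL(2, ℝ), ∀ᶠ y in 𝓝 x, (ψ y : ℍ) = g • (φ y : ℍ)

/-- The boundary of the surface: the points sent by a chart to the geodesic `Re z = 0`. -/
def HyperbolicMetric.boundary {S : Type*} [TopologicalSpace S] (h : HyperbolicMetric S) : Set S :=
  {x | ∃ φ ∈ h.charts, x ∈ φ.source ∧ (φ x : ℍ).re = 0}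

/-- The universal cover of a hyperbolic surface, identified with a subset of the hyperbolic plane
by an orientation-preserving local isometry: a simply connected subset `carrier` of `ℍ`, and a
covering map to `S` which, read in the charts of `S`, is locally in `SL(2, ℝ)`. -/
structure UniversalCover {S : Type*} [TopologicalSpace S] (h : HyperbolicMetric S) where
  carrier : Set ℍ
  proj : carrier → S
  simplyConnected : SimplyConnectedSpace carrier
  isCoveringMap : IsCoveringMap proj
  surjective : Function.Surjective proj
  localIsometry : ∀ z : carrier, ∀ φ ∈ h.charts, proj z ∈ φ.source →
    ∃ g : SL(2, ℝ), ∀ᶠ w in 𝓝 z, (φ (proj w) : ℍ) = g • (w : ℍ)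

/-- The inclusion of `ℍ` in the Riemann sphere. Its image is an open disc; the closure of the image
is the closed disc compactifying the hyperbolic plane. -/
def toSphere (z : ℍ) : OnePoint ℂ := ((z : ℂ) : OnePoint ℂ)

/-- The ideal boundary of a subset `X` of the hyperbolic plane: the points of the circle at
infinity lying in the closure of `X`. -/
def idealBoundary (X : Set ℍ) : Set (OnePoint ℂ) :=
  closure (toSphere '' X) ∩ frontier (range toSphere)

/-- Unordered pairs of points carry the quotient topology. -/
instance sym2TopologicalSpace (α : Type*) [TopologicalSpace α] : TopologicalSpace (Sym2 α) :=
  TopologicalSpace.coinduced (fun p : α × α => s(p.1, p.2)) inferInstance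

/-- The space of bi-infinite geodesics: unordered pairs of distinct points of the ideal boundary. -/
abbrev GeodesicSpace (X : Set ℍ) : Type :=
  {q : Sym2 (idealBoundary X) // ¬ q.IsDiag}

/-- The complete geodesic line of the hyperbolic plane with the given pair of endpoints. -/
def GeodesicSpace.line {X : Set ℍ} (q : GeodesicSpace X) : Set ℍ :=
  {z | ∃ c : ℝ → ℍ, Isometry c ∧ z ∈ range c ∧ ∃ ξ η : idealBoundary X, q.1 = s(ξ, η) ∧
    Tendsto (fun t => toSphere (c t)) atBot (𝓝 (ξ : OnePoint ℂ)) ∧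
    Tendsto (fun t => toSphere (c t)) atTop (𝓝 (η : OnePoint ℂ))}

/-- `f` is the extension of `J : X → Y` to the ideal boundaries: `J z` tends to `f ξ` as `z ∈ X`
tends to `ξ` in the closed disc. There is at most one such `f`. -/
def IsBoundaryExtension {X Y : Set ℍ} (J : X → Y) (f : idealBoundary X → idealBoundary Y) : Prop :=
  ∀ ξ : idealBoundary X,
    Tendsto (fun z : X => toSphere (J z)) (comap (fun z : X => toSphere z) (𝓝 (ξ : OnePoint ℂ)))
      (𝓝 (f ξ : OnePoint ℂ))

namespace UniversalCover

/-- The space `𝒢(S̃)` of bi-infinite geodesics of the universal cover. -/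
abbrev geodesics {S : Type*} [TopologicalSpace S] {h : HyperbolicMetric S} (U : UniversalCover h) :
    Type :=
  GeodesicSpace U.carrier

/-- The geodesic of `S` with lift `q`, as a subset of `S`. -/
def image {S : Type*} [TopologicalSpace S] {h : HyperbolicMetric S} (U : UniversalCover h)
    (q : U.geodesics) : Set S :=
  U.proj '' {z | (z : ℍ) ∈ q.line}

/-- `C` is (the support of) a closed geodesic of `S`. -/
def IsClosedGeodesic {S : Type*} [TopologicalSpace S] {h : HyperbolicMetric S}
    (U : UniversalCover h) (C : Set S) : Prop :=
  ∃ c : ℝ → U.carrier, Isometry c ∧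
    (∃ T : ℝ, 0 < T ∧ ∀ t, U.proj (c (t + T)) = U.proj (c t)) ∧ C = range (U.proj ∘ c)

/-- Two points of `𝒢(S̃)` are `π₁(S)`-conjugate: a deck transformation of the universal cover,
acting on the ideal boundary by extension, sends the first pair of endpoints to the second. -/
def IsConjugate {S : Type*} [TopologicalSpace S] {h : HyperbolicMetric S}
    (U : UniversalCover h) (a b : U.geodesics) : Prop :=
  ∃ g : U.carrier ≃ₜ U.carrier, (∀ z, U.proj (g z) = U.proj z) ∧
    ∃ f : idealBoundary U.carrier → idealBoundary U.carrier,
      IsBoundaryExtension g f ∧ Sym2.map f a.1 = b.1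

end UniversalCover

section Realization

variable {ι : Type*} {R : ι → Type*} [∀ i, TopologicalSpace (R i)]
  {S : Type*} [TopologicalSpace S]

/-- The boundary of the disjoint union of the surfaces `R i`. -/
def sigmaBoundary (hR : ∀ i, HyperbolicMetric (R i)) : Set (Σ i, R i) :=
  {x | x.2 ∈ (hR x.1).boundary}

/-- The boundary curves of the disjoint union of the surfaces `R i`: the connected components of
its boundary. -/
def IsBoundaryCurve (hR : ∀ i, HyperbolicMetric (R i)) (β : Set (Σ i, R i)) : Prop :=
  ∃ x ∈ sigmaBoundary hR, β = connectedComponentIn (sigmaBoundary hR) x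

/-- Geodesic realizations: continuous maps sending the interior of the surface homeomorphically
onto its image and each boundary curve homeomorphically onto a closed geodesic of `S`. -/
structure IsGeodesicRealization (hR : ∀ i, HyperbolicMetric (R i)) {hS : HyperbolicMetric S}
    (US : UniversalCover hS) (I : (Σ i, R i) → S) : Prop where
  continuous : Continuous I
  interior : IsEmbedding ((sigmaBoundary hR)ᶜ.domRestrict I)
  boundaryCurve : ∀ β, IsBoundaryCurve hR β →
    IsEmbedding (β.domRestrict I) ∧ US.IsClosedGeodesic (I '' β)

/-- The maps `J i` form a lift of `I` to the universal covers. -/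
def IsLift {hR : ∀ i, HyperbolicMetric (R i)} (UR : ∀ i, UniversalCover (hR i))
    {hS : HyperbolicMetric S} (US : UniversalCover hS) (I : (Σ i, R i) → S)
    (J : ∀ i, (UR i).carrier → US.carrier) : Prop :=
  ∀ i, Continuous (J i) ∧ ∀ z, US.proj (J i z) = I ⟨i, (UR i).proj z⟩

/-- The geodesic of the surface `Σ i, R i` with a given lift, as a subset of that surface. -/
def sigmaImage {hR : ∀ i, HyperbolicMetric (R i)} (UR : ∀ i, UniversalCover (hR i))
    (a : Σ i, (UR i).geodesics) : Set (Σ i, R i) :=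
  Sigma.mk a.1 '' (UR a.1).image a.2

end Realization

/-! ### Invariance of domain in the plane -/

/-! The realization is not assumed to respect the metric of R, so lifts are controlled by coarse
geometry. In the Klein model `kl`, complete geodesics are open chords of the unit disc and convexity
is Euclidean. Cocompactness of the deck group and the local half-plane model make the universal
cover of a compact surface closed (`isClosed_carrier`) and convex (`convex_carrier`), with boundary
made of complete geodesics.

Let J lift I on one component. The preimage in the cover of S of the image of ∂R, the wall, is a
union of complete geodesics, so the components of its complement are convex (`convex_component`).
The interior of the cover of R is mapped injectively onto one such component W
(`injOn_int_and_image_int_eq`): its image is open by invariance of domain, and the inverse of I on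
the interior, composed with the projection of W, lifts to an inverse of J because W is contractible.
Equivariance under a cocompact group bounds J from above (`exists_dist_le`), and local finiteness of
orbits bounds it from below (`exists_dist_le'`). Both the domain and the range of J being convex, J
is coarse in both directions.

A coarse map moves points far out and close together in the Klein disc to points close together
(`IsCoarse.visual`), because errors along a geodesic leaving the base point decay geometrically. In
one direction this gives a continuous boundary extension, in the other its injectivity. Continuity
and closedness on unordered pairs follow from compactness of the ideal boundary, and injectivity on
geodesics is immediate.

For conjugacy, let a deck transformation g carry the image of a to the image of b. If g matches two
points of J(interior), then g is induced by a deck transformation of the cover of R, and a, b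
project to the same geodesic (`image_eq_of_not_disjoint`). Otherwise both image lines avoid
J(interior), and a line of this kind comes from a boundary geodesic (`notMem_interior_of_disjoint`).
Conversely, when two boundary geodesics have the same image in S, a deck transformation matching one
point of their lifts matches the whole lines (`eq_geodesicMap_of_mem`). -/

theorem Complex.not_odd_exp_on_sphere (l : Metric.sphere (0 : ℂ) 1 → ℂ) (hl : Continuous l)
    (hodd : ∀ x, Complex.exp (l (-x)) = -Complex.exp (l x)) : False := by
  have hpc : PreconnectedSpace (Metric.sphere (0 : ℂ) 1) :=
    Subtype.preconnectedSpace (isPreconnected_sphere (by simp [Complex.rank_real_complex]) 0 1)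
  have hc : Continuous fun x : Metric.sphere (0 : ℂ) 1 => l (-x) - l x := by fun_prop
  have hexp : ∀ x, Complex.exp (l (-x) - l x) = -1 := fun x => by
    rw [Complex.exp_sub, hodd, neg_div, div_self (Complex.exp_ne_zero _)]
  let x₀ : Metric.sphere (0 : ℂ) 1 := ⟨1, by simp⟩
  -- The difference of logarithms takes values in the discrete fibre of exp over -1, so it is
  -- constant on the circle. Exchanging x and -x changes its sign, hence it vanishes, although exp 0
  -- ≠ -1.
  have hconst := Complex.isCoveringMap_exp.const_of_comp hc
    (fun a b => Subtype.ext ((hexp a).trans (hexp b).symm)) x₀ (-x₀)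
  simp only [neg_neg] at hconst
  have h0 : l (-x₀) - l x₀ = 0 := by linear_combination hconst / 2
  have := hexp x₀
  rw [h0, Complex.exp_zero] at this
  norm_num at this

/-- Homotopy lifting for the covering exp: having a continuous logarithm is a homotopy invariant of
maps from the circle to the punctured plane. -/
theorem Complex.exists_log_of_homotopy
    (H : C(unitInterval × Metric.sphere (0 : ℂ) 1, ℂ)) (hH : ∀ p, H p ≠ 0)
    (l : C(Metric.sphere (0 : ℂ) 1, ℂ)) (hl : ∀ x, H (0, x) = Complex.exp (l x)) :
    ∃ l' : C(Metric.sphere (0 : ℂ) 1, ℂ), ∀ x, H (1, x) = Complex.exp (l' x) := by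
  let H' : C(unitInterval × Metric.sphere (0 : ℂ) 1, {z : ℂ // z ≠ 0}) :=
    ⟨fun p => ⟨H p, hH p⟩, by fun_prop⟩
  let G := Complex.isCoveringMap_exp.liftHomotopy H' l (fun a => Subtype.ext (hl a))
  refine ⟨G.comp ⟨fun x => (1, x), by fun_prop⟩, fun x => ?_⟩
  have := congr_fun (Complex.isCoveringMap_exp.liftHomotopy_lifts H' l
    (fun a => Subtype.ext (hl a))) (1, x)
  exact (congrArg Subtype.val this).symm

theorem Complex.exists_log_on_closedBall (g : C(Metric.closedBall (0 : ℂ) 1, ℂ))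
    (hg : ∀ x, g x ≠ 0) :
    ∃ l : C(Metric.closedBall (0 : ℂ) 1, ℂ), ∀ x, g x = Complex.exp (l x) := by
  have hne : (Metric.closedBall (0 : ℂ) 1).Nonempty := ⟨0, by simp⟩
  have := (convex_closedBall (0 : ℂ) 1).contractibleSpace hne
  have hlp : LocallyPathConnectedSpace (Metric.closedBall (0 : ℂ) 1) :=
    (convex_closedBall (0 : ℂ) 1).locallyPathConnectedSpace
  obtain ⟨F, ⟨-, hF⟩, -⟩ := Complex.isCoveringMapOn_exp.existsUnique_continuousMap_lifts g
    (a₀ := ⟨0, by simp⟩) (Complex.exp_log (hg ⟨0, by simp⟩)) (fun a => hg a)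
  exact ⟨F, fun x => (congr_fun hF x).symm⟩

/-- If p close to f 0 is omitted, f - p has a logarithm on the disc. On the circle its ratio to f -
f 0 stays within distance 1 of 1, so f - f 0 has a logarithm there too. Injectivity deforms f - f 0
without zeros into an odd map, contradicting `Complex.not_odd_exp_on_sphere`. -/
theorem Complex.image_closedBall_mem_nhds_of_injOn {f : ℂ → ℂ}
    (hf : ContinuousOn f (Metric.closedBall 0 1)) (hinj : InjOn f (Metric.closedBall 0 1)) :
    f '' Metric.closedBall 0 1 ∈ 𝓝 (f 0) := by
  have hsub : Metric.sphere (0 : ℂ) 1 ⊆ Metric.closedBall 0 1 := Metric.sphere_subset_closedBall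
  have h0 : (0 : ℂ) ∈ Metric.closedBall (0 : ℂ) 1 := by simp
  have hfs : ContinuousOn f (Metric.sphere 0 1) := hf.mono hsub
  obtain ⟨x₀, hx₀, hmin⟩ := (isCompact_sphere (0 : ℂ) 1).exists_isMinOn ⟨1, by simp⟩
    (f := fun x => ‖f x - f 0‖) (by fun_prop)
  have hδ : 0 < ‖f x₀ - f 0‖ := by
    rw [norm_pos_iff, sub_ne_zero]
    intro h
    have := hinj (hsub hx₀) h0 h
    simp [this] at hx₀
  refine Filter.mem_of_superset (Metric.ball_mem_nhds (f 0) hδ) fun p hp => ?_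
  by_contra hpf
  obtain ⟨l, hl⟩ := Complex.exists_log_on_closedBall
    ⟨fun x => f x - p, (hf.domRestrict).sub continuous_const⟩
    (fun x h => hpf ⟨x, x.2, sub_eq_zero.1 h⟩)
  replace hl : ∀ x : Metric.closedBall (0 : ℂ) 1, f x - p = Complex.exp (l x) := hl
  -- a logarithm of `f - f 0` on the circle
  have hne : ∀ x : Metric.sphere (0 : ℂ) 1, f x - f 0 ≠ 0 := fun x h => by
    have := hmin x.2
    simp only [mem_ofPred_eq, h, norm_zero] at this
    linarith
  have hslit : ∀ x : Metric.sphere (0 : ℂ) 1,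
      (f x - p) / (f x - f 0) ∈ Complex.slitPlane := fun x => by
    have h1 : (f x - p) / (f x - f 0) = 1 + (f 0 - p) / (f x - f 0) := by
      field_simp [hne x]; ring
    rw [h1]
    refine Complex.mem_slitPlane_of_norm_lt_one ?_
    rw [norm_div, div_lt_one (norm_pos_iff.2 (hne x))]
    rw [Metric.mem_ball, dist_comm, dist_eq_norm] at hp
    exact hp.trans_le (hmin x.2)
  have hfc : Continuous fun x : Metric.sphere (0 : ℂ) 1 => f x := hfs.domRestrict
  have hcl : Continuous fun x : Metric.sphere (0 : ℂ) 1 =>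
      l ⟨x, hsub x.2⟩ - Complex.log ((f x - p) / (f x - f 0)) := by
    refine Continuous.sub (by fun_prop) ?_
    refine Continuous.clog ?_ hslit
    exact (hfc.sub continuous_const).div (hfc.sub continuous_const) hne
  have hden : ∀ t : unitInterval, (0 : ℝ) < 1 + t := fun t => by linarith [t.2.1]
  have hA : ∀ q : unitInterval × Metric.sphere (0 : ℂ) 1,
      ((1 / (1 + q.1.1) : ℝ) : ℂ) * q.2.1 ∈ Metric.closedBall (0 : ℂ) 1 := fun q => by
    have h2 : ‖q.2.1‖ = 1 := by simp
    rw [mem_closedBall_zero_iff, norm_mul, h2, mul_one, Complex.norm_real, Real.norm_eq_abs,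
      abs_of_pos (one_div_pos.2 (hden _)), div_le_one (hden _)]
    linarith [q.1.2.1]
  have hB : ∀ q : unitInterval × Metric.sphere (0 : ℂ) 1,
      ((-q.1.1 / (1 + q.1.1) : ℝ) : ℂ) * q.2.1 ∈ Metric.closedBall (0 : ℂ) 1 := fun q => by
    have h2 : ‖q.2.1‖ = 1 := by simp
    rw [mem_closedBall_zero_iff, norm_mul, h2, mul_one, Complex.norm_real, Real.norm_eq_abs,
      abs_div, abs_neg, abs_of_nonneg q.1.2.1, abs_of_pos (hden _), div_le_one (hden _)]
    linarith
  -- The arguments of the two terms are distinct multiples of x inside the disc. The homotopy starts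
  -- at f x - f 0 and ends at f (x/2) - f (-x/2), which is odd.
  let H : C(unitInterval × Metric.sphere (0 : ℂ) 1, ℂ) :=
    ⟨fun q => f (((1 / (1 + q.1.1) : ℝ) : ℂ) * q.2.1) - f (((-q.1.1 / (1 + q.1.1) : ℝ) : ℂ) * q.2.1),
      by
      refine Continuous.sub ?_ ?_
      · refine hf.comp_continuous ?_ hA
        refine Continuous.mul (Complex.continuous_ofReal.comp ?_) (by fun_prop)
        exact continuous_const.div (by fun_prop) (fun q => (hden _).ne')
      · refine hf.comp_continuous ?_ hB
        refine Continuous.mul (Complex.continuous_ofReal.comp ?_) (by fun_prop)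
        exact Continuous.div (by fun_prop) (by fun_prop) (fun q => (hden _).ne')⟩
  obtain ⟨l', hl'⟩ := Complex.exists_log_of_homotopy H
    (fun q h => by
      have h1 := hinj (hA q) (hB q) (sub_eq_zero.1 h)
      have h3 : q.2.1 ≠ 0 := fun h4 => by
        have := q.2.2
        simp [h4] at this
      have h2 := Complex.ofReal_injective (mul_right_cancel₀ h3 h1)
      rw [div_left_inj' (hden _).ne'] at h2
      linarith [q.1.2.1])
    ⟨_, hcl⟩
    (fun x => by
      have h1 := hl ⟨x, hsub x.2⟩
      have h3 : f x - p ≠ 0 := fun h => hpf ⟨x, hsub x.2, sub_eq_zero.1 h⟩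
      simp only [H, ContinuousMap.coe_mk]
      rw [Complex.exp_sub, ← h1, Complex.exp_log (div_ne_zero h3 (hne x)), div_div_cancel₀ h3]
      simp)
  refine Complex.not_odd_exp_on_sphere l' l'.continuous fun x => ?_
  rw [← hl', ← hl']
  simp only [H, ContinuousMap.coe_mk]
  norm_num

theorem Complex.image_mem_nhds_of_injOn {f : ℂ → ℂ} {s : Set ℂ} {z : ℂ} (hs : s ∈ 𝓝 z)
    (hf : ContinuousOn f s) (hinj : InjOn f s) : f '' s ∈ 𝓝 (f z) := by
  obtain ⟨r, hr, hrs⟩ := Metric.nhds_basis_closedBall.mem_iff.1 hs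
  have hm : MapsTo (fun w : ℂ => z + r * w) (Metric.closedBall 0 1) s := fun w hw => hrs (by
    rw [mem_closedBall_zero_iff] at hw
    rw [mem_closedBall_iff_norm, add_sub_cancel_left, norm_mul, Complex.norm_real,
      Real.norm_of_nonneg hr.le]
    nlinarith)
  have := Complex.image_closedBall_mem_nhds_of_injOn (f := fun w : ℂ => f (z + r * w))
    (hf.comp (by fun_prop) hm) (fun a ha b hb h => by
      have := hinj (hm ha) (hm hb) h
      have hr' : (r : ℂ) ≠ 0 := by exact_mod_cast hr.ne'
      exact mul_left_cancel₀ hr' (add_left_cancel this))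
  simp only [mul_zero, add_zero] at this
  refine Filter.mem_of_superset this ?_
  rintro _ ⟨w, hw, rfl⟩
  exact ⟨_, hm hw, rfl⟩

/-! ### The Klein model of the hyperbolic plane -/

/-- The Klein coordinate of a point of the closed half-plane: stereographic projection followed by
an orthogonal projection along the imaginary direction. -/
noncomputable def kleinC (w : ℂ) : ℂ :=
  ⟨2 * w.re / (Complex.normSq w + 1), (Complex.normSq w - 1) / (Complex.normSq w + 1)⟩

/-- The Klein coordinate on the Riemann sphere. -/
noncomputable def klein (x : OnePoint ℂ) : ℂ := Option.elim x Complex.I kleinC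

/-- The Klein coordinate on the hyperbolic plane. -/
noncomputable def kl (z : ℍ) : ℂ := kleinC z

theorem klein_toSphere (z : ℍ) : klein (toSphere z) = kl z := rfl

theorem klein_coe (w : ℂ) : klein (w : OnePoint ℂ) = kleinC w := rfl

theorem klein_infty : klein OnePoint.infty = Complex.I := rfl

theorem normSq_add_one_pos (w : ℂ) : 0 < Complex.normSq w + 1 := by
  have := Complex.normSq_nonneg w
  linarith

theorem continuous_kleinC : Continuous kleinC := by
  have h : kleinC = fun w : ℂ => ((2 * w.re / (Complex.normSq w + 1) : ℝ) : ℂ) +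
      ((Complex.normSq w - 1) / (Complex.normSq w + 1) : ℝ) * Complex.I := by
    funext w
    apply Complex.ext <;> simp only [kleinC, Complex.add_re, Complex.add_im, Complex.ofReal_re,
      Complex.ofReal_im, Complex.mul_re, Complex.mul_im, Complex.I_re, Complex.I_im] <;> ring
  rw [h]
  have h1 := Complex.continuous_normSq
  have h2 := Complex.continuous_re
  refine Continuous.add (Complex.continuous_ofReal.comp ?_)
    ((Complex.continuous_ofReal.comp ?_).mul continuous_const)
  · exact (continuous_const.mul h2).div (h1.add continuous_const)
      fun w => (normSq_add_one_pos w).ne'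
  · exact (h1.sub continuous_const).div (h1.add continuous_const)
      fun w => (normSq_add_one_pos w).ne'

theorem normSq_kleinC_sub_I (w : ℂ) :
    Complex.normSq (kleinC w - Complex.I) = 4 * (w.re ^ 2 + 1) / (Complex.normSq w + 1) ^ 2 := by
  have h := (normSq_add_one_pos w).ne'
  rw [Complex.normSq_apply]
  simp only [kleinC, Complex.sub_re, Complex.sub_im, Complex.I_re, Complex.I_im]
  field_simp
  ring

theorem continuous_klein : Continuous klein := by
  rw [OnePoint.continuous_iff]
  refine ⟨?_, continuous_kleinC⟩
  rw [Filter.coclosedCompact_eq_cocompact]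
  change Tendsto kleinC (cocompact ℂ) (𝓝 Complex.I)
  rw [tendsto_iff_norm_sub_tendsto_zero]
  have h1 : Tendsto (fun w : ℂ => ‖w‖ ^ 2 + 1) (cocompact ℂ) atTop :=
    tendsto_atTop_add_const_right _ _
      ((tendsto_pow_atTop two_ne_zero).comp (tendsto_norm_cocompact_atTop (E := ℂ)))
  have h2 : Tendsto (fun w : ℂ => Real.sqrt (4 / (‖w‖ ^ 2 + 1))) (cocompact ℂ) (𝓝 0) := by
    rw [← Real.sqrt_zero]
    exact (Real.continuous_sqrt.tendsto 0).comp (Tendsto.const_div_atTop h1 4)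
  refine squeeze_zero (fun _ => norm_nonneg _) (fun w => ?_) h2
  refine Real.le_sqrt_of_sq_le ?_
  rw [← Complex.normSq_eq_norm_sq, ← Complex.normSq_eq_norm_sq, normSq_kleinC_sub_I]
  have h3 := normSq_add_one_pos w
  rw [div_le_div_iff₀ (by positivity) h3]
  have : w.re ^ 2 + 1 ≤ Complex.normSq w + 1 := by
    rw [Complex.normSq_apply]; nlinarith [mul_self_nonneg w.im]
  nlinarith [mul_le_mul_of_nonneg_right this h3.le]

theorem continuous_kl : Continuous kl := continuous_kleinC.comp UpperHalfPlane.continuous_coe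

/-- The stereographic image of w lies on the unit sphere, and `kleinC` forgets one coordinate; the
right side is the square of that coordinate. -/
theorem one_sub_normSq_kleinC (w : ℂ) :
    1 - Complex.normSq (kleinC w) = (2 * w.im / (Complex.normSq w + 1)) ^ 2 := by
  have h := (normSq_add_one_pos w).ne'
  have h2 : Complex.normSq w = w.re * w.re + w.im * w.im := Complex.normSq_apply w
  rw [Complex.normSq_apply]
  simp only [kleinC]
  field_simp
  rw [h2]
  ring

theorem cosh_dist_I (z : ℍ) :
    Real.cosh (dist z UpperHalfPlane.I) = (Complex.normSq z + 1) / (2 * z.im) := by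
  have := z.im_pos.ne'
  rw [UpperHalfPlane.cosh_dist, Complex.dist_eq, ← Complex.normSq_eq_norm_sq,
    Complex.normSq_apply, Complex.normSq_apply]
  simp
  field_simp
  ring

/-- The dictionary between Euclidean distance to the unit circle and hyperbolic distance to the base
point. -/
theorem one_sub_norm_kl_sq (z : ℍ) :
    1 - ‖kl z‖ ^ 2 = 1 / Real.cosh (dist z UpperHalfPlane.I) ^ 2 := by
  have h := (normSq_add_one_pos z).ne'
  rw [← Complex.normSq_eq_norm_sq, kl, one_sub_normSq_kleinC, cosh_dist_I]
  have := z.im_pos.ne'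
  simp
  field_simp

theorem norm_kl_lt_one (z : ℍ) : ‖kl z‖ < 1 := by
  have h := one_sub_norm_kl_sq z
  have h2 : 0 < 1 / Real.cosh (dist z UpperHalfPlane.I) ^ 2 := by
    have := Real.cosh_pos (dist z UpperHalfPlane.I)
    positivity
  nlinarith [norm_nonneg (kl z)]

/-- The two sides differ by a sum of two squares. Hence points at bounded hyperbolic distance from
each other and far from the base point are exponentially close in the Klein disc. -/
theorem norm_kl_sub_sq_le (z w : ℍ) :
    ‖kl z - kl w‖ ^ 2 ≤ 2 * Real.cosh (dist z w) /
      (Real.cosh (dist z UpperHalfPlane.I) * Real.cosh (dist w UpperHalfPlane.I)) := by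
  rw [← Complex.normSq_eq_norm_sq, cosh_dist_I, cosh_dist_I, UpperHalfPlane.cosh_dist,
    Complex.dist_eq, ← Complex.normSq_eq_norm_sq]
  have hz := normSq_add_one_pos z
  have hw := normSq_add_one_pos w
  have hz' := z.im_pos
  have hw' := w.im_pos
  have key : 2 * (1 + Complex.normSq (z - w) / (2 * z.im * w.im)) /
      ((Complex.normSq z + 1) / (2 * z.im) * ((Complex.normSq w + 1) / (2 * w.im))) -
      Complex.normSq (kl z - kl w) =
      (2 * z.im / (Complex.normSq z + 1)) ^ 2 + (2 * w.im / (Complex.normSq w + 1)) ^ 2 := by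
    have e1 : Complex.normSq z = z.re * z.re + z.im * z.im := Complex.normSq_apply z
    have e2 : Complex.normSq w = w.re * w.re + w.im * w.im := Complex.normSq_apply w
    have e3 : Complex.normSq (z - w) = (z.re - w.re) * (z.re - w.re) +
      (z.im - w.im) * (z.im - w.im) := by
      rw [Complex.normSq_apply]; simp
    rw [e1] at hz
    rw [e2] at hw
    rw [Complex.normSq_apply (kl z - kl w)]
    simp only [kl, kleinC, Complex.sub_re, Complex.sub_im, UpperHalfPlane.coe_re, e1, e2, e3]
    field_simp
    ring
  have : 0 ≤ (2 * z.im / (Complex.normSq z + 1)) ^ 2 + (2 * w.im / (Complex.normSq w + 1)) ^ 2 := by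
    positivity
  linarith

theorem kleinC_ne_I (w : ℂ) : kleinC w ≠ Complex.I := fun h => by
  have h1 := normSq_kleinC_sub_I w
  have h2 := normSq_add_one_pos w
  rw [h, sub_self, map_zero] at h1
  have : 0 < 4 * (w.re ^ 2 + 1) / (Complex.normSq w + 1) ^ 2 := by positivity
  linarith

theorem kleinC_injOn : InjOn kleinC {w | 0 ≤ w.im} := by
  intro w hw w' hw' h
  have h1 := normSq_add_one_pos w
  have h2 := normSq_add_one_pos w'
  have hre : 2 * w.re / (Complex.normSq w + 1) = 2 * w'.re / (Complex.normSq w' + 1) :=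
    congrArg Complex.re h
  have him : (Complex.normSq w - 1) / (Complex.normSq w + 1) =
    (Complex.normSq w' - 1) / (Complex.normSq w' + 1) := congrArg Complex.im h
  rw [div_eq_div_iff h1.ne' h2.ne'] at hre him
  have hn : Complex.normSq w = Complex.normSq w' := by nlinarith
  rw [hn] at hre
  have hr : w.re = w'.re := by
    have := mul_right_cancel₀ h2.ne' hre
    linarith
  rw [Complex.normSq_apply, Complex.normSq_apply, hr] at hn
  refine Complex.ext hr ?_
  have h5 : (0:ℝ) ≤ w.im := hw
  have h6 : (0:ℝ) ≤ w'.im := hw'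
  nlinarith [mul_self_inj_of_nonneg h5 h6]

/-- The closed disc compactifying the hyperbolic plane, as a subset of the Riemann sphere. -/
def closedDisc : Set (OnePoint ℂ) := closure (range toSphere)

theorem isOpenEmbedding_toSphere : IsOpenEmbedding toSphere :=
  OnePoint.isOpenEmbedding_coe.comp UpperHalfPlane.isOpenEmbedding_coe

theorem im_nonneg_of_mem_closedDisc {w : ℂ} (h : (w : OnePoint ℂ) ∈ closedDisc) : 0 ≤ w.im := by
  by_contra! hw
  have ho : IsOpen ((fun w : ℂ => (w : OnePoint ℂ)) '' {w | w.im < 0}) :=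
    OnePoint.isOpenEmbedding_coe.isOpenMap _ (isOpen_lt Complex.continuous_im continuous_const)
  obtain ⟨_, ⟨v, hv, rfl⟩, ⟨z, hz⟩⟩ := mem_closure_iff.1 h _ ho ⟨w, hw, rfl⟩
  have hz' : (z : ℂ) = v := OnePoint.coe_injective hz
  have : 0 < (z : ℂ).im := z.im_pos
  rw [hz'] at this
  exact lt_asymm this hv

theorem klein_injOn : InjOn klein closedDisc := by
  intro x hx y hy h
  induction x using OnePoint.rec with
  | infty =>
    induction y using OnePoint.rec with
    | infty => rfl
    | coe y => exact absurd h.symm (kleinC_ne_I y)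
  | coe x =>
    induction y using OnePoint.rec with
    | infty => exact absurd h (kleinC_ne_I x)
    | coe y =>
      rw [kleinC_injOn (im_nonneg_of_mem_closedDisc hx) (im_nonneg_of_mem_closedDisc hy) h]

theorem kl_injective : Function.Injective kl := fun z w h =>
  UpperHalfPlane.ext (kleinC_injOn z.im_pos.le w.im_pos.le h)

/-- A continuous injection of a compact space. Limits in the closed disc, including those at
infinity, can therefore be tested in Klein coordinates. -/
theorem isClosedEmbedding_klein : IsClosedEmbedding (fun x : closedDisc => klein x) := by
  have : CompactSpace closedDisc := isCompact_iff_compactSpace.1 isClosed_closure.isCompact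
  exact Continuous.isClosedEmbedding (continuous_klein.comp continuous_subtype_val)
    fun x y h => Subtype.ext (klein_injOn x.2 y.2 h)

theorem toSphere_mem_closedDisc (z : ℍ) : toSphere z ∈ closedDisc := subset_closure ⟨z, rfl⟩

theorem tendsto_toSphere_iff {α : Type*} {l : Filter α} {c : α → ℍ} {ξ : OnePoint ℂ}
    (hξ : ξ ∈ closedDisc) :
    Tendsto (fun a => toSphere (c a)) l (𝓝 ξ) ↔ Tendsto (fun a => kl (c a)) l (𝓝 (klein ξ)) := by
  have h1 := isClosedEmbedding_klein.isInducing.tendsto_nhds_iff (l := l)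
    (f := fun a => (⟨toSphere (c a), toSphere_mem_closedDisc _⟩ : closedDisc)) (y := ⟨ξ, hξ⟩)
  have h2 := IsInducing.subtypeVal.tendsto_nhds_iff (l := l)
    (f := fun a => (⟨toSphere (c a), toSphere_mem_closedDisc _⟩ : closedDisc)) (y := ⟨ξ, hξ⟩)
  exact h2.symm.trans h1

theorem range_kl : range kl = Metric.ball 0 1 := by
  refine Subset.antisymm (range_subset_iff.2 fun z => by simpa using norm_kl_lt_one z) fun k hk => ?_
  have hk1 : Complex.normSq k < 1 := by
    rw [mem_ball_zero_iff] at hk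
    rw [Complex.normSq_eq_norm_sq]
    nlinarith [norm_nonneg k]
  have hk2 : k.re * k.re + k.im * k.im < 1 := by rwa [Complex.normSq_apply] at hk1
  have hk3 : 0 < 1 - k.im := by nlinarith [mul_self_nonneg k.re]
  have hs : 0 < 1 - Complex.normSq k := by linarith
  -- The witness lifts k to the hemisphere, with missing coordinate √(1 - |k|²), and projects back
  -- stereographically.
  refine ⟨⟨⟨k.re / (1 - k.im), √(1 - Complex.normSq k) / (1 - k.im)⟩,
    div_pos (Real.sqrt_pos.2 hs) hk3⟩, ?_⟩
  have hN : Complex.normSq (⟨k.re / (1 - k.im), √(1 - Complex.normSq k) / (1 - k.im)⟩ : ℂ) + 1 =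
      2 / (1 - k.im) := by
    rw [Complex.normSq_apply]
    field_simp
    rw [Real.sq_sqrt hs.le, Complex.normSq_apply]
    ring
  apply Complex.ext
  · simp only [kl, kleinC, hN]
    field_simp
  · have hN' := eq_sub_of_add_eq hN
    simp only [kl, kleinC, hN']
    field_simp
    ring

theorem isOpenEmbedding_kl : IsOpenEmbedding kl := by
  have h : IsEmbedding fun z : ℍ => (⟨toSphere z, toSphere_mem_closedDisc z⟩ : closedDisc) :=
    isOpenEmbedding_toSphere.isEmbedding.codRestrict _ _
  exact ⟨isClosedEmbedding_klein.isEmbedding.comp h, range_kl ▸ Metric.isOpen_ball⟩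

theorem idealBoundary_eq (X : Set ℍ) :
    idealBoundary X = closure (toSphere '' X) \ range toSphere := by
  rw [idealBoundary, frontier, isOpenEmbedding_toSphere.isOpen_range.interior_eq]
  ext ξ
  constructor
  · rintro ⟨h1, h2, h3⟩
    exact ⟨h1, h3⟩
  · rintro ⟨h1, h3⟩
    exact ⟨h1, closure_mono (image_subset_range _ _) h1, h3⟩

theorem mem_closedDisc_of_mem_idealBoundary {X : Set ℍ} {ξ : OnePoint ℂ}
    (h : ξ ∈ idealBoundary X) : ξ ∈ closedDisc :=
  closure_mono (image_subset_range _ _) h.1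

theorem norm_klein_of_mem_closedDisc {ξ : OnePoint ℂ} (h : ξ ∈ closedDisc)
    (h' : ξ ∉ range toSphere) : ‖klein ξ‖ = 1 := by
  induction ξ using OnePoint.rec with
  | infty => simp [klein_infty]
  | coe w =>
    have h1 := im_nonneg_of_mem_closedDisc h
    have h2 : w.im = 0 := by
      by_contra h3
      exact h' ⟨⟨w, lt_of_le_of_ne h1 (Ne.symm h3)⟩, rfl⟩
    have h3 := one_sub_normSq_kleinC w
    rw [h2, Complex.normSq_eq_norm_sq] at h3
    rw [klein_coe]
    have h4 : ‖kleinC w‖ ^ 2 = 1 := by linarith [show (2 * 0 / (Complex.normSq w + 1)) ^ 2 = 0 by simp]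
    exact (pow_eq_one_iff_of_nonneg (norm_nonneg _) two_ne_zero).1 h4

theorem norm_klein_idealBoundary {X : Set ℍ} (ξ : idealBoundary X) :
    ‖klein (ξ : OnePoint ℂ)‖ = 1 :=
  norm_klein_of_mem_closedDisc (mem_closedDisc_of_mem_idealBoundary ξ.2)
    ((idealBoundary_eq X).subset ξ.2).2

theorem klein_mem_closure {X : Set ℍ} (ξ : idealBoundary X) :
    klein (ξ : OnePoint ℂ) ∈ closure (kl '' X) := by
  have := map_mem_closure continuous_klein ξ.2.1 (t := kl '' X)
  refine this ?_
  rintro _ ⟨z, hz, rfl⟩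
  exact ⟨z, hz, rfl⟩

theorem klein_idealBoundary_injective (X : Set ℍ) :
    Function.Injective fun ξ : idealBoundary X => klein ξ := fun ξ η h =>
  Subtype.ext (klein_injOn (mem_closedDisc_of_mem_idealBoundary ξ.2)
    (mem_closedDisc_of_mem_idealBoundary η.2) h)

theorem exists_idealBoundary_of_mem_closure {X : Set ℍ} {u : ℂ} (hu : ‖u‖ = 1)
    (h : u ∈ closure (kl '' X)) : ∃ ξ : idealBoundary X, klein ξ = u := by
  have hK : IsCompact (closure (toSphere '' X)) := isClosed_closure.isCompact
  have h1 : kl '' X ⊆ klein '' closure (toSphere '' X) := by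
    rintro _ ⟨z, hz, rfl⟩
    exact ⟨toSphere z, subset_closure ⟨z, hz, rfl⟩, rfl⟩
  obtain ⟨ξ, hξ, rfl⟩ := closure_minimal h1 (hK.image continuous_klein).isClosed h
  refine ⟨⟨ξ, (idealBoundary_eq X).symm.subset ⟨hξ, ?_⟩⟩, rfl⟩
  rintro ⟨z, rfl⟩
  have := norm_kl_lt_one z
  rw [klein_toSphere] at hu
  linarith

/-! ### Geodesics and half-planes in the Klein model -/

/-- The unit speed parametrization of the imaginary axis. -/
noncomputable def vert (t : ℝ) : ℍ := ⟨⟨0, Real.exp t⟩, Real.exp_pos t⟩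

theorem isometry_vert : Isometry vert := UpperHalfPlane.isometry_vertical_line 0

theorem vert_zero : vert 0 = UpperHalfPlane.I := by
  apply UpperHalfPlane.ext
  apply Complex.ext <;> simp [vert]

theorem vert_re (t : ℝ) : (vert t).re = 0 := rfl

theorem vert_im (t : ℝ) : (vert t).im = Real.exp t := rfl

theorem eq_vert_of_re_eq_zero {z : ℍ} (h : z.re = 0) : z = vert (Real.log z.im) := by
  apply UpperHalfPlane.ext
  apply Complex.ext
  · exact h
  · exact (Real.exp_log z.im_pos).symm

/-- The denominator of a Möbius transformation is positive. -/
theorem sl2_denom_pos (A : SL(2, ℝ)) (z : ℍ) :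
    0 < (A 1 0 * z.re + A 1 1) ^ 2 + (A 1 0 * z.im) ^ 2 := by
  have hdet : A 0 0 * A 1 1 - A 0 1 * A 1 0 = 1 := by
    rw [← Matrix.det_fin_two]; exact A.2
  by_cases hc : A 1 0 = 0
  · have : A 1 1 ≠ 0 := fun h => by rw [hc, h] at hdet; simp at hdet
    have h2 : 0 < (A 1 1) ^ 2 := by positivity
    rw [hc]
    nlinarith
  · have h1 : 0 < (A 1 0 * z.im) ^ 2 := by
      have := z.im_pos
      have := mul_ne_zero hc this.ne'
      positivity
    nlinarith [sq_nonneg (A 1 0 * z.re + A 1 1)]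

theorem sl2_smul_coe (A : SL(2, ℝ)) (z : ℍ) :
    ((A • z : ℍ) : ℂ) = ⟨((A 0 0 * z.re + A 0 1) * (A 1 0 * z.re + A 1 1) +
        A 0 0 * A 1 0 * z.im ^ 2) / ((A 1 0 * z.re + A 1 1) ^ 2 + (A 1 0 * z.im) ^ 2),
      z.im / ((A 1 0 * z.re + A 1 1) ^ 2 + (A 1 0 * z.im) ^ 2)⟩ := by
  have hdet : A 0 0 * A 1 1 - A 0 1 * A 1 0 = 1 := by
    rw [← Matrix.det_fin_two]; exact A.2
  have hD := sl2_denom_pos A z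
  have hD' : Complex.normSq ((A 1 0 : ℂ) * z + (A 1 1 : ℂ)) =
      (A 1 0 * z.re + A 1 1) ^ 2 + (A 1 0 * z.im) ^ 2 := by
    rw [Complex.normSq_apply]; simp; ring
  have hA : ((A • z : ℍ) : ℂ) = ((A 0 0 : ℂ) * z + (A 0 1 : ℂ)) / ((A 1 0 : ℂ) * z + (A 1 1 : ℂ)) :=
    UpperHalfPlane.coe_specialLinearGroup_apply A z
  rw [hA]
  generalize A 0 0 = a at *
  generalize A 0 1 = b at *
  generalize A 1 0 = c at *
  generalize A 1 1 = d at *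
  obtain ⟨D, hDe⟩ : ∃ D, D = (c * z.re + d) ^ 2 + (c * z.im) ^ 2 := ⟨_, rfl⟩
  rw [← hDe] at hD hD' ⊢
  apply Complex.ext
  · rw [Complex.div_re, hD']
    simp
    field_simp
  · rw [Complex.div_im, hD']
    simp
    field_simp
    linear_combination hdet

theorem sl2_smul_im (A : SL(2, ℝ)) (z : ℍ) :
    (A • z : ℍ).im = z.im / ((A 1 0 * z.re + A 1 1) ^ 2 + (A 1 0 * z.im) ^ 2) :=
  congrArg Complex.im (sl2_smul_coe A z)

theorem sl2_smul_re (A : SL(2, ℝ)) (z : ℍ) :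
    (A • z : ℍ).re = ((A 0 0 * z.re + A 0 1) * (A 1 0 * z.re + A 1 1) +
        A 0 0 * A 1 0 * z.im ^ 2) / ((A 1 0 * z.re + A 1 1) ^ 2 + (A 1 0 * z.im) ^ 2) :=
  congrArg Complex.re (sl2_smul_coe A z)

theorem sl2_smul_normSq (A : SL(2, ℝ)) (z : ℍ) :
    Complex.normSq (A • z : ℍ) = ((A 0 0 * z.re + A 0 1) ^ 2 + (A 0 0 * z.im) ^ 2) /
      ((A 1 0 * z.re + A 1 1) ^ 2 + (A 1 0 * z.im) ^ 2) := by
  have hdet : A 0 0 * A 1 1 - A 0 1 * A 1 0 = 1 := by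
    rw [← Matrix.det_fin_two]; exact A.2
  have hD := sl2_denom_pos A z
  rw [sl2_smul_coe, Complex.normSq_apply]
  simp only
  generalize A 0 0 = a at *
  generalize A 0 1 = b at *
  generalize A 1 0 = c at *
  generalize A 1 1 = d at *
  obtain ⟨D, hDe⟩ : ∃ D, D = (c * z.re + d) ^ 2 + (c * z.im) ^ 2 := ⟨_, rfl⟩
  rw [← hDe] at hD ⊢
  field_simp
  rw [hDe]
  have hs : z.im ^ 2 = z.im ^ 2 * (a * d - b * c) ^ 2 := by rw [hdet]; ring
  linear_combination hs

theorem kl_smul_re (A : SL(2, ℝ)) (z : ℍ) : (kl (A • z)).re =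
    2 * ((A 0 0 * z.re + A 0 1) * (A 1 0 * z.re + A 1 1) + A 0 0 * A 1 0 * z.im ^ 2) /
    ((A 0 0 * z.re + A 0 1) ^ 2 + (A 0 0 * z.im) ^ 2 +
      ((A 1 0 * z.re + A 1 1) ^ 2 + (A 1 0 * z.im) ^ 2)) := by
  have hD := sl2_denom_pos A z
  simp only [kl, kleinC, UpperHalfPlane.coe_re]
  rw [sl2_smul_normSq, sl2_smul_re]
  generalize (A 1 0 * z.re + A 1 1) ^ 2 + (A 1 0 * z.im) ^ 2 = D at *
  have hN : 0 ≤ (A 0 0 * z.re + A 0 1) ^ 2 + (A 0 0 * z.im) ^ 2 := by positivity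
  generalize (A 0 0 * z.re + A 0 1) ^ 2 + (A 0 0 * z.im) ^ 2 = N at *
  have : N + D ≠ 0 := by positivity
  field_simp

theorem kl_smul_im (A : SL(2, ℝ)) (z : ℍ) : (kl (A • z)).im =
    ((A 0 0 * z.re + A 0 1) ^ 2 + (A 0 0 * z.im) ^ 2 -
      ((A 1 0 * z.re + A 1 1) ^ 2 + (A 1 0 * z.im) ^ 2)) /
    ((A 0 0 * z.re + A 0 1) ^ 2 + (A 0 0 * z.im) ^ 2 +
      ((A 1 0 * z.re + A 1 1) ^ 2 + (A 1 0 * z.im) ^ 2)) := by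
  have hD := sl2_denom_pos A z
  simp only [kl, kleinC]
  rw [sl2_smul_normSq]
  generalize (A 1 0 * z.re + A 1 1) ^ 2 + (A 1 0 * z.im) ^ 2 = D at *
  have hN : 0 ≤ (A 0 0 * z.re + A 0 1) ^ 2 + (A 0 0 * z.im) ^ 2 := by positivity
  generalize (A 0 0 * z.re + A 0 1) ^ 2 + (A 0 0 * z.im) ^ 2 = N at *
  have : N + D ≠ 0 := by positivity
  field_simp

/-- The point of the unit circle with homogeneous real coordinates `[a : c]`. -/
noncomputable def circlePt (a c : ℝ) : ℂ :=
  ⟨2 * (a * c) / (a ^ 2 + c ^ 2), (a ^ 2 - c ^ 2) / (a ^ 2 + c ^ 2)⟩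

theorem norm_circlePt {a c : ℝ} (h : 0 < a ^ 2 + c ^ 2) : ‖circlePt a c‖ = 1 := by
  have : Complex.normSq (circlePt a c) = 1 := by
    rw [Complex.normSq_apply]
    simp only [circlePt]
    field_simp
    ring
  rw [Complex.normSq_eq_norm_sq] at this
  exact (pow_eq_one_iff_of_nonneg (norm_nonneg _) two_ne_zero).1 this

theorem circlePt_ne {a b c d : ℝ} (hac : 0 < a ^ 2 + c ^ 2) (hbd : 0 < b ^ 2 + d ^ 2)
    (h : a * d - b * c ≠ 0) : circlePt b d ≠ circlePt a c := by
  intro he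
  have h1 : 2 * (b * d) / (b ^ 2 + d ^ 2) = 2 * (a * c) / (a ^ 2 + c ^ 2) := congrArg Complex.re he
  have h2 : (b ^ 2 - d ^ 2) / (b ^ 2 + d ^ 2) = (a ^ 2 - c ^ 2) / (a ^ 2 + c ^ 2) :=
    congrArg Complex.im he
  rw [div_eq_div_iff hbd.ne' hac.ne'] at h1 h2
  have h4 : (a * d - b * c) ^ 2 * (a ^ 2 + c ^ 2) = 0 := by
    linear_combination (-(a ^ 2 - c ^ 2) / 2) * h2 - (a * c) * h1
  rcases mul_eq_zero.1 h4 with h5 | h5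
  · exact h (pow_eq_zero_iff two_ne_zero |>.1 h5)
  · exact hac.ne' h5

/-- With ζ = a - ic of modulus one, `circlePt a c` equals iζ², so a square root of -iu provides the
coordinates. -/
theorem exists_circlePt {u : ℂ} (hu : ‖u‖ = 1) : ∃ a c : ℝ, a ^ 2 + c ^ 2 = 1 ∧ circlePt a c = u := by
  obtain ⟨ζ, hζ⟩ := IsAlgClosed.exists_pow_nat_eq (-Complex.I * u) (n := 2) two_pos
  have hn : ‖ζ‖ ^ 2 = 1 := by rw [← norm_pow, hζ]; simp [hu]
  have hn' : ζ.re ^ 2 + ζ.im ^ 2 = 1 := by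
    rw [← hn, ← Complex.normSq_eq_norm_sq, Complex.normSq_apply]; ring
  have h1 := congrArg Complex.re hζ
  have h2 := congrArg Complex.im hζ
  simp [pow_two] at h1 h2
  refine ⟨ζ.re, -ζ.im, by linarith, ?_⟩
  have : ζ.re ^ 2 + (-ζ.im) ^ 2 = 1 := by linarith
  apply Complex.ext
  · simp only [circlePt, this]; linarith
  · simp only [circlePt, this]; linarith

/-- Geodesics are chords: the columns of the matrix are homogeneous coordinates for the images of ∞
and 0, and these are the ends of the chord. -/
theorem kl_smul_vert (A : SL(2, ℝ)) (t : ℝ) :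
    kl (A • vert t) = AffineMap.lineMap (circlePt (A 0 1) (A 1 1)) (circlePt (A 0 0) (A 1 0))
      ((A 0 0 ^ 2 + A 1 0 ^ 2) * Real.exp (2 * t) /
        ((A 0 1 ^ 2 + A 1 1 ^ 2) + (A 0 0 ^ 2 + A 1 0 ^ 2) * Real.exp (2 * t))) := by
  have hdet : A 0 0 * A 1 1 - A 0 1 * A 1 0 = 1 := by
    rw [← Matrix.det_fin_two]; exact A.2
  have hP : 0 < A 0 0 ^ 2 + A 1 0 ^ 2 := by
    by_contra! h
    have h1 : A 0 0 = 0 := by nlinarith [sq_nonneg (A 0 0), sq_nonneg (A 1 0)]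
    have h2 : A 1 0 = 0 := by nlinarith [sq_nonneg (A 0 0), sq_nonneg (A 1 0)]
    rw [h1, h2] at hdet; simp at hdet
  have hQ : 0 < A 0 1 ^ 2 + A 1 1 ^ 2 := by
    by_contra! h
    have h1 : A 0 1 = 0 := by nlinarith [sq_nonneg (A 0 1), sq_nonneg (A 1 1)]
    have h2 : A 1 1 = 0 := by nlinarith [sq_nonneg (A 0 1), sq_nonneg (A 1 1)]
    rw [h1, h2] at hdet; simp at hdet
  have hE : Real.exp t ^ 2 = Real.exp (2 * t) := by rw [← Real.exp_nat_mul]; norm_num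
  have hE0 := Real.exp_pos (2 * t)
  have hS := add_pos hQ (mul_pos hP hE0)
  have e0 : (A 0 0 * (vert t).re + A 0 1) ^ 2 + (A 0 0 * (vert t).im) ^ 2 +
      ((A 1 0 * (vert t).re + A 1 1) ^ 2 + (A 1 0 * (vert t).im) ^ 2) =
      (A 0 1 ^ 2 + A 1 1 ^ 2) + (A 0 0 ^ 2 + A 1 0 ^ 2) * Real.exp (2 * t) := by
    rw [vert_re, vert_im, ← hE]; ring
  apply Complex.ext
  · rw [kl_smul_re, AffineMap.lineMap_apply, e0]
    simp only [vert_re, vert_im, hE, mul_zero, zero_add, vsub_eq_sub, vadd_eq_add,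
      Complex.add_re, Complex.smul_re, Complex.sub_re, circlePt, smul_eq_mul]
    generalize Real.exp (2 * t) = E at *
    obtain ⟨P, hPe⟩ : ∃ P, P = A 0 0 ^ 2 + A 1 0 ^ 2 := ⟨_, rfl⟩
    obtain ⟨Q, hQe⟩ : ∃ Q, Q = A 0 1 ^ 2 + A 1 1 ^ 2 := ⟨_, rfl⟩
    rw [← hPe] at hP ⊢
    rw [← hQe] at hQ ⊢
    have hS' : Q + P * E ≠ 0 := by positivity
    field_simp
    rw [hPe, hQe]
    ring
  · rw [kl_smul_im, AffineMap.lineMap_apply, e0]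
    simp only [vert_re, vert_im, mul_pow, hE, mul_zero, zero_add, vsub_eq_sub, vadd_eq_add,
      Complex.add_im, Complex.smul_im, Complex.sub_im, circlePt, smul_eq_mul]
    generalize Real.exp (2 * t) = E at *
    obtain ⟨P, hPe⟩ : ∃ P, P = A 0 0 ^ 2 + A 1 0 ^ 2 := ⟨_, rfl⟩
    obtain ⟨Q, hQe⟩ : ∃ Q, Q = A 0 1 ^ 2 + A 1 1 ^ 2 := ⟨_, rfl⟩
    rw [← hPe] at hP ⊢
    rw [← hQe] at hQ ⊢
    have hS' : Q + P * E ≠ 0 := by positivity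
    field_simp
    rw [hPe, hQe]
    ring

/-- `c` is a unit speed parametrization of the complete geodesic whose endpoints on the unit circle
(in the Klein model) are `v` and `u`. -/
structure IsGeodesicLine (c : ℝ → ℍ) (v u : ℂ) : Prop where
  isometry : Isometry c
  norm_left : ‖v‖ = 1
  norm_right : ‖u‖ = 1
  ne : v ≠ u
  param : ∃ θ : ℝ → ℝ, StrictMono θ ∧ Continuous θ ∧ range θ = Ioo 0 1 ∧
    Tendsto θ atBot (𝓝 0) ∧ Tendsto θ atTop (𝓝 1) ∧ ∀ t, kl (c t) = AffineMap.lineMap v u (θ t)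

theorem strictMono_param {P Q : ℝ} (hP : 0 < P) (hQ : 0 < Q) :
    StrictMono fun t : ℝ => P * Real.exp (2 * t) / (Q + P * Real.exp (2 * t)) := by
  intro s t hst
  have h1 : Real.exp (2 * s) < Real.exp (2 * t) := Real.exp_lt_exp.2 (by linarith)
  have h2 := Real.exp_pos (2 * s)
  have h3 := Real.exp_pos (2 * t)
  simp only
  rw [div_lt_div_iff₀ (by positivity) (by positivity)]
  nlinarith [mul_pos hP hQ]

theorem tendsto_param_atTop {P Q : ℝ} (hP : 0 < P) (hQ : 0 < Q) :
    Tendsto (fun t : ℝ => P * Real.exp (2 * t) / (Q + P * Real.exp (2 * t))) atTop (𝓝 1) := by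
  have h1 : Tendsto (fun t : ℝ => 1 - Q / (Q + P * Real.exp (2 * t))) atTop (𝓝 (1 - 0)) := by
    refine tendsto_const_nhds.sub (Tendsto.const_div_atTop ?_ Q)
    exact tendsto_atTop_add_const_left _ _ ((Real.tendsto_exp_atTop.comp
      (tendsto_id.const_mul_atTop two_pos)).const_mul_atTop hP)
  rw [sub_zero] at h1
  refine h1.congr fun t => ?_
  have h3 := Real.exp_pos (2 * t)
  field_simp
  ring

theorem tendsto_param_atBot {P Q : ℝ} (hQ : 0 < Q) :
    Tendsto (fun t : ℝ => P * Real.exp (2 * t) / (Q + P * Real.exp (2 * t))) atBot (𝓝 0) := by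
  have h1 : Tendsto (fun t : ℝ => P * Real.exp (2 * t)) atBot (𝓝 (P * 0)) :=
    (Real.tendsto_exp_atBot.comp (tendsto_id.const_mul_atBot two_pos)).const_mul P
  rw [mul_zero] at h1
  have h2 := h1.div (h1.const_add Q) (by simpa using hQ.ne')
  rw [add_zero, zero_div] at h2
  exact h2

theorem range_param {P Q : ℝ} (hP : 0 < P) (hQ : 0 < Q) :
    range (fun t : ℝ => P * Real.exp (2 * t) / (Q + P * Real.exp (2 * t))) = Ioo 0 1 := by
  ext s
  constructor
  · rintro ⟨t, rfl⟩
    have h3 := Real.exp_pos (2 * t)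
    have : 0 < P * Real.exp (2 * t) := by positivity
    exact ⟨by positivity, by simp only; rw [div_lt_one (by positivity)]; linarith⟩
  · rintro ⟨h0, h1⟩
    have h2 : 0 < 1 - s := by linarith
    refine ⟨Real.log (Q * s / (P * (1 - s))) / 2, ?_⟩
    simp only
    rw [mul_div_cancel₀ _ (two_ne_zero), Real.exp_log (by positivity)]
    field_simp
    ring

theorem continuous_param {P Q : ℝ} (hP : 0 < P) (hQ : 0 < Q) :
    Continuous fun t : ℝ => P * Real.exp (2 * t) / (Q + P * Real.exp (2 * t)) := by
  refine Continuous.div (by fun_prop) (by fun_prop) fun t => ?_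
  have h3 := Real.exp_pos (2 * t)
  positivity

theorem isGeodesicLine_smul_vert (A : SL(2, ℝ)) :
    IsGeodesicLine (fun t => A • vert t) (circlePt (A 0 1) (A 1 1)) (circlePt (A 0 0) (A 1 0)) := by
  have hdet : A 0 0 * A 1 1 - A 0 1 * A 1 0 = 1 := by
    rw [← Matrix.det_fin_two]; exact A.2
  have hP : 0 < A 0 0 ^ 2 + A 1 0 ^ 2 := by
    by_contra! h
    have h1 : A 0 0 = 0 := by nlinarith [sq_nonneg (A 0 0), sq_nonneg (A 1 0)]
    have h2 : A 1 0 = 0 := by nlinarith [sq_nonneg (A 0 0), sq_nonneg (A 1 0)]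
    rw [h1, h2] at hdet; simp at hdet
  have hQ : 0 < A 0 1 ^ 2 + A 1 1 ^ 2 := by
    by_contra! h
    have h1 : A 0 1 = 0 := by nlinarith [sq_nonneg (A 0 1), sq_nonneg (A 1 1)]
    have h2 : A 1 1 = 0 := by nlinarith [sq_nonneg (A 0 1), sq_nonneg (A 1 1)]
    rw [h1, h2] at hdet; simp at hdet
  exact ⟨(isometry_smul ℍ A).comp isometry_vert, norm_circlePt hQ, norm_circlePt hP,
    circlePt_ne hP hQ (by rw [hdet]; exact one_ne_zero),
    _, strictMono_param hP hQ, continuous_param hP hQ, range_param hP hQ, tendsto_param_atBot hQ,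
    tendsto_param_atTop hP hQ, fun t => kl_smul_vert A t⟩

/-- Rotations about the base point act on the Klein disc by Euclidean rotations, and the hypothesis
on k says that its modulus is tanh s, which is the modulus of `kl (vert s)`. -/
theorem exists_sl2_rotation {k : ℂ} {s : ℝ} (hs : 0 ≤ s) (hk : ‖k‖ ^ 2 = 1 - 1 / Real.cosh s ^ 2) :
    ∃ A : SL(2, ℝ), A • UpperHalfPlane.I = UpperHalfPlane.I ∧ kl (A • vert s) = k := by
  obtain ⟨e, he, hke⟩ : ∃ e : ℂ, ‖e‖ = 1 ∧ k = ‖k‖ * e := by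
    by_cases h : k = 0
    · exact ⟨1, by simp, by simp [h]⟩
    · have h' : (‖k‖ : ℂ) ≠ 0 := by exact_mod_cast norm_ne_zero_iff.2 h
      refine ⟨k / ‖k‖, ?_, ?_⟩
      · rw [norm_div, Complex.norm_real, norm_norm, div_self (norm_ne_zero_iff.2 h)]
      · field_simp
  have hkt : ‖k‖ = Real.tanh s := by
    have h1 : ‖k‖ ^ 2 = Real.tanh s ^ 2 := by
      rw [hk, Real.tanh_eq_sinh_div_cosh]
      have := Real.cosh_pos s
      field_simp
      linarith [Real.cosh_sq s]
    have h2 : 0 ≤ Real.tanh s := by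
      rw [Real.tanh_eq_sinh_div_cosh]
      exact div_nonneg (Real.sinh_nonneg_iff.2 hs) (Real.cosh_pos s).le
    exact (pow_left_inj₀ (norm_nonneg _) h2 two_ne_zero).1 h1
  obtain ⟨a, c, hac, hu⟩ := exists_circlePt he
  let A : SL(2, ℝ) := ⟨!![a, -c; c, a], by rw [Matrix.det_fin_two_of]; linarith⟩
  have h00 : A 0 0 = a := rfl
  have h01 : A 0 1 = -c := rfl
  have h10 : A 1 0 = c := rfl
  have h11 : A 1 1 = a := rfl
  have hac' : c ^ 2 + a ^ 2 = 1 := by linarith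
  refine ⟨A, ?_, ?_⟩
  · apply UpperHalfPlane.ext
    rw [sl2_smul_coe, h00, h01, h10, h11]
    apply Complex.ext
    · simp
      left
      ring
    · simp
      linarith
  · have hE : Real.exp s * Real.exp (-s) = 1 := by rw [← Real.exp_add]; simp
    have hp := Real.exp_pos s
    have hq := Real.exp_pos (-s)
    have hE2 : Real.exp (2 * s) = Real.exp s ^ 2 := by rw [← Real.exp_nat_mul]; norm_num
    have hT : Real.tanh s = (Real.exp s ^ 2 - 1) / (1 + Real.exp s ^ 2) := by
      rw [Real.tanh_eq_sinh_div_cosh, Real.sinh_eq, Real.cosh_eq]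
      have : Real.exp (-s) = 1 / Real.exp s := by field_simp; linarith
      rw [this]
      field_simp
      ring
    rw [hke, hkt, ← hu, kl_smul_vert, AffineMap.lineMap_apply, h00, h01, h10, h11, hE2, hT]
    have e1 : (-c) ^ 2 + a ^ 2 = 1 := by linarith
    rw [e1, hac]
    apply Complex.ext
    · simp only [vsub_eq_sub, vadd_eq_add, Complex.add_re, Complex.smul_re, Complex.sub_re,
        circlePt, smul_eq_mul, Complex.re_ofReal_mul, e1, hac]
      field_simp
      ring
    · simp only [vsub_eq_sub, vadd_eq_add, Complex.add_im, Complex.smul_im, Complex.sub_im,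
        circlePt, smul_eq_mul, Complex.im_ofReal_mul, e1, hac]
      field_simp
      ring

theorem exists_sl2_through (x y : ℍ) :
    ∃ A : SL(2, ℝ), A • vert 0 = x ∧ A • vert (dist x y) = y := by
  obtain ⟨B, hB⟩ : ∃ B : SL(2, ℝ), B • UpperHalfPlane.I = x := ⟨_, x.toSL2R_smul_I⟩
  have hd : dist (B⁻¹ • y) UpperHalfPlane.I = dist x y := by
    rw [← dist_smul B, smul_inv_smul, hB, dist_comm]
  obtain ⟨A, hA, hA'⟩ := exists_sl2_rotation (k := kl (B⁻¹ • y)) (s := dist x y) dist_nonneg (by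
    have := one_sub_norm_kl_sq (B⁻¹ • y)
    rw [hd] at this
    linarith)
  refine ⟨B * A, ?_, ?_⟩
  · rw [vert_zero, mul_smul, hA, hB]
  · rw [mul_smul, kl_injective hA', smul_inv_smul]

theorem cosh_dist_vert (y : ℍ) (s : ℝ) : Real.cosh (dist y (vert s)) =
    (Complex.normSq y + Real.exp s ^ 2) / (2 * y.im * Real.exp s) := by
  have h1 := y.im_pos
  have h2 := Real.exp_pos s
  rw [UpperHalfPlane.cosh_dist, Complex.dist_eq, ← Complex.normSq_eq_norm_sq,
    Complex.normSq_apply, Complex.normSq_apply]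
  have e1 : ((y : ℂ) - (vert s : ℂ)).re = y.re := by simp [vert]
  have e2 : ((y : ℂ) - (vert s : ℂ)).im = y.im - Real.exp s := by simp [vert]
  rw [e1, e2, vert_im]
  simp only [UpperHalfPlane.coe_re, UpperHalfPlane.coe_im]
  field_simp
  ring

/-- After moving c 0 and c 1 to the imaginary axis, the distances |t| and |t - 1| to these two
points determine the position of c t. -/
theorem exists_smul_vert_of_isometry {c : ℝ → ℍ} (hc : Isometry c) :
    ∃ A : SL(2, ℝ), ∀ t, c t = A • vert t := by
  obtain ⟨A, h0, h1⟩ := exists_sl2_through (c 0) (c 1)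
  have hd1 : dist (c 0) (c 1) = 1 := by rw [hc.dist_eq]; simp
  rw [hd1] at h1
  refine ⟨A, fun t => ?_⟩
  obtain ⟨y, hy⟩ : ∃ y, y = A⁻¹ • c t := ⟨_, rfl⟩
  have hct : c t = A • y := by rw [hy, smul_inv_smul]
  rw [hct]
  congr 1
  have d0 : dist y (vert 0) = |t| := by
    rw [← dist_smul A, ← hct, h0, hc.dist_eq, Real.dist_eq, sub_zero]
  have d1 : dist y (vert 1) = |t - 1| := by
    rw [← dist_smul A, ← hct, h1, hc.dist_eq, Real.dist_eq]
  have e0 := cosh_dist_vert y 0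
  have e1 := cosh_dist_vert y 1
  rw [d0, Real.cosh_abs, Real.exp_zero, Real.cosh_eq] at e0
  rw [d1, Real.cosh_abs, Real.cosh_eq] at e1
  have hy0 := y.im_pos
  have he := Real.exp_pos 1
  have ht := Real.exp_pos t
  have hmt : Real.exp (-t) = (Real.exp t)⁻¹ := Real.exp_neg t
  have ha : Real.exp (t - 1) = Real.exp t / Real.exp 1 := Real.exp_sub t 1
  have hb : Real.exp (-(t - 1)) = Real.exp 1 / Real.exp t := by
    rw [← Real.exp_sub]; congr 1; ring
  rw [hmt] at e0
  rw [ha, hb] at e1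
  have he1 : 1 < Real.exp 1 := Real.one_lt_exp_iff.2 one_pos
  generalize Real.exp 1 = e at *
  field_simp at e0 e1
  have hne : e ^ 2 - 1 ≠ 0 := by nlinarith
  -- Subtracting the two distance equations eliminates |y|²; either one of them then forces the real
  -- part to vanish.
  have him : y.im = Real.exp t := by
    have : (e ^ 2 - 1) * (y.im - Real.exp t) = 0 := by linear_combination e1 - e0
    rcases mul_eq_zero.1 this with h | h
    · exact absurd h hne
    · linarith
  have hre : y.re = 0 := by
    rw [Complex.normSq_apply] at e0
    simp only [UpperHalfPlane.coe_re, UpperHalfPlane.coe_im] at e0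
    rw [him] at e0
    have : Real.exp t * (y.re * y.re) = 0 := by linear_combination -e0
    rcases mul_eq_zero.1 this with h | h
    · exact absurd h ht.ne'
    · exact mul_self_eq_zero.1 h
  rw [eq_vert_of_re_eq_zero hre, him, Real.log_exp]

theorem Isometry.exists_isGeodesicLine {c : ℝ → ℍ} (hc : Isometry c) :
    ∃ v u, IsGeodesicLine c v u := by
  obtain ⟨A, hA⟩ := exists_smul_vert_of_isometry hc
  have : c = fun t => A • vert t := funext hA
  exact ⟨_, _, this ▸ isGeodesicLine_smul_vert A⟩

theorem exists_isGeodesicLine {v u : ℂ} (hv : ‖v‖ = 1) (hu : ‖u‖ = 1) (hne : v ≠ u) :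
    ∃ c, IsGeodesicLine c v u := by
  obtain ⟨b, d, hbd, rfl⟩ := exists_circlePt hv
  obtain ⟨a, c, hac, rfl⟩ := exists_circlePt hu
  have hdet : a * d - b * c ≠ 0 := fun h => by
    have h1 : (a * b + c * d) ^ 2 = 1 := by
      have : (a * d - b * c) ^ 2 + (a * b + c * d) ^ 2 = (a ^ 2 + c ^ 2) * (b ^ 2 + d ^ 2) := by ring
      rw [h, hbd, hac] at this
      linarith
    have hb : b = (a * b + c * d) * a := by linear_combination (-b) * hac - c * h
    have hd : d = (a * b + c * d) * c := by linear_combination (-d) * hac + a * h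
    refine hne ?_
    have e1 : b * d = a * c := by
      linear_combination d * hb + (a * b + c * d) * a * hd + a * c * h1
    have e2 : b ^ 2 = a ^ 2 := by
      linear_combination (b + (a * b + c * d) * a) * hb + a ^ 2 * h1
    have e3 : d ^ 2 = c ^ 2 := by
      linear_combination (d + (a * b + c * d) * c) * hd + c ^ 2 * h1
    unfold circlePt
    rw [e1, e2, e3]
  -- Rescaling the second column makes the determinant one and leaves the corresponding point of the
  -- circle unchanged.
  let A : SL(2, ℝ) := ⟨!![a, b / (a * d - b * c); c, d / (a * d - b * c)], by
    rw [Matrix.det_fin_two_of]; field_simp⟩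
  have h := isGeodesicLine_smul_vert A
  have h01 : A 0 1 = b / (a * d - b * c) := rfl
  have h11 : A 1 1 = d / (a * d - b * c) := rfl
  have e : circlePt (A 0 1) (A 1 1) = circlePt b d := by
    rw [h01, h11, circlePt, circlePt]
    clear_value A
    clear h h01 h11
    generalize a * d - b * c = δ at *
    have h2 : (b / δ) ^ 2 + (d / δ) ^ 2 = 1 / δ ^ 2 := by
      rw [div_pow, div_pow, ← add_div, hbd]
    rw [h2, hbd]
    congr 1 <;> field_simp
  exact ⟨_, e ▸ h⟩

namespace IsGeodesicLine

variable {c c' : ℝ → ℍ} {v u v' u' : ℂ}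

theorem range_kl (h : IsGeodesicLine c v u) : range (fun t => kl (c t)) = openSegment ℝ v u := by
  obtain ⟨θ, -, -, hr, -, -, hk⟩ := h.param
  rw [openSegment_eq_image_lineMap, ← hr, ← range_comp]
  congr 1
  funext t
  exact hk t

theorem mem_range_iff (h : IsGeodesicLine c v u) {z : ℍ} :
    z ∈ range c ↔ kl z ∈ openSegment ℝ v u := by
  rw [← h.range_kl]
  constructor
  · rintro ⟨t, rfl⟩
    exact ⟨t, rfl⟩
  · rintro ⟨t, ht⟩
    exact ⟨t, kl_injective ht⟩

theorem tendsto_left (h : IsGeodesicLine c v u) : Tendsto (fun t => kl (c t)) atBot (𝓝 v) := by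
  obtain ⟨θ, -, -, -, h0, -, hk⟩ := h.param
  have h1 : Continuous (AffineMap.lineMap v u : ℝ → ℂ) := AffineMap.lineMap_continuous
  have h2 := (h1.tendsto 0).comp h0
  rw [AffineMap.lineMap_apply_zero] at h2
  exact h2.congr fun t => (hk t).symm

theorem tendsto_right (h : IsGeodesicLine c v u) : Tendsto (fun t => kl (c t)) atTop (𝓝 u) := by
  obtain ⟨θ, -, -, -, -, h0, hk⟩ := h.param
  have h1 : Continuous (AffineMap.lineMap v u : ℝ → ℂ) := AffineMap.lineMap_continuous
  have h2 := (h1.tendsto 1).comp h0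
  rw [AffineMap.lineMap_apply_one] at h2
  exact h2.congr fun t => (hk t).symm

theorem mem_segment (h : IsGeodesicLine c v u) {r s t : ℝ} (hrs : r ≤ s) (hst : s ≤ t) :
    kl (c s) ∈ segment ℝ (kl (c r)) (kl (c t)) := by
  obtain ⟨θ, hm, -, -, -, -, hk⟩ := h.param
  rw [hk, hk, hk, ← image_segment]
  refine mem_image_of_mem _ ?_
  rw [segment_eq_Icc (hm.monotone (hrs.trans hst))]
  exact ⟨hm.monotone hrs, hm.monotone hst⟩

theorem openSegment_subset_ball (h : IsGeodesicLine c v u) :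
    openSegment ℝ v u ⊆ Metric.ball 0 1 := by
  rw [← h.range_kl]
  rintro _ ⟨t, rfl⟩
  simpa using norm_kl_lt_one (c t)

theorem eq_or_eq_of_mem_segment (h : IsGeodesicLine c v u) {x : ℂ} (hx : ‖x‖ = 1)
    (hxs : x ∈ segment ℝ v u) : x = v ∨ x = u := by
  rw [← insert_endpoints_openSegment] at hxs
  rcases hxs with h1 | h1 | h1
  · exact Or.inl h1
  · exact Or.inr h1
  · have := h.openSegment_subset_ball h1
    rw [mem_ball_zero_iff, hx] at this
    exact absurd this (lt_irrefl _)

/-- The limits at infinity of points of a geodesic line are its endpoints. -/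
theorem endpoints_of_tendsto (h' : IsGeodesicLine c' v' u') {α : Type*} {l : Filter α} [l.NeBot]
    {g : α → ℍ} {x : ℂ} (hx : ‖x‖ = 1) (hg : ∀ᶠ a in l, g a ∈ range c')
    (ht : Tendsto (fun a => kl (g a)) l (𝓝 x)) : x = v' ∨ x = u' := by
  refine h'.eq_or_eq_of_mem_segment hx ?_
  have hcl : IsClosed (segment ℝ v' u') := by
    rw [segment_eq_image_lineMap]
    exact (isCompact_Icc.image AffineMap.lineMap_continuous).isClosed
  refine hcl.mem_of_tendsto ht (hg.mono fun a ha => ?_)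
  exact openSegment_subset_segment _ _ _ (h'.mem_range_iff.1 ha)

/-- A geodesic line contained in another one has the same endpoints. -/
theorem endpoints_of_range_subset (h : IsGeodesicLine c v u) (h' : IsGeodesicLine c' v' u')
    (hs : range c ⊆ range c') : (v = v' ∧ u = u') ∨ (v = u' ∧ u = v') := by
  have h1 := h'.endpoints_of_tendsto h.norm_left (Eventually.of_forall fun t => hs ⟨t, rfl⟩)
    h.tendsto_left
  have h2 := h'.endpoints_of_tendsto h.norm_right (Eventually.of_forall fun t => hs ⟨t, rfl⟩)
    h.tendsto_right
  rcases h1 with h1 | h1 <;> rcases h2 with h2 | h2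
  · exact absurd (h1.trans h2.symm) h.ne
  · exact Or.inl ⟨h1, h2⟩
  · exact Or.inr ⟨h1, h2⟩
  · exact absurd (h1.trans h2.symm) h.ne

theorem range_eq_of_endpoints (h : IsGeodesicLine c v u) (h' : IsGeodesicLine c' v' u')
    (he : (v = v' ∧ u = u') ∨ (v = u' ∧ u = v')) : range c = range c' := by
  ext z
  rw [h.mem_range_iff, h'.mem_range_iff]
  rcases he with ⟨rfl, rfl⟩ | ⟨rfl, rfl⟩
  · rfl
  · rw [openSegment_symm]

theorem range_eq_of_subset (h : IsGeodesicLine c v u) (h' : IsGeodesicLine c' v' u')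
    (hs : range c ⊆ range c') : range c = range c' :=
  h.range_eq_of_endpoints h' (h.endpoints_of_range_subset h' hs)

/-- A geodesic line staying, near one of its points, on one side of a line through that point, is
contained in that line. -/
theorem eq_zero_of_nonneg_nhds (h : IsGeodesicLine c v u) {L : ℂ →L[ℝ] ℝ} {m t₀ : ℝ}
    (h0 : L (kl (c t₀)) + m = 0) (hn : ∀ᶠ t in 𝓝 t₀, 0 ≤ L (kl (c t)) + m) (t : ℝ) :
    L (kl (c t)) + m = 0 := by
  obtain ⟨θ, hm, -, -, -, -, hk⟩ := h.param
  have hL : ∀ t, L (kl (c t)) + m = (θ t - θ t₀) * L (u - v) := fun t => by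
    have e1 : L (kl (c t)) - L (kl (c t₀)) = (θ t - θ t₀) * L (u - v) := by
      rw [hk, hk, AffineMap.lineMap_apply, AffineMap.lineMap_apply]
      simp only [vsub_eq_sub, vadd_eq_add, map_add, map_smul, smul_eq_mul]
      ring
    linarith
  obtain ⟨ε, hε, hb⟩ := Metric.eventually_nhds_iff.1 hn
  have h1 := hb (y := t₀ + ε / 2) (by rw [Real.dist_eq]; simp; rw [abs_of_pos] <;> linarith)
  have h2 := hb (y := t₀ - ε / 2) (by rw [Real.dist_eq]; simp; rw [abs_of_pos] <;> linarith)
  rw [hL] at h1 h2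
  have h3 : θ t₀ < θ (t₀ + ε / 2) := hm (by linarith)
  have h4 : θ (t₀ - ε / 2) < θ t₀ := hm (by linarith)
  have h5 : L (u - v) = 0 := by
    have h6 := nonneg_of_mul_nonneg_right h1 (by linarith)
    nlinarith
  rw [hL, h5, mul_zero]

end IsGeodesicLine

/-- Half-planes are given by affine functionals in the Klein model. -/
theorem exists_functional_of_sl2 (A : SL(2, ℝ)) : ∃ (L : ℂ →L[ℝ] ℝ) (m : ℝ), L ≠ 0 ∧
    ∀ z : ℍ, ∃ ρ > 0, (A • z).re = ρ * (L (kl z) + m) := by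
  have hdet : A 0 0 * A 1 1 - A 0 1 * A 1 0 = 1 := by
    rw [← Matrix.det_fin_two]; exact A.2
  refine ⟨(A 0 0 * A 1 1 + A 0 1 * A 1 0) • Complex.reCLM +
    (A 0 0 * A 1 0 - A 0 1 * A 1 1) • Complex.imCLM, A 0 0 * A 1 0 + A 0 1 * A 1 1, ?_, ?_⟩
  · intro h
    have h1 := DFunLike.congr_fun h 1
    have h2 := DFunLike.congr_fun h Complex.I
    simp at h1 h2
    have e1 : A 0 0 * A 1 1 = 1 / 2 := by linarith
    have e2 : A 0 1 * A 1 0 = -1 / 2 := by linarith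
    have e3 : (A 0 0 * A 1 0) ^ 2 = -1 / 4 := by
      linear_combination (A 0 0 * A 1 0) * h2 + (A 0 1 * A 1 0) * e1 + (1 / 2) * e2
    nlinarith [sq_nonneg (A 0 0 * A 1 0)]
  · intro z
    have hD := sl2_denom_pos A z
    have hN := normSq_add_one_pos z
    refine ⟨(Complex.normSq z + 1) / (2 * ((A 1 0 * z.re + A 1 1) ^ 2 + (A 1 0 * z.im) ^ 2)),
      by positivity, ?_⟩
    rw [sl2_smul_re]
    generalize (A 1 0 * z.re + A 1 1) ^ 2 + (A 1 0 * z.im) ^ 2 = D at *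
    simp only [kl, kleinC, add_apply, smul_apply,
      Complex.reCLM_apply, Complex.imCLM_apply, smul_eq_mul, UpperHalfPlane.coe_re]
    have e1 : Complex.normSq (z : ℂ) = z.re ^ 2 + z.im ^ 2 := by
      rw [Complex.normSq_apply, pow_two, pow_two]; rfl
    have hs : z.im ^ 2 = Complex.normSq (z : ℂ) - z.re ^ 2 := by linarith
    rw [hs]
    generalize Complex.normSq (z : ℂ) = N at *
    field_simp
    ring

/-- The complete geodesic bounding a half-plane. -/
theorem exists_isGeodesicLine_of_sl2 (A : SL(2, ℝ)) : ∃ (c : ℝ → ℍ) (v u : ℂ),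
    IsGeodesicLine c v u ∧ ∀ z : ℍ, z ∈ range c ↔ (A • z).re = 0 := by
  refine ⟨_, _, _, isGeodesicLine_smul_vert A⁻¹, fun z => ⟨?_, fun h => ?_⟩⟩
  · rintro ⟨t, rfl⟩
    simp only [smul_inv_smul]
    rfl
  · exact ⟨Real.log (A • z).im, by
      simp only
      rw [← eq_vert_of_re_eq_zero h, inv_smul_smul]⟩

theorem Isometry.exists_functional {c : ℝ → ℍ} (hc : Isometry c) :
    ∃ (L : ℂ →L[ℝ] ℝ) (m : ℝ), L ≠ 0 ∧ ∀ z : ℍ, z ∈ range c ↔ L (kl z) + m = 0 := by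
  obtain ⟨A, hA⟩ := exists_smul_vert_of_isometry hc
  obtain ⟨L, m, hL, h⟩ := exists_functional_of_sl2 A⁻¹
  refine ⟨L, m, hL, fun z => ?_⟩
  obtain ⟨ρ, hρ, he⟩ := h z
  have h1 : L (kl z) + m = 0 ↔ (A⁻¹ • z).re = 0 := by
    rw [he, mul_eq_zero]
    exact ⟨Or.inr, fun h => h.resolve_left hρ.ne'⟩
  rw [h1]
  constructor
  · rintro ⟨t, rfl⟩
    rw [hA, inv_smul_smul]
    rfl
  · intro h2
    exact ⟨Real.log (A⁻¹ • z).im, by rw [hA, ← eq_vert_of_re_eq_zero h2, smul_inv_smul]⟩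

/-- Any two points are joined by a geodesic, which is a segment in the Klein model. -/
theorem exists_geodesic_segment (x y : ℍ) : ∃ c : ℝ → ℍ, Isometry c ∧ c 0 = x ∧ c (dist x y) = y ∧
    ∀ t ∈ Icc 0 (dist x y), kl (c t) ∈ segment ℝ (kl x) (kl y) := by
  obtain ⟨A, h0, h1⟩ := exists_sl2_through x y
  have h := isGeodesicLine_smul_vert A
  refine ⟨_, h.isometry, h0, h1, fun t ht => ?_⟩
  have := h.mem_segment ht.1 ht.2
  simp only [h0, h1] at this
  exact this

section Line

variable {X : Set ℍ}

theorem klein_ne_of_not_isDiag {ξ η : idealBoundary X} (h : ¬ (s(ξ, η)).IsDiag) :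
    klein (ξ : OnePoint ℂ) ≠ klein η := fun he =>
  h (Sym2.mk_isDiag_iff.2 (klein_idealBoundary_injective X he))

theorem GeodesicSpace.exists_rep (q : GeodesicSpace X) : ∃ ξ η : idealBoundary X,
    q.1 = s(ξ, η) ∧ ∃ c, IsGeodesicLine c (klein ξ) (klein η) := by
  obtain ⟨q, hq⟩ := q
  induction q using Sym2.inductionOn with
  | hf ξ η =>
    exact ⟨ξ, η, rfl, exists_isGeodesicLine (norm_klein_idealBoundary ξ)
      (norm_klein_idealBoundary η) (klein_ne_of_not_isDiag hq)⟩

/-- Isometric parametrizations with the same pair of limits trace the same chord, so the line may be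
computed from any one of them. -/
theorem GeodesicSpace.line_eq {q : GeodesicSpace X} {ξ η : idealBoundary X} (hq : q.1 = s(ξ, η))
    {c : ℝ → ℍ} (hc : IsGeodesicLine c (klein ξ) (klein η)) : q.line = range c := by
  ext z
  constructor
  · rintro ⟨c', hc', hz, ξ', η', hq', h1, h2⟩
    obtain ⟨v, u, hg⟩ := hc'.exists_isGeodesicLine
    rw [tendsto_toSphere_iff (mem_closedDisc_of_mem_idealBoundary ξ'.2)] at h1
    rw [tendsto_toSphere_iff (mem_closedDisc_of_mem_idealBoundary η'.2)] at h2
    have e1 := tendsto_nhds_unique h1 hg.tendsto_left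
    have e2 := tendsto_nhds_unique h2 hg.tendsto_right
    have e3 : range c' = range c := by
      refine hg.range_eq_of_endpoints hc ?_
      rw [← e1, ← e2]
      rw [hq, Sym2.eq_iff] at hq'
      rcases hq' with ⟨rfl, rfl⟩ | ⟨rfl, rfl⟩
      · exact Or.inl ⟨rfl, rfl⟩
      · exact Or.inr ⟨rfl, rfl⟩
    exact e3 ▸ hz
  · intro hz
    exact ⟨c, hc.isometry, hz, ξ, η, hq,
      (tendsto_toSphere_iff (mem_closedDisc_of_mem_idealBoundary ξ.2)).2 hc.tendsto_left,
      (tendsto_toSphere_iff (mem_closedDisc_of_mem_idealBoundary η.2)).2 hc.tendsto_right⟩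

theorem mem_closure_of_kl_mem_closure {z : ℍ} (h : kl z ∈ closure (kl '' X)) : z ∈ closure X := by
  rw [isOpenEmbedding_kl.isInducing.closure_eq_preimage_closure_image]
  exact h

theorem GeodesicSpace.line_subset (hX : IsClosed X) (hconv : Convex ℝ (kl '' X))
    (q : GeodesicSpace X) : q.line ⊆ X := by
  obtain ⟨ξ, η, hq, c, hc⟩ := q.exists_rep
  rw [GeodesicSpace.line_eq hq hc]
  intro z hz
  rw [← hX.closure_eq]
  refine mem_closure_of_kl_mem_closure ?_
  exact hconv.closure.openSegment_subset (klein_mem_closure ξ) (klein_mem_closure η)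
    (hc.mem_range_iff.1 hz)

/-- A complete geodesic contained in `X` determines a point of the space of geodesics of `X`. -/
theorem IsGeodesicLine.exists_geodesicSpace {c : ℝ → ℍ} {v u : ℂ} (hc : IsGeodesicLine c v u)
    (hX : range c ⊆ X) : ∃ q : GeodesicSpace X, q.line = range c ∧
      ∃ ξ η : idealBoundary X, q.1 = s(ξ, η) ∧ klein ξ = v ∧ klein η = u := by
  have h1 : v ∈ closure (kl '' X) := mem_closure_of_tendsto hc.tendsto_left
    (Eventually.of_forall fun t => ⟨c t, hX ⟨t, rfl⟩, rfl⟩)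
  have h2 : u ∈ closure (kl '' X) := mem_closure_of_tendsto hc.tendsto_right
    (Eventually.of_forall fun t => ⟨c t, hX ⟨t, rfl⟩, rfl⟩)
  obtain ⟨ξ, rfl⟩ := exists_idealBoundary_of_mem_closure hc.norm_left h1
  obtain ⟨η, rfl⟩ := exists_idealBoundary_of_mem_closure hc.norm_right h2
  have hd : ¬ (s(ξ, η)).IsDiag := fun h => hc.ne (by rw [Sym2.mk_isDiag_iff.1 h])
  exact ⟨⟨s(ξ, η), hd⟩, GeodesicSpace.line_eq (q := ⟨s(ξ, η), hd⟩) rfl hc, ξ, η, rfl, rfl, rfl⟩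

theorem GeodesicSpace.eq_of_line_eq {q q' : GeodesicSpace X} (h : q.line = q'.line) : q = q' := by
  obtain ⟨ξ, η, hq, c, hc⟩ := q.exists_rep
  obtain ⟨ξ', η', hq', c', hc'⟩ := q'.exists_rep
  rw [GeodesicSpace.line_eq hq hc, GeodesicSpace.line_eq hq' hc'] at h
  refine Subtype.ext ?_
  rw [hq, hq', Sym2.eq_iff]
  have hi := klein_idealBoundary_injective X
  rcases hc.endpoints_of_range_subset hc' h.subset with ⟨h1, h2⟩ | ⟨h1, h2⟩
  · exact Or.inl ⟨hi h1, hi h2⟩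
  · exact Or.inr ⟨hi h1, hi h2⟩

end Line

/-! ### Universal covers of compact hyperbolic surfaces are closed convex subsets -/

theorem not_eventually_nonneg_re {A : SL(2, ℝ)} {z : ℍ} (h : (A • z).re = 0) :
    ¬ ∀ᶠ w in 𝓝 z, 0 ≤ (A • w).re := by
  intro hn
  have h1 : ∀ᶠ w in 𝓝 (A • z), 0 ≤ w.re := by
    have h2 : Tendsto (fun w : ℍ => A⁻¹ • w) (𝓝 (A • z)) (𝓝 z) := by
      have := (continuous_const_smul (T := ℍ) A⁻¹).tendsto (A • z)
      rwa [inv_smul_smul] at this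
    filter_upwards [h2.eventually hn] with w hw
    rwa [smul_inv_smul] at hw
  have h3 := UpperHalfPlane.isOpenMap_re.image_mem_nhds h1
  rw [h] at h3
  obtain ⟨ε, hε, hb⟩ := Metric.mem_nhds_iff.1 h3
  obtain ⟨w, hw, hw'⟩ := hb (show -(ε / 2) ∈ Metric.ball (0 : ℝ) ε by
    rw [Metric.mem_ball, Real.dist_eq, sub_zero, abs_neg, abs_of_pos] <;> linarith)
  have : 0 ≤ w.re := hw
  linarith

namespace UniversalCover

variable {S : Type*} [TopologicalSpace S] {h : HyperbolicMetric S} (U : UniversalCover h)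

/-- The chart composed with the projection is a local homeomorphism to the half-plane and agrees
near z with a Möbius map A. Charts take values in the half-plane, which gives one inclusion;
openness of the composite gives the other. -/
theorem local_model (z : U.carrier) {φ : OpenPartialHomeomorph S HypHalfPlane}
    (hφ : φ ∈ h.charts) (hz : U.proj z ∈ φ.source) :
    ∃ A : SL(2, ℝ), (φ (U.proj z) : ℍ) = A • (z : ℍ) ∧
      ∀ᶠ w in 𝓝 (z : ℍ), (w ∈ U.carrier ↔ 0 ≤ (A • w).re) := by
  obtain ⟨A, hA⟩ := U.localIsometry z φ hφ hz
  refine ⟨A, hA.self_of_nhds, ?_⟩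
  have h1 : ∀ᶠ w in 𝓝 (z : ℍ), ∀ a : U.carrier, (a : ℍ) = w → (φ (U.proj a) : ℍ) = A • (a : ℍ) := by
    rw [nhds_subtype_eq_comap] at hA
    exact eventually_comap.1 hA
  have hmap : map (fun w => φ (U.proj w)) (𝓝 z) = 𝓝 (φ (U.proj z)) := by
    have e1 := U.isCoveringMap.isLocalHomeomorph.map_nhds_eq z
    have e2 := φ.map_nhds_eq hz
    rw [← e2, ← e1, map_map]
    rfl
  have h2 : (fun w => φ (U.proj w)) '' {w | (φ (U.proj w) : ℍ) = A • (w : ℍ)} ∈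
      𝓝 (φ (U.proj z)) := by
    rw [← hmap]
    exact image_mem_map hA
  rw [nhds_subtype_eq_comap, hA.self_of_nhds] at h2
  have h3 := eventually_comap.1 h2
  have h4 := ((continuous_const_smul (T := ℍ) A).tendsto (z : ℍ)).eventually h3
  filter_upwards [h1, h4] with w hw1 hw4
  constructor
  · intro hw
    rw [← hw1 ⟨w, hw⟩ rfl]
    exact (φ (U.proj ⟨w, hw⟩)).2
  · intro hw
    obtain ⟨w', hw', he⟩ := hw4 ⟨A • w, hw⟩ rfl
    have h5 : (φ (U.proj w') : ℍ) = A • w := congrArg Subtype.val he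
    rw [show (φ (U.proj w') : ℍ) = A • (w' : ℍ) from hw'] at h5
    rw [← smul_left_cancel A h5]
    exact w'.2

theorem mem_interior_iff (z : U.carrier) :
    (z : ℍ) ∈ interior U.carrier ↔ U.proj z ∉ h.boundary := by
  constructor
  · rintro hz ⟨φ, hφ, hs, h0⟩
    obtain ⟨A, hA, hw⟩ := U.local_model z hφ hs
    refine not_eventually_nonneg_re (hA ▸ h0) ?_
    filter_upwards [hw, mem_interior_iff_mem_nhds.1 hz] with w h1 h2 using h1.1 h2
  · intro hz
    obtain ⟨φ, hφ, hs⟩ := h.cover (U.proj z)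
    obtain ⟨A, hA, hw⟩ := U.local_model z hφ hs
    have h0 : (A • (z : ℍ)).re ≠ 0 := fun h0 => hz ⟨φ, hφ, hs, hA ▸ h0⟩
    have h1 : 0 < (A • (z : ℍ)).re := lt_of_le_of_ne (hw.self_of_nhds.1 z.2) h0.symm
    rw [mem_interior_iff_mem_nhds]
    have h2 : ∀ᶠ w in 𝓝 (z : ℍ), 0 < (A • w).re :=
      (UpperHalfPlane.continuous_re.comp (continuous_const_smul A)).continuousAt.eventually
        (lt_mem_nhds h1)
    filter_upwards [hw, h2] with w h1 h2 using h1.2 h2.le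

/-- The local model of the universal cover, in Klein coordinates. -/
theorem klein_local_model (z : U.carrier) : ∃ (L : ℂ →L[ℝ] ℝ) (m : ℝ), L ≠ 0 ∧
    (∀ᶠ k in 𝓝 (kl z), (k ∈ kl '' U.carrier ↔ 0 ≤ L k + m)) ∧
    (((z : ℍ) ∉ interior U.carrier) → L (kl z) + m = 0) ∧
    ∃ c v u, IsGeodesicLine c v u ∧ ∀ w : ℍ, w ∈ range c ↔ L (kl w) + m = 0 := by
  obtain ⟨φ, hφ, hs⟩ := h.cover (U.proj z)
  obtain ⟨A, hA, hw⟩ := U.local_model z hφ hs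
  obtain ⟨L, m, hL, hρ⟩ := exists_functional_of_sl2 A
  have hre : ∀ w : ℍ, (A • w).re = 0 ↔ L (kl w) + m = 0 := fun w => by
    obtain ⟨ρ, hρ0, he⟩ := hρ w
    rw [he, mul_eq_zero]
    exact ⟨fun h => h.resolve_left hρ0.ne', Or.inr⟩
  have hre' : ∀ w : ℍ, 0 ≤ (A • w).re ↔ 0 ≤ L (kl w) + m := fun w => by
    obtain ⟨ρ, hρ0, he⟩ := hρ w
    rw [he]
    exact ⟨fun h => nonneg_of_mul_nonneg_right h hρ0, fun h => mul_nonneg hρ0.le h⟩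
  refine ⟨L, m, hL, ?_, fun hz => ?_, ?_⟩
  · rw [← isOpenEmbedding_kl.map_nhds_eq, eventually_map]
    filter_upwards [hw] with w hw
    rw [kl_injective.mem_set_image, hw, hre']
  · rw [← hre, ← hA]
    by_contra h0
    refine hz ((U.mem_interior_iff z).2 ?_)
    rintro ⟨ψ, hψ, hsψ, h1⟩
    obtain ⟨B, hB, hwB⟩ := U.local_model z hψ hsψ
    refine not_eventually_nonneg_re (hB ▸ h1) ?_
    have h2 : 0 < (A • (z : ℍ)).re :=
      lt_of_le_of_ne (hw.self_of_nhds.1 z.2) (Ne.symm (hA ▸ h0))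
    have h3 : ∀ᶠ w in 𝓝 (z : ℍ), 0 < (A • w).re :=
      (UpperHalfPlane.continuous_re.comp (continuous_const_smul A)).continuousAt.eventually
        (lt_mem_nhds h2)
    filter_upwards [hw, hwB, h3] with w h4 h5 h6
    exact h5.1 (h4.2 h6.le)
  · obtain ⟨c, v, u, hc, hr⟩ := exists_isGeodesicLine_of_sl2 A
    exact ⟨c, v, u, hc, fun w => (hr w).trans (hre w)⟩

theorem isEmbedding_kl_carrier : IsEmbedding fun z : U.carrier => kl z :=
  isOpenEmbedding_kl.isEmbedding.comp IsEmbedding.subtypeVal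

/-- Small Klein balls meet the carrier in convex sets, by the half-plane model. This makes the
lifting criterion for coverings available on the carrier. -/
theorem locallyPathConnectedSpace : LocallyPathConnectedSpace U.carrier := by
  have key : ∀ z : U.carrier, ∃ ε₀ > 0, ∀ ε ≤ ε₀, Convex ℝ (Metric.ball (kl z) ε ∩ kl '' U.carrier) := by
    intro z
    obtain ⟨L, m, -, hk, -⟩ := U.klein_local_model z
    obtain ⟨ε₀, h0, hb⟩ := Metric.eventually_nhds_iff_ball.1 hk
    refine ⟨ε₀, h0, fun ε hε => ?_⟩
    have : Metric.ball (kl z) ε ∩ kl '' U.carrier = Metric.ball (kl z) ε ∩ {k | -m ≤ L k} := by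
      ext k
      refine and_congr_right fun hk => ?_
      rw [hb k (Metric.ball_subset_ball hε hk)]
      exact neg_le_iff_add_nonneg.symm
    rw [this]
    exact (convex_ball _ _).inter (convex_halfSpace_ge L.toLinearMap.isLinear _)
  choose ε₀ hε₀ hconv using key
  refine LocallyPathConnectedSpace.of_bases (p := fun z ε => 0 < ε ∧ ε ≤ ε₀ z)
    (s := fun z ε => (fun z : U.carrier => kl z) ⁻¹' Metric.ball (kl z) ε) (fun z => ?_)
    fun z ε hε => ?_
  · rw [U.isEmbedding_kl_carrier.isInducing.nhds_eq_comap]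
    refine Filter.HasBasis.comap _ ?_
    refine Metric.nhds_basis_ball.to_hasBasis (fun ε hε => ?_) fun ε hε => ⟨ε, hε.1, Subset.rfl⟩
    exact ⟨min ε (ε₀ z), ⟨lt_min hε (hε₀ z), min_le_right _ _⟩,
      Metric.ball_subset_ball (min_le_left _ _)⟩
  · rw [U.isEmbedding_kl_carrier.isInducing.isPathConnected_iff]
    have e : (fun z : U.carrier => kl z) '' ((fun z : U.carrier => kl z) ⁻¹' Metric.ball (kl z) ε) =
        Metric.ball (kl z) ε ∩ kl '' U.carrier := by
      rw [image_preimage_eq_inter_range]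
      congr 1
      ext k
      simp
    rw [e]
    exact (hconv z ε hε.2).isPathConnected ⟨kl z, Metric.mem_ball_self hε.1, z, z.2, rfl⟩

/-- Lifting the projection through itself in both directions gives mutually inverse maps: the deck
group is transitive on fibres. -/
theorem exists_deck {z z' : U.carrier} (hz : U.proj z = U.proj z') :
    ∃ g : U.carrier ≃ₜ U.carrier, (∀ w, U.proj (g w) = U.proj w) ∧ g z = z' := by
  have := U.simplyConnected
  have := U.locallyPathConnectedSpace
  have hp := U.isCoveringMap.continuous
  obtain ⟨F, ⟨hF, hF'⟩, -⟩ := U.isCoveringMap.existsUnique_continuousMap_lifts ⟨U.proj, hp⟩ z z' hz.symm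
  obtain ⟨G, ⟨hG, hG'⟩, -⟩ := U.isCoveringMap.existsUnique_continuousMap_lifts ⟨U.proj, hp⟩ z' z hz
  replace hF' : ∀ w, U.proj (F w) = U.proj w := congr_fun hF'
  replace hG' : ∀ w, U.proj (G w) = U.proj w := congr_fun hG'
  have e1 : G ∘ F = id := U.isCoveringMap.eq_of_comp_eq (by fun_prop) continuous_id
    (by funext w; simp [hF', hG']) z (by simp [hF, hG])
  have e2 : F ∘ G = id := U.isCoveringMap.eq_of_comp_eq (by fun_prop) continuous_id
    (by funext w; simp [hF', hG']) z' (by simp [hF, hG])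
  exact ⟨⟨⟨F, G, congr_fun e1, congr_fun e2⟩, F.continuous, G.continuous⟩, hF', hF⟩

end UniversalCover

/-- A fixed point in the upper half-plane solves a real quadratic equation, which has at most one
root there unless all its coefficients vanish. This is applied to B⁻¹A. -/
theorem sl2_eq_of_eq_two {A B : SL(2, ℝ)} {x y : ℍ} (hxy : x ≠ y) (hx : A • x = B • x)
    (hy : A • y = B • y) (w : ℍ) : A • w = B • w := by
  have key : ∀ C : SL(2, ℝ), C • x = x → C • y = y → ∀ w : ℍ, C • w = w := by
    intro C hCx hCy w
    have hdet : C 0 0 * C 1 1 - C 0 1 * C 1 0 = 1 := by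
      rw [← Matrix.det_fin_two]; exact C.2
    have e : ∀ z : ℍ, C • z = z → C 1 0 * (2 * z.re) = C 0 0 - C 1 1 ∧
        C 1 0 * (z.re ^ 2 + z.im ^ 2) = - C 0 1 := by
      intro z hz
      have h1 := sl2_smul_im C z
      have h2 := sl2_smul_re C z
      have hD := sl2_denom_pos C z
      rw [hz] at h1 h2
      have h3 := z.im_pos
      have h4 : (C 1 0 * z.re + C 1 1) ^ 2 + (C 1 0 * z.im) ^ 2 = 1 := by
        rw [eq_div_iff hD.ne'] at h1
        exact mul_left_cancel₀ h3.ne' (by linarith)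
      rw [h4, div_one] at h2
      have e1 : C 0 0 * z.im = (C 1 0 * z.re + C 1 1) * z.im + C 1 0 * z.im * z.re := by
        linear_combination (-(C 0 0 * z.im)) * h4 + ((C 1 0 * z.re + C 1 1) * z.im) * hdet -
          (C 1 0 * z.im) * h2
      have e2 : C 0 0 * z.re + C 0 1 = (C 1 0 * z.re + C 1 1) * z.re - C 1 0 * z.im * z.im := by
        linear_combination (-(C 0 0 * z.re + C 0 1)) * h4 - (C 1 0 * z.re + C 1 1) * h2 -
          (C 1 0 * z.im * z.im) * hdet
      have h5 : C 1 0 * (2 * z.re) = C 0 0 - C 1 1 := by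
        refine mul_right_cancel₀ h3.ne' ?_
        linear_combination -e1
      exact ⟨h5, by linear_combination e2 + z.re * h5⟩
    obtain ⟨x1, x2⟩ := e x hCx
    obtain ⟨y1, y2⟩ := e y hCy
    have hc : C 1 0 = 0 := by
      by_contra hc
      refine hxy ?_
      have hr : x.re = y.re := by
        have := mul_left_cancel₀ hc (x1.trans y1.symm)
        linarith
      have hi := mul_left_cancel₀ hc (x2.trans y2.symm)
      rw [hr] at hi
      have hi' : x.im = y.im := by
        have h1 := x.im_pos
        have h2 := y.im_pos
        nlinarith
      exact UpperHalfPlane.ext (Complex.ext hr hi')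
    rw [hc, zero_mul] at x1 x2
    have hb : C 0 1 = 0 := by linarith
    have had : C 0 0 = C 1 1 := by linarith
    rw [hc, hb, had] at hdet
    apply UpperHalfPlane.ext
    rw [sl2_smul_coe, hc, hb, had]
    have hd2 : C 1 1 ^ 2 = 1 := by linarith
    apply Complex.ext
    · have hd0 : C 1 1 ≠ 0 := fun h0 => by rw [h0] at hd2; norm_num at hd2
      simp
      field_simp
    · simp [hd2]
  have := key (B⁻¹ * A) (by rw [mul_smul, hx, inv_smul_smul]) (by rw [mul_smul, hy, inv_smul_smul]) w
  rw [mul_smul, inv_smul_eq_iff] at this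
  exact this

/-- Two closed half-planes agreeing near a boundary point are equal. -/
theorem halfPlane_eq_of_eventually {L L' : ℂ →L[ℝ] ℝ} {m m' : ℝ} {k₀ : ℂ} (hL : L ≠ 0)
    (h0 : L k₀ + m = 0) (he : ∀ᶠ k in 𝓝 k₀, (0 ≤ L k + m ↔ 0 ≤ L' k + m')) (k : ℂ) :
    0 ≤ L k + m ↔ 0 ≤ L' k + m' := by
  have hline : ∀ v : ℂ, ∀ᶠ t in 𝓝[>] (0 : ℝ),
      (0 ≤ L (k₀ + t • v) + m ↔ 0 ≤ L' (k₀ + t • v) + m') := fun v => by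
    have : Tendsto (fun t : ℝ => k₀ + t • v) (𝓝[>] 0) (𝓝 k₀) := by
      have h1 : Continuous fun t : ℝ => k₀ + t • v := by fun_prop
      have h2 := h1.tendsto 0
      simp only [zero_smul, add_zero] at h2
      exact h2.mono_left nhdsWithin_le_nhds
    exact this.eventually he
  have h0' : L' k₀ + m' = 0 := by
    refine le_antisymm ?_ (he.self_of_nhds.1 h0.ge)
    by_contra! hpos
    obtain ⟨v, hv⟩ : ∃ v, L v ≠ 0 := by
      by_contra! hv
      exact hL (ContinuousLinearMap.ext hv)
    obtain ⟨w, hw⟩ : ∃ w, L w < 0 := by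
      rcases lt_or_gt_of_ne hv with h | h
      · exact ⟨v, h⟩
      · exact ⟨-v, by rw [map_neg]; linarith⟩
    have h2 : ∀ᶠ t in 𝓝[>] (0 : ℝ), 0 < L' (k₀ + t • w) + m' := by
      have h1 : Continuous fun t : ℝ => L' (k₀ + t • w) + m' := by fun_prop
      have h3 : Tendsto (fun t : ℝ => L' (k₀ + t • w) + m') (𝓝[>] 0) (𝓝 (L' k₀ + m')) := by
        have h2 := h1.tendsto 0
        simp only [zero_smul, add_zero] at h2
        exact h2.mono_left nhdsWithin_le_nhds
      exact h3.eventually (lt_mem_nhds hpos)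
    obtain ⟨t, ht1, ht2, ht0⟩ := ((hline w).and (h2.and self_mem_nhdsWithin)).exists
    have ht0' : 0 < t := ht0
    have h3 := ht1.2 ht2.le
    rw [map_add, map_smul, smul_eq_mul] at h3
    nlinarith
  obtain ⟨t, ht, ht0⟩ := ((hline (k - k₀)).and self_mem_nhdsWithin).exists
  have ht0' : 0 < t := ht0
  have e1 : L (k₀ + t • (k - k₀)) + m = t * (L k + m) := by
    rw [map_add, map_smul, smul_eq_mul, map_sub]; linear_combination (1 - t) * h0
  have e2 : L' (k₀ + t • (k - k₀)) + m' = t * (L' k + m') := by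
    rw [map_add, map_smul, smul_eq_mul, map_sub]; linear_combination (1 - t) * h0'
  rw [e1, e2] at ht
  exact ⟨fun hk => nonneg_of_mul_nonneg_right (ht.1 (mul_nonneg ht0'.le hk)) ht0',
    fun hk => nonneg_of_mul_nonneg_right (ht.2 (mul_nonneg ht0'.le hk)) ht0'⟩

namespace UniversalCover

variable {S : Type*} [TopologicalSpace S] {h : HyperbolicMetric S} (U : UniversalCover h)

/-- A half-plane through kl z contains at least one of kl z ± v for every v. Nontriviality makes
punctured neighbourhoods nonempty, as needed to find a second point of agreement in
`exists_sl2_of_deck`. -/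
theorem nontrivial_carrier : Nontrivial U.carrier := by
  have := U.simplyConnected
  obtain ⟨z⟩ : Nonempty U.carrier := inferInstance
  obtain ⟨L, m, -, hk, -⟩ := U.klein_local_model z
  have hz : 0 ≤ L (kl z) + m := hk.self_of_nhds.1 ⟨z, z.2, rfl⟩
  by_contra hn
  rw [not_nontrivial_iff_subsingleton] at hn
  have hone : ∀ k ∈ kl '' U.carrier, k = kl z := by
    rintro _ ⟨w, hw, rfl⟩
    rw [show w = z from congrArg Subtype.val (Subsingleton.elim (⟨w, hw⟩ : U.carrier) z)]
  obtain ⟨ε, hε, hb⟩ := Metric.eventually_nhds_iff_ball.1 hk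
  have main : ∀ v : ℂ, 0 < ‖v‖ → ‖v‖ < ε → L v < 0 := by
    intro v hv hvε
    by_contra! hL
    have h1 := (hb (kl z + v) (by simpa using hvε)).2 (by rw [map_add]; linarith)
    have h2 := hone _ h1
    have h3 : v = 0 := by simpa using h2
    rw [h3, norm_zero] at hv
    exact lt_irrefl _ hv
  have h1 := main ((ε / 2 : ℝ) : ℂ) (by rw [Complex.norm_real, Real.norm_eq_abs, abs_of_pos] <;> linarith)
    (by rw [Complex.norm_real, Real.norm_eq_abs, abs_of_pos] <;> linarith)
  have h2 := main (-((ε / 2 : ℝ) : ℂ))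
    (by rw [norm_neg, Complex.norm_real, Real.norm_eq_abs, abs_of_pos] <;> linarith)
    (by rw [norm_neg, Complex.norm_real, Real.norm_eq_abs, abs_of_pos] <;> linarith)
  rw [map_neg] at h2
  linarith

/-- Deck transformations are restrictions of Möbius transformations. -/
theorem exists_sl2_of_deck {g : U.carrier → U.carrier} (hg : Continuous g)
    (hp : ∀ z, U.proj (g z) = U.proj z) : ∃ A : SL(2, ℝ), ∀ z, (g z : ℍ) = A • (z : ℍ) := by
  have := U.simplyConnected
  have := U.nontrivial_carrier
  have hloc : ∀ z : U.carrier, ∃ A : SL(2, ℝ), ∀ᶠ w in 𝓝 z, (g w : ℍ) = A • (w : ℍ) := by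
    intro z
    obtain ⟨φ, hφ, hs⟩ := h.cover (U.proj z)
    obtain ⟨A, hA⟩ := U.localIsometry z φ hφ hs
    obtain ⟨B, hB⟩ := U.localIsometry (g z) φ hφ (by rwa [hp])
    refine ⟨B⁻¹ * A, ?_⟩
    filter_upwards [hA, hg.continuousAt.eventually hB] with w h1 h2
    rw [hp, h1] at h2
    rw [mul_smul, h2, inv_smul_smul]
  obtain ⟨z₀⟩ : Nonempty U.carrier := inferInstance
  obtain ⟨A, hA⟩ := hloc z₀
  -- Analytic continuation: the local Möbius expressions of g agree wherever they overlap, since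
  -- they agree at two points, so T is clopen.
  let T : Set U.carrier := {z | ∀ᶠ w in 𝓝 z, (g w : ℍ) = A • (w : ℍ)}
  have hT : IsClopen T := by
    refine ⟨?_, isOpen_iff_mem_nhds.2 fun z hz => eventually_eventually_nhds.2 hz⟩
    refine isClosed_of_closure_subset fun z hz => ?_
    obtain ⟨B, hB⟩ := hloc z
    obtain ⟨z₁, hz₁, hz₁T⟩ := mem_closure_iff_nhds.1 hz _ (eventually_eventually_nhds.2 hB)
    have h1 : ∀ᶠ w : U.carrier in 𝓝 z₁, A • (w : ℍ) = B • (w : ℍ) := by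
      have ha : ∀ᶠ w in 𝓝 z₁, (g w : ℍ) = B • (w : ℍ) := hz₁
      have hb : ∀ᶠ w in 𝓝 z₁, (g w : ℍ) = A • (w : ℍ) := hz₁T
      filter_upwards [ha, hb] with w h1 h2
      rw [← h1, h2]
    have h1' : ∀ᶠ w : U.carrier in 𝓝[≠] z₁, A • (w : ℍ) = B • (w : ℍ) :=
      h1.filter_mono nhdsWithin_le_nhds
    have hne : ∀ᶠ w : U.carrier in 𝓝[≠] z₁, w ≠ z₁ := self_mem_nhdsWithin
    obtain ⟨w, hw, hwz⟩ := (h1'.and hne).exists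
    have h2 := sl2_eq_of_eq_two (fun he => hwz (Subtype.ext he)) hw h1.self_of_nhds
    filter_upwards [hB] with w hw
    rw [hw, h2]
  have hu : T = univ := hT.eq_univ ⟨z₀, hA⟩
  exact ⟨A, fun z => (hu.symm.subset (mem_univ z) : ∀ᶠ w in 𝓝 z, _).self_of_nhds⟩

theorem isometry_of_deck {g : U.carrier → U.carrier} (hg : Continuous g)
    (hp : ∀ z, U.proj (g z) = U.proj z) : Isometry g := by
  obtain ⟨A, hA⟩ := U.exists_sl2_of_deck hg hp
  refine Isometry.of_dist_eq fun x y => ?_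
  rw [Subtype.dist_eq, hA, hA, dist_smul, Subtype.dist_eq]

theorem locallyCompactSpace_carrier : LocallyCompactSpace U.carrier := by
  suffices h : IsLocallyClosed U.carrier from h.locallyCompactSpace
  refine ((isLocallyClosed_tfae U.carrier).out 0 3).2 fun z hz => ?_
  obtain ⟨φ, hφ, hs⟩ := h.cover (U.proj ⟨z, hz⟩)
  obtain ⟨A, -, hA⟩ := U.local_model ⟨z, hz⟩ hφ hs
  obtain ⟨V, hV, hVo, hzV⟩ := eventually_nhds_iff.1 hA
  refine ⟨V, hzV, hVo, ?_⟩
  rintro w ⟨hwV, hwc⟩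
  refine (hV w hwV).2 ?_
  have hcl : IsClosed {w : ℍ | 0 ≤ (A • w).re} :=
    isClosed_le continuous_const (UpperHalfPlane.continuous_re.comp (continuous_const_smul A))
  have : w ∈ closure (V ∩ U.carrier) := hVo.inter_closure ⟨hwV, hwc⟩
  exact closure_minimal (fun x hx => (hV x hx.1).1 hx.2) hcl this

/-- The deck group acts cocompactly. -/
theorem exists_compact_fundamental [CompactSpace S] : ∃ K : Set U.carrier, IsCompact K ∧ K.Nonempty ∧
    ∀ z, ∃ g : U.carrier ≃ₜ U.carrier, (∀ w, U.proj (g w) = U.proj w) ∧ g z ∈ K := by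
  have := U.locallyCompactSpace_carrier
  have := U.simplyConnected
  choose s hs using U.surjective
  choose N hN hNz using fun x : S => exists_compact_mem_nhds (s x)
  have hn : ∀ x, U.proj '' N x ∈ 𝓝 x := fun x => by
    have := U.isCoveringMap.isOpenMap.image_mem_nhds (hNz x)
    rwa [hs] at this
  obtain ⟨t, -, ht⟩ := isCompact_univ.elim_nhds_subcover (fun x => U.proj '' N x) fun x _ => hn x
  have hK : ∀ z, ∃ g : U.carrier ≃ₜ U.carrier, (∀ w, U.proj (g w) = U.proj w) ∧
      g z ∈ ⋃ x ∈ t, N x := fun z => by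
    obtain ⟨x, hx, w, hw, hwz⟩ := mem_iUnion₂.1 (ht (mem_univ (U.proj z)))
    obtain ⟨g, hg, hgz⟩ := U.exists_deck hwz.symm
    exact ⟨g, hg, mem_iUnion₂.2 ⟨x, hx, hgz.symm ▸ hw⟩⟩
  obtain ⟨z⟩ : Nonempty U.carrier := inferInstance
  obtain ⟨g, -, hg⟩ := hK z
  exact ⟨⋃ x ∈ t, N x, t.isCompact_biUnion fun x _ => hN x, ⟨_, hg⟩, hK⟩

/-- Cocompactness gives a uniform radius r such that every ball of radius r in the carrier lies in a
compact subset of it; a limit point within r/2 of the carrier cannot escape. -/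
theorem isClosed_carrier [CompactSpace S] : IsClosed U.carrier := by
  have := U.locallyCompactSpace_carrier
  obtain ⟨K, hK, hne, hKg⟩ := U.exists_compact_fundamental
  obtain ⟨K', hK', hKK'⟩ := exists_compact_superset hK
  obtain ⟨r, hr, hrK⟩ := hK.exists_thickening_subset_open isOpen_interior hKK'
  refine isClosed_of_closure_subset fun z hz => ?_
  obtain ⟨w, hw, hwz⟩ := Metric.mem_closure_iff.1 hz (r / 2) (by linarith)
  obtain ⟨g, hg, hgK⟩ := hKg ⟨w, hw⟩
  have hgi := U.isometry_of_deck g.continuous hg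
  have hcl : IsClosed ((fun x : U.carrier => (x : ℍ)) '' (g.symm '' K')) :=
    ((hK'.image g.symm.continuous).image continuous_subtype_val).isClosed
  have hmem : z ∈ closure (Metric.ball w r ∩ U.carrier) :=
    Metric.isOpen_ball.inter_closure ⟨by rw [Metric.mem_ball]; linarith, hz⟩
  have hsub : Metric.ball w r ∩ U.carrier ⊆ (fun x : U.carrier => (x : ℍ)) '' (g.symm '' K') := by
    intro x hx
    refine ⟨⟨x, hx.2⟩, ⟨g ⟨x, hx.2⟩, interior_subset (hrK ?_), g.symm_apply_apply _⟩, rfl⟩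
    rw [Metric.mem_thickening_iff]
    refine ⟨_, hgK, ?_⟩
    rw [hgi.dist_eq]
    exact hx.1
  obtain ⟨x, -, rfl⟩ := closure_minimal hsub hcl hmem
  exact x.2

/-- Through each boundary point of the universal cover passes a complete geodesic contained in the
boundary, and the universal cover lies on one side of it. -/
theorem exists_boundary_line [CompactSpace S] {z : ℍ} (hz : z ∈ U.carrier)
    (hz' : z ∉ interior U.carrier) : ∃ (L : ℂ →L[ℝ] ℝ) (m : ℝ) (c : ℝ → ℍ) (v u : ℂ),
    L ≠ 0 ∧ IsGeodesicLine c v u ∧ (∀ w : ℍ, w ∈ range c ↔ L (kl w) + m = 0) ∧ z ∈ range c ∧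
    range c ⊆ U.carrier ∧ (∀ w ∈ U.carrier, 0 ≤ L (kl w) + m) ∧
    ∀ w ∈ range c, ∀ᶠ k in 𝓝 (kl w), (k ∈ kl '' U.carrier ↔ 0 ≤ L k + m) := by
  have := U.simplyConnected
  have hX := U.isClosed_carrier
  obtain ⟨L, m, hL, hk, h0, c, v, u, hc, hr⟩ := U.klein_local_model ⟨z, hz⟩
  have hzc : z ∈ range c := (hr z).2 (h0 hz')
  have hcc : Continuous fun t => kl (c t) := continuous_kl.comp hc.isometry.continuous
  -- The half-plane that models the carrier at z continues to do so along the whole line. T is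
  -- closed because the carrier is closed and half-planes with the same germ at a boundary point
  -- coincide.
  let T : Set ℝ := {t | ∀ᶠ k in 𝓝 (kl (c t)), (k ∈ kl '' U.carrier ↔ 0 ≤ L k + m)}
  have hTX : ∀ t ∈ T, c t ∈ U.carrier := fun t ht => by
    have h1 : ∀ᶠ k in 𝓝 (kl (c t)), (k ∈ kl '' U.carrier ↔ 0 ≤ L k + m) := ht
    have := h1.self_of_nhds.2 ((hr _).1 ⟨t, rfl⟩).ge
    rwa [kl_injective.mem_set_image] at this
  have hT : IsClopen T := by
    refine ⟨isClosed_of_closure_subset fun t ht => ?_, isOpen_iff_mem_nhds.2 fun t ht =>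
      hcc.continuousAt.eventually (eventually_eventually_nhds.2 ht)⟩
    have htX : c t ∈ U.carrier :=
      closure_minimal hTX (hX.preimage hc.isometry.continuous) ht
    obtain ⟨L', m', hL', hk', -⟩ := U.klein_local_model ⟨c t, htX⟩
    obtain ⟨s, hs, hsT⟩ := mem_closure_iff_nhds.1 ht _
      (hcc.continuousAt.eventually (eventually_eventually_nhds.2 hk'))
    have hsT' : ∀ᶠ k in 𝓝 (kl (c s)), (k ∈ kl '' U.carrier ↔ 0 ≤ L k + m) := hsT
    have hs' : ∀ᶠ k in 𝓝 (kl (c s)), (k ∈ kl '' U.carrier ↔ 0 ≤ L' k + m') := hs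
    have he := halfPlane_eq_of_eventually hL ((hr _).1 ⟨s, rfl⟩)
      (by filter_upwards [hsT', hs'] with k h1 h2 using h1.symm.trans h2)
    have hk'' : ∀ᶠ k in 𝓝 (kl (c t)), (k ∈ kl '' U.carrier ↔ 0 ≤ L' k + m') := hk'
    change ∀ᶠ k in 𝓝 (kl (c t)), (k ∈ kl '' U.carrier ↔ 0 ≤ L k + m)
    filter_upwards [hk''] with k h1
    rw [h1, he]
  obtain ⟨t₀, ht₀⟩ := hzc
  have hTu : T = univ := hT.eq_univ ⟨t₀, by
    change ∀ᶠ k in 𝓝 (kl (c t₀)), (k ∈ kl '' U.carrier ↔ 0 ≤ L k + m)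
    rw [ht₀]; exact hk⟩
  have hgerm : ∀ w ∈ range c, ∀ᶠ k in 𝓝 (kl w), (k ∈ kl '' U.carrier ↔ 0 ≤ L k + m) := by
    rintro _ ⟨t, rfl⟩
    exact hTu.symm.subset (mem_univ t)
  refine ⟨L, m, c, v, u, hL, hc, hr, ⟨t₀, ht₀⟩, ?_, ?_, hgerm⟩
  · rintro _ ⟨t, rfl⟩
    exact hTX t (hTu.symm.subset (mem_univ t))
  · have hcont : Continuous fun w : U.carrier => L (kl w) + m :=
      (L.continuous.comp (continuous_kl.comp continuous_subtype_val)).add continuous_const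
    -- Openness is only in question where the functional vanishes, that is, on the line, where the
    -- local model bounds the carrier to one side.
    have hclopen : IsClopen {w : U.carrier | 0 ≤ L (kl w) + m} := by
      refine ⟨isClosed_le continuous_const hcont, isOpen_iff_mem_nhds.2 fun w hw => ?_⟩
      rcases (show 0 ≤ L (kl w) + m from hw).lt_or_eq with h1 | h1
      · filter_upwards [hcont.continuousAt.eventually (lt_mem_nhds h1)] with x hx using hx.le
      · have h2 := hgerm w ((hr w).2 h1.symm)
        have h3 : Tendsto (fun x : U.carrier => kl x) (𝓝 w) (𝓝 (kl w)) :=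
          (continuous_kl.comp continuous_subtype_val).continuousAt
        filter_upwards [h3.eventually h2] with x hx
        exact hx.1 ⟨x, x.2, rfl⟩
    have hu := hclopen.eq_univ ⟨⟨z, hz⟩, (h0 hz').ge⟩
    intro w hw
    exact hu.symm.subset (mem_univ (⟨w, hw⟩ : U.carrier))

/-- Continuous induction along the segment. At an interior point there is nothing to check; at a
boundary point both ends of the segment satisfy the global inequality of `exists_boundary_line`, so
the segment does, and the local model keeps it in the carrier. -/
theorem convex_carrier [CompactSpace S] : Convex ℝ (kl '' U.carrier) := by
  have hX := U.isClosed_carrier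
  rw [convex_iff_segment_subset]
  rintro _ ⟨x, hx, rfl⟩ _ ⟨y, hy, rfl⟩
  rw [segment_eq_image_lineMap]
  have hγ : Continuous (AffineMap.lineMap (kl x) (kl y) : ℝ → ℂ) := AffineMap.lineMap_continuous
  have hball : ∀ t ∈ Icc (0 : ℝ) 1, (AffineMap.lineMap (kl x) (kl y) t : ℂ) ∈ range kl := by
    intro t ht
    rw [range_kl]
    have hconv := convex_ball (0 : ℂ) 1
    refine hconv.segment_subset (range_kl.subset ⟨x, rfl⟩) (range_kl.subset ⟨y, rfl⟩) ?_
    rw [segment_eq_image_lineMap]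
    exact mem_image_of_mem _ ht
  have hYc : ∀ k ∈ range kl, k ∈ closure (kl '' U.carrier) → k ∈ kl '' U.carrier := by
    rintro _ ⟨w, rfl⟩ hw
    exact ⟨w, hX.closure_eq.subset (mem_closure_of_kl_mem_closure hw), rfl⟩
  have hcl : IsClosed ((AffineMap.lineMap (kl x) (kl y) : ℝ → ℂ) ⁻¹' (kl '' U.carrier) ∩ Icc 0 1) := by
    have e : (AffineMap.lineMap (kl x) (kl y) : ℝ → ℂ) ⁻¹' (kl '' U.carrier) ∩ Icc 0 1 =
        (AffineMap.lineMap (kl x) (kl y) : ℝ → ℂ) ⁻¹' closure (kl '' U.carrier) ∩ Icc 0 1 := by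
      ext t
      constructor
      · exact fun h => ⟨subset_closure h.1, h.2⟩
      · exact fun h => ⟨hYc _ (hball t h.2) h.1, h.2⟩
    rw [e]
    exact (isClosed_closure.preimage hγ).inter isClosed_Icc
  have := hcl.Icc_subset_of_forall_mem_nhdsWithin (a := (0:ℝ)) (b := 1) ⟨x, hx, by simp⟩ ?_
  · rintro _ ⟨t, ht, rfl⟩
    exact this ht
  · rintro t ⟨⟨w, hw, hwt⟩, ht⟩
    have hIcc : ∀ᶠ s in 𝓝[>] t, s ∈ Icc (0:ℝ) 1 := by
      filter_upwards [Ioc_mem_nhdsGT ht.2] with s hs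
      exact ⟨ht.1.trans hs.1.le, hs.2⟩
    by_cases hwi : w ∈ interior U.carrier
    · have h1 : kl '' U.carrier ∈ 𝓝 (kl w) :=
        isOpenEmbedding_kl.image_mem_nhds.2 (mem_interior_iff_mem_nhds.1 hwi)
      rw [hwt] at h1
      exact nhdsWithin_le_nhds (hγ.continuousAt.preimage_mem_nhds h1)
    · obtain ⟨L, m, c, v, u, -, -, -, hwc, -, hpos, hgerm⟩ := U.exists_boundary_line hw hwi
      have h1 := hgerm w hwc
      rw [hwt] at h1
      have h2 := nhdsWithin_le_nhds (s := Ioi t) (hγ.continuousAt.eventually h1)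
      filter_upwards [h2, hIcc] with s hs hs'
      refine hs.2 ?_
      rw [AffineMap.lineMap_apply]
      simp only [vsub_eq_sub, vadd_eq_add, map_add, map_smul, map_sub, smul_eq_mul]
      nlinarith [hpos x hx, hpos y hy, hs'.1, hs'.2, mul_nonneg hs'.1 (hpos y hy),
        mul_nonneg (sub_nonneg.2 hs'.2) (hpos x hx)]

theorem boundary_line_subset [CompactSpace S] {z : ℍ} (hz : z ∈ U.carrier)
    (hz' : z ∉ interior U.carrier) : ∃ (c : ℝ → ℍ) (v u : ℂ), IsGeodesicLine c v u ∧ z ∈ range c ∧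
      range c ⊆ U.carrier ∧ ∀ w ∈ range c, w ∉ interior U.carrier := by
  obtain ⟨L, m, c, v, u, hL, hc, hr, hzc, hcX, hpos, -⟩ := U.exists_boundary_line hz hz'
  refine ⟨c, v, u, hc, hzc, hcX, fun w hw hwi => ?_⟩
  have h1 : kl '' U.carrier ∈ 𝓝 (kl w) :=
    isOpenEmbedding_kl.image_mem_nhds.2 (mem_interior_iff_mem_nhds.1 hwi)
  -- The choice 0 and 1 represents the whole plane as a degenerate half-plane; a proper half-plane
  -- cannot coincide with it.
  have he := halfPlane_eq_of_eventually (L' := 0) (m' := 1) hL ((hr w).1 hw)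
    (by
      filter_upwards [h1] with k hk
      obtain ⟨x, hx, rfl⟩ := hk
      simp [hpos x hx])
  refine hL (ContinuousLinearMap.ext fun v => ?_)
  have hall : ∀ k, 0 ≤ L k + m := fun k => (he k).2 (by simp)
  simp only [zero_apply]
  by_contra hv
  have h3 := hall ((-(m + 1) / L v) • v)
  rw [map_smul, smul_eq_mul, div_mul_cancel₀ _ hv] at h3
  linarith

end UniversalCover

/-! ### Boundary extension of coarse maps -/

/-- The constant comes from 1 - ‖k‖² ≤ 2(1 - ‖k‖) and `one_sub_norm_kl_sq`. -/
theorem le_dist_I_of_norm_kl {ρ : ℝ} (hρ : 0 ≤ ρ) {z : ℍ}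
    (hz : 1 - 1 / (2 * Real.cosh ρ ^ 2) ≤ ‖kl z‖) : ρ ≤ dist z UpperHalfPlane.I := by
  by_contra! hlt
  have h1 := one_sub_norm_kl_sq z
  have h2 := norm_kl_lt_one z
  have h3 : Real.cosh (dist z UpperHalfPlane.I) < Real.cosh ρ := by
    rw [Real.cosh_lt_cosh, abs_of_nonneg dist_nonneg, abs_of_nonneg hρ]
    exact hlt
  have h4 := Real.cosh_pos (dist z UpperHalfPlane.I)
  have h5 : 1 / Real.cosh ρ ^ 2 < 1 / Real.cosh (dist z UpperHalfPlane.I) ^ 2 := by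
    apply one_div_lt_one_div_of_lt (by positivity)
    exact pow_lt_pow_left₀ h3 h4.le two_ne_zero
  have h6 : 1 / (2 * Real.cosh ρ ^ 2) = (1 / Real.cosh ρ ^ 2) / 2 := by
    have := Real.cosh_pos ρ
    field_simp
  rw [h6] at hz
  nlinarith [norm_nonneg (kl z)]

theorem tendsto_dist_I_iff {α : Type*} {l : Filter α} {g : α → ℍ} :
    Tendsto (fun a => ‖kl (g a)‖) l (𝓝 1) ↔
      Tendsto (fun a => dist (g a) UpperHalfPlane.I) l atTop := by
  constructor
  · intro h
    refine tendsto_atTop.2 fun r => ?_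
    have h1 : 1 - 1 / (2 * Real.cosh (max r 0) ^ 2) < 1 := by
      have := Real.cosh_pos (max r 0)
      have : 0 < 1 / (2 * Real.cosh (max r 0) ^ 2) := by positivity
      linarith
    filter_upwards [h.eventually (lt_mem_nhds h1)] with a ha
    exact (le_max_left r 0).trans (le_dist_I_of_norm_kl (le_max_right r 0) ha.le)
  · intro h
    have h1 : Tendsto (fun a => Real.cosh (dist (g a) UpperHalfPlane.I) ^ 2) l atTop := by
      refine (tendsto_pow_atTop two_ne_zero).comp ?_
      refine tendsto_atTop_mono (fun a => ?_) h
      have h0 : 0 ≤ dist (g a) UpperHalfPlane.I := dist_nonneg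
      have := Real.add_one_le_exp (dist (g a) UpperHalfPlane.I)
      rw [← Real.cosh_add_sinh] at this
      have h2 := Real.cosh_sq (dist (g a) UpperHalfPlane.I)
      have h3 := Real.self_le_sinh_iff.2 h0
      nlinarith [Real.cosh_pos (dist (g a) UpperHalfPlane.I)]
    have h2 : Tendsto (fun a => ‖kl (g a)‖ ^ 2) l (𝓝 (1 - 0)) := by
      have := (tendsto_const_nhds (x := (1:ℝ)) (f := l)).sub (h1.const_div_atTop 1)
      refine this.congr fun a => ?_
      have := one_sub_norm_kl_sq (g a)
      linarith
    have h3 := h2.sqrt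
    simp only [sub_zero, Real.sqrt_one] at h3
    exact h3.congr fun a => Real.sqrt_sq (norm_nonneg _)

theorem norm_kl_sub_le_exp {C s : ℝ} {z w : ℍ} (hC : dist z w ≤ C)
    (hz : s ≤ dist z UpperHalfPlane.I) (hw : s ≤ dist w UpperHalfPlane.I) :
    ‖kl z - kl w‖ ≤ √(8 * Real.cosh C) * Real.exp (-s) := by
  have hc : ∀ z : ℍ, s ≤ dist z UpperHalfPlane.I →
      Real.exp s / 2 ≤ Real.cosh (dist z UpperHalfPlane.I) := fun z hz => by
    rw [Real.cosh_eq]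
    have h1 := Real.exp_le_exp.2 hz
    have h2 := Real.exp_pos (-dist z UpperHalfPlane.I)
    linarith
  have h1 := norm_kl_sub_sq_le z w
  have h2 : Real.cosh (dist z w) ≤ Real.cosh C := by
    rw [Real.cosh_le_cosh, abs_of_nonneg dist_nonneg, abs_of_nonneg (dist_nonneg.trans hC)]
    exact hC
  have h3 : 0 < Real.exp s := Real.exp_pos s
  have h4 : 0 < Real.cosh C := Real.cosh_pos C
  have h5 : 2 * Real.cosh (dist z w) / (Real.cosh (dist z UpperHalfPlane.I) *
      Real.cosh (dist w UpperHalfPlane.I)) ≤ 2 * Real.cosh C / (Real.exp s / 2 * (Real.exp s / 2)) := by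
    have := hc z hz
    have := hc w hw
    gcongr
  have h6 : 2 * Real.cosh C / (Real.exp s / 2 * (Real.exp s / 2)) =
      (√(8 * Real.cosh C) * Real.exp (-s)) ^ 2 := by
    rw [mul_pow, Real.sq_sqrt (by positivity), Real.exp_neg]
    field_simp
    norm_num
  exact (pow_le_pow_iff_left₀ (norm_nonneg _) (by positivity) two_ne_zero).1
    (h1.trans (h5.trans h6.le))

/-- Pairs of maps `P Q : α → ℍ` for which `P a ↦ Q a` is a well-defined coarse map. -/
structure IsCoarse {α : Type*} (P Q : α → ℍ) (C : ℝ) : Prop where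
  one_le : 1 ≤ C
  convex : Convex ℝ (kl '' range P)
  step : ∀ a b, dist (P a) (P b) ≤ 1 → dist (Q a) (Q b) ≤ C
  proper : ∀ a, dist (P a) UpperHalfPlane.I ≤ C * dist (Q a) UpperHalfPlane.I + C

namespace IsCoarse

variable {α : Type*} {P Q : α → ℍ} {C : ℝ}

theorem norm_step (h : IsCoarse P Q C) {a b : α} {s : ℝ} (hab : dist (P a) (P b) ≤ 1)
    (ha : s ≤ dist (P a) UpperHalfPlane.I) (hb : s ≤ dist (P b) UpperHalfPlane.I) :
    ‖kl (Q a) - kl (Q b)‖ ≤ √(8 * Real.cosh C) * Real.exp (-(s / C - 1)) := by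
  have hC : 0 < C := by linarith [h.one_le]
  have key : ∀ a, s ≤ dist (P a) UpperHalfPlane.I → s / C - 1 ≤ dist (Q a) UpperHalfPlane.I := by
    intro a ha
    have := h.proper a
    rw [sub_le_iff_le_add, div_le_iff₀ hC]
    linarith
  exact norm_kl_sub_le_exp (h.step a b hab) (key a ha) (key b hb)

/-- Each step costs an amount exponentially small in the distance from the base point. That distance
has a lower bound growing by 1/4 per step, so the errors are dominated by a geometric series of
ratio exp(-1/(4C)). -/
theorem norm_chain (h : IsCoarse P Q C) {p : ℕ → α} {n : ℕ} {ρ : ℝ}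
    (hp : ∀ j < n, dist (P (p j)) (P (p (j + 1))) ≤ 1)
    (hd : ∀ j ≤ n, ρ + (j : ℝ) / 4 ≤ dist (P (p j)) UpperHalfPlane.I) :
    ‖kl (Q (p 0)) - kl (Q (p n))‖ ≤
      √(8 * Real.cosh C) * Real.exp (-(ρ / C - 1)) * (1 - Real.exp (-(1 / (4 * C))))⁻¹ := by
  have hC : 0 < C := by linarith [h.one_le]
  set θ := Real.exp (-(1 / (4 * C))) with hθ
  have hθ0 : 0 ≤ θ := (Real.exp_pos _).le
  have hθ1 : θ < 1 := by
    rw [hθ, Real.exp_lt_one_iff]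
    have : 0 < 1 / (4 * C) := by positivity
    linarith
  have hstep : ∀ j < n, ‖kl (Q (p j)) - kl (Q (p (j + 1)))‖ ≤
      √(8 * Real.cosh C) * Real.exp (-(ρ / C - 1)) * θ ^ j := by
    intro j hj
    have h1 := h.norm_step (hp j hj) (hd j hj.le) (s := ρ + (j : ℝ) / 4) (by
      refine le_trans ?_ (hd (j + 1) hj)
      push_cast
      linarith)
    refine h1.trans_eq ?_
    rw [hθ, ← Real.exp_nat_mul, mul_assoc, ← Real.exp_add]
    congr 2
    field_simp
    ring
  have h1 : dist (kl (Q (p 0))) (kl (Q (p n))) ≤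
      ∑ j ∈ Finset.range n, √(8 * Real.cosh C) * Real.exp (-(ρ / C - 1)) * θ ^ j :=
    dist_le_range_sum_of_dist_le (f := fun j => kl (Q (p j))) n fun {j} hj => by
      rw [dist_eq_norm]; exact hstep j hj
  rw [← dist_eq_norm]
  refine h1.trans ?_
  rw [← Finset.mul_sum]
  gcongr
  rw [← tsum_geometric_of_lt_one hθ0 hθ1]
  exact (summable_geometric_of_lt_one hθ0 hθ1).sum_le_tsum _ fun i _ => pow_nonneg hθ0 i

theorem exists_param (h : IsCoarse P Q C) {a b : α} {k : ℂ}
    (hk : k ∈ segment ℝ (kl (P a)) (kl (P b))) : ∃ x, kl (P x) = k := by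
  obtain ⟨_, ⟨x, rfl⟩, hx⟩ := h.convex.segment_subset ⟨_, ⟨a, rfl⟩, rfl⟩ ⟨_, ⟨b, rfl⟩, rfl⟩ hk
  exact ⟨x, hx⟩

/-- The geodesic starts at its point nearest to the base point and is followed in unit steps. After
j steps the distance to the base point is at least ρ by minimality and at least (j - 1)/2 by the
triangle inequality; averaging the two gives the linear growth required by `norm_chain`. The summand
2 pays for replacing the ends of the chain by a and b, since P need not be injective. -/
theorem norm_ray (h : IsCoarse P Q C) {a b : α} {ρ : ℝ}
    (hmin : ∀ x, kl (P x) ∈ segment ℝ (kl (P a)) (kl (P b)) →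
      dist (P a) UpperHalfPlane.I ≤ dist (P x) UpperHalfPlane.I)
    (hρ : ρ ≤ dist (P a) UpperHalfPlane.I) :
    ‖kl (Q a) - kl (Q b)‖ ≤ √(8 * Real.cosh C) * Real.exp (-((ρ / 2 - 1) / C - 1)) *
      (2 + (1 - Real.exp (-(1 / (4 * C))))⁻¹) := by
  obtain ⟨c, hc, hc0, hc1, hcs⟩ := exists_geodesic_segment (P a) (P b)
  set D := dist (P a) (P b) with hD
  have hD0 : 0 ≤ D := dist_nonneg
  have hsel : ∀ j : ℕ, ∃ x, P x = c (min j D) := fun j => by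
    obtain ⟨x, hx⟩ := h.exists_param (hcs (min j D) ⟨le_min (by positivity) hD0, min_le_right _ _⟩)
    exact ⟨x, kl_injective hx⟩
  choose p hp using hsel
  have hρP : ∀ x, kl (P x) ∈ segment ℝ (kl (P a)) (kl (P b)) → ρ ≤ dist (P x) UpperHalfPlane.I :=
    fun x hx => hρ.trans (hmin x hx)
  have hpa : P (p 0) = P a := by
    rw [hp, ← hc0]
    congr 1
    simpa using hD0
  have hpb : P (p ⌈D⌉₊) = P b := by
    rw [hp, ← hc1]
    congr 1
    exact min_eq_right (Nat.le_ceil D)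
  have hd : ∀ j ≤ ⌈D⌉₊, (ρ / 2 - 1) + (j : ℝ) / 4 ≤ dist (P (p j)) UpperHalfPlane.I := by
    intro j hj
    have hmem : kl (P (p j)) ∈ segment ℝ (kl (P a)) (kl (P b)) := by
      rw [hp]
      exact hcs _ ⟨le_min (by positivity) hD0, min_le_right _ _⟩
    have h1 := hρP _ hmem
    have h2 := hmin _ hmem
    have h3 : dist (P a) (P (p j)) = min (j : ℝ) D := by
      rw [hp, ← hc0, hc.dist_eq, Real.dist_eq, zero_sub, abs_neg,
        abs_of_nonneg (le_min (by positivity) hD0)]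
    have h4 : (j : ℝ) - 1 ≤ min (j : ℝ) D := by
      refine le_min (by linarith) ?_
      have h5 : (j : ℝ) ≤ (⌈D⌉₊ : ℝ) := by exact_mod_cast hj
      have h6 := Nat.ceil_lt_add_one hD0
      linarith
    have h5 := dist_triangle_right (P a) (P (p j)) UpperHalfPlane.I
    linarith
  have hstep : ∀ j < ⌈D⌉₊, dist (P (p j)) (P (p (j + 1))) ≤ 1 := by
    intro j _
    rw [hp, hp, hc.dist_eq, Real.dist_eq]
    have := abs_min_sub_min_le_max (j : ℝ) D ((j + 1 : ℕ) : ℝ) D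
    refine this.trans ?_
    push_cast
    simp
  have hchain := h.norm_chain hstep hd
  have hρ0 : ρ / 2 - 1 ≤ dist (P a) UpperHalfPlane.I := by
    have : 0 ≤ dist (P a) UpperHalfPlane.I := dist_nonneg
    linarith
  have hρ1 : ρ / 2 - 1 ≤ dist (P b) UpperHalfPlane.I := by
    have h1 : 0 ≤ dist (P a) UpperHalfPlane.I := dist_nonneg
    have h2 := hmin b (right_mem_segment ℝ _ _)
    linarith
  have e0 := h.norm_step (a := a) (b := p 0) (by rw [hpa, dist_self]; exact zero_le_one) hρ0
    (by rw [hpa]; exact hρ0)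
  have e1 := h.norm_step (a := p ⌈D⌉₊) (b := b) (by rw [hpb, dist_self]; exact zero_le_one)
    (by rw [hpb]; exact hρ1) hρ1
  have e2 : kl (Q a) - kl (Q b) = (kl (Q a) - kl (Q (p 0))) +
    (kl (Q (p 0)) - kl (Q (p ⌈D⌉₊))) + (kl (Q (p ⌈D⌉₊)) - kl (Q b)) := by ring
  rw [e2]
  refine (norm_add₃_le).trans ?_
  linarith

/-- If two points are close and near the circle, the whole chord between them is near the circle.
Its point nearest to the base point is then far out, and `norm_ray` applies from there to both ends.
-/
theorem visual (h : IsCoarse P Q C) {ε : ℝ} (hε : 0 < ε) : ∃ δ > 0, ∀ a b,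
    1 - δ < ‖kl (P a)‖ → ‖kl (P a) - kl (P b)‖ < δ → ‖kl (Q a) - kl (Q b)‖ < ε := by
  have hC : 0 < C := by linarith [h.one_le]
  have hlim : Tendsto (fun ρ : ℝ => √(8 * Real.cosh C) * Real.exp (-((ρ / 2 - 1) / C - 1)) *
      (2 + (1 - Real.exp (-(1 / (4 * C))))⁻¹)) atTop (𝓝 (√(8 * Real.cosh C) * 0 *
      (2 + (1 - Real.exp (-(1 / (4 * C))))⁻¹))) := by
    refine Tendsto.mul_const _ (Tendsto.const_mul _ ?_)
    refine Real.tendsto_exp_neg_atTop_nhds_zero.comp ?_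
    refine tendsto_atTop_add_const_right _ (-1) ?_
    refine Tendsto.atTop_div_const hC ?_
    exact tendsto_atTop_add_const_right _ (-1) (tendsto_id.atTop_div_const two_pos)
  rw [mul_zero, zero_mul] at hlim
  obtain ⟨ρ, hρ, hρ0⟩ := ((hlim.eventually (gt_mem_nhds (half_pos hε))).and
    (eventually_ge_atTop 0)).exists
  have hcosh := Real.cosh_pos ρ
  -- Points of the chord have modulus greater than 1 - 2δ, and 2δ is exactly the threshold of
  -- `le_dist_I_of_norm_kl`.
  refine ⟨1 / (2 * Real.cosh ρ ^ 2) / 2, by positivity, fun a b ha hab => ?_⟩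
  set δ := 1 / (2 * Real.cosh ρ ^ 2) / 2
  have hfar : ∀ k ∈ segment ℝ (kl (P a)) (kl (P b)), 1 - 2 * δ < ‖k‖ := fun k hk => by
    have h1 : ‖kl (P a) - k‖ ≤ ‖kl (P a) - kl (P b)‖ := by
      rw [← dist_eq_norm, ← dist_eq_norm]
      have := dist_add_dist_of_mem_segment hk
      have h2 : 0 ≤ dist k (kl (P b)) := dist_nonneg
      linarith
    have h2 := norm_sub_norm_le (kl (P a)) (kl (P a) - k)
    rw [sub_sub_cancel] at h2
    linarith
  have hK : IsCompact (kl ⁻¹' segment ℝ (kl (P a)) (kl (P b))) := by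
    refine isOpenEmbedding_kl.isInducing.isCompact_preimage' ?_ ?_
    · rw [segment_eq_image_lineMap]
      exact isCompact_Icc.image AffineMap.lineMap_continuous
    · intro k hk
      obtain ⟨x, hx⟩ := h.exists_param hk
      exact ⟨_, hx⟩
  obtain ⟨z, hz, hzmin⟩ := hK.exists_isMinOn ⟨P a, left_mem_segment ℝ _ _⟩
    (f := fun z => dist z UpperHalfPlane.I) (by fun_prop)
  obtain ⟨x, hx⟩ := h.exists_param hz
  have hx' : P x = z := kl_injective hx
  have hxρ : ρ ≤ dist (P x) UpperHalfPlane.I := by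
    refine le_dist_I_of_norm_kl hρ0 ?_
    have := hfar _ hz
    rw [hx]
    refine le_trans (le_of_eq ?_) this.le
    simp only [δ]
    ring
  have hmin' : ∀ y, kl (P y) ∈ segment ℝ (kl (P a)) (kl (P b)) →
      dist (P x) UpperHalfPlane.I ≤ dist (P y) UpperHalfPlane.I := fun y hy => by
    rw [hx']
    exact hzmin hy
  have hzs : kl (P x) ∈ segment ℝ (kl (P a)) (kl (P b)) := by rw [hx]; exact hz
  have r1 := h.norm_ray (a := x) (b := a) (fun y hy => hmin' y
    ((convex_segment _ _).segment_subset hzs (left_mem_segment ℝ _ _) hy)) hxρ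
  have r2 := h.norm_ray (a := x) (b := b) (fun y hy => hmin' y
    ((convex_segment _ _).segment_subset hzs (right_mem_segment ℝ _ _) hy)) hxρ
  have e : kl (Q a) - kl (Q b) = (kl (Q x) - kl (Q b)) - (kl (Q x) - kl (Q a)) := by ring
  rw [e]
  refine (norm_sub_le _ _).trans_lt ?_
  linarith

end IsCoarse

theorem isEmbedding_klein_idealBoundary (X : Set ℍ) :
    IsEmbedding fun ξ : idealBoundary X => klein ξ := by
  have h : IsEmbedding fun ξ : idealBoundary X =>
      (⟨ξ, mem_closedDisc_of_mem_idealBoundary ξ.2⟩ : closedDisc) :=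
    IsEmbedding.subtypeVal.codRestrict _ _
  exact isClosedEmbedding_klein.isEmbedding.comp h

instance compactSpace_idealBoundary (X : Set ℍ) : CompactSpace (idealBoundary X) :=
  isCompact_iff_compactSpace.1 (isClosed_closure.inter isClosed_frontier).isCompact

section Extension

variable {X Y : Set ℍ}

/-- The neighbourhood filter of an ideal point, traced on `X`. -/
noncomputable def idealFilter (ξ : idealBoundary X) : Filter X :=
  comap (fun z : X => toSphere z) (𝓝 (ξ : OnePoint ℂ))

instance idealFilter_neBot (ξ : idealBoundary X) : (idealFilter ξ).NeBot := by
  rw [idealFilter, comap_neBot_iff_frequently]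
  have h : (ξ : OnePoint ℂ) ∈ closure (toSphere '' X) := ξ.2.1
  rw [mem_closure_iff_frequently] at h
  refine h.mono ?_
  rintro _ ⟨z, hz, rfl⟩
  exact ⟨⟨z, hz⟩, rfl⟩

theorem tendsto_kl_idealFilter (ξ : idealBoundary X) :
    Tendsto (fun z : X => kl z) (idealFilter ξ) (𝓝 (klein ξ)) :=
  (tendsto_toSphere_iff (mem_closedDisc_of_mem_idealBoundary ξ.2)).1 tendsto_comap

theorem tendsto_norm_kl_idealFilter (ξ : idealBoundary X) :
    Tendsto (fun z : X => ‖kl z‖) (idealFilter ξ) (𝓝 1) := by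
  have := (tendsto_kl_idealFilter ξ).norm
  rwa [norm_klein_idealBoundary] at this

theorem isBoundaryExtension_iff {J : X → Y} {f : idealBoundary X → idealBoundary Y} :
    IsBoundaryExtension J f ↔
      ∀ ξ, Tendsto (fun z => kl (J z)) (idealFilter ξ) (𝓝 (klein (f ξ))) :=
  forall_congr' fun ξ => tendsto_toSphere_iff (mem_closedDisc_of_mem_idealBoundary (f ξ).2)

theorem IsBoundaryExtension.unique {J : X → Y} {f f' : idealBoundary X → idealBoundary Y}
    (h : IsBoundaryExtension J f) (h' : IsBoundaryExtension J f') : f = f' := by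
  rw [isBoundaryExtension_iff] at h h'
  funext ξ
  exact klein_idealBoundary_injective Y (tendsto_nhds_unique (h ξ) (h' ξ))

theorem IsBoundaryExtension.comp {Z : Set ℍ} {J : X → Y} {J' : Y → Z}
    {f : idealBoundary X → idealBoundary Y} {f' : idealBoundary Y → idealBoundary Z}
    (h' : IsBoundaryExtension J' f') (h : IsBoundaryExtension J f) :
    IsBoundaryExtension (J' ∘ J) (f' ∘ f) := by
  intro ξ
  have h1 : Tendsto J (idealFilter ξ) (idealFilter (f ξ)) := tendsto_comap_iff.2 (h ξ)
  exact (h' (f ξ)).comp h1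

/-- The estimate `visual` makes the values near an ideal point Cauchy, and the lower bound `proper`
puts the limit on the unit circle. -/
theorem IsCoarse.exists_isBoundaryExtension {J : X → Y} {C : ℝ}
    (h : IsCoarse (fun x : X => (x : ℍ)) (fun x => (J x : ℍ)) C) :
    ∃ f : idealBoundary X → idealBoundary Y, IsBoundaryExtension J f := by
  have hC : 0 < C := by linarith [h.one_le]
  have key : ∀ ξ : idealBoundary X, ∃ η : idealBoundary Y,
      Tendsto (fun z => kl (J z)) (idealFilter ξ) (𝓝 (klein η)) := by
    intro ξ
    have hc : Cauchy (map (fun z => kl (J z)) (idealFilter ξ)) := by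
      rw [Metric.cauchy_iff]
      refine ⟨inferInstance, fun ε hε => ?_⟩
      obtain ⟨δ, hδ, hv⟩ := h.visual hε
      have h1 : ∀ᶠ z : X in idealFilter ξ, 1 - δ < ‖kl z‖ ∧ kl z ∈ Metric.ball (klein ξ) (δ / 2) :=
        ((tendsto_norm_kl_idealFilter ξ).eventually (lt_mem_nhds (by linarith))).and
          ((tendsto_kl_idealFilter ξ).eventually (Metric.ball_mem_nhds _ (half_pos hδ)))
      refine ⟨_, image_mem_map h1, ?_⟩
      rintro _ ⟨z, ⟨hz, hz'⟩, rfl⟩ _ ⟨w, ⟨-, hw'⟩, rfl⟩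
      rw [dist_eq_norm]
      refine hv z w hz ?_
      rw [← dist_eq_norm]
      rw [Metric.mem_ball] at hz' hw'
      have := dist_triangle_right (kl z) (kl w) (klein ξ)
      linarith
    obtain ⟨u, hu⟩ := CompleteSpace.complete hc
    have hu' : Tendsto (fun z => kl (J z)) (idealFilter ξ) (𝓝 u) := hu
    have hn : Tendsto (fun z => ‖kl (J z)‖) (idealFilter ξ) (𝓝 1) := by
      rw [tendsto_dist_I_iff]
      have h1 := tendsto_dist_I_iff.1 (tendsto_norm_kl_idealFilter ξ)
      have h2 : Tendsto (fun z : X => (dist (z : ℍ) UpperHalfPlane.I - C) / C) (idealFilter ξ) atTop :=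
        (tendsto_atTop_add_const_right _ (-C) h1).atTop_div_const hC
      refine tendsto_atTop_mono (fun z => ?_) h2
      rw [div_le_iff₀ hC]
      have := h.proper z
      linarith
    have hu1 : ‖u‖ = 1 := tendsto_nhds_unique hu'.norm hn
    obtain ⟨η, rfl⟩ := exists_idealBoundary_of_mem_closure (X := Y) hu1
      (mem_closure_of_tendsto hu' (Eventually.of_forall fun z => ⟨J z, (J z).2, rfl⟩))
    exact ⟨η, hu'⟩
  choose f hf using key
  exact ⟨f, isBoundaryExtension_iff.2 hf⟩

theorem IsBoundaryExtension.continuous_of_isCoarse {J : X → Y} {C : ℝ}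
    {f : idealBoundary X → idealBoundary Y} (hf : IsBoundaryExtension J f)
    (h : IsCoarse (fun x : X => (x : ℍ)) (fun x => (J x : ℍ)) C) : Continuous f := by
  rw [isBoundaryExtension_iff] at hf
  rw [(isEmbedding_klein_idealBoundary Y).continuous_iff, continuous_iff_continuousAt]
  intro ξ
  rw [ContinuousAt, Metric.tendsto_nhds]
  intro ε hε
  obtain ⟨δ, hδ, hv⟩ := h.visual (half_pos hε)
  have h0 : ContinuousAt (fun η : idealBoundary X => klein η) ξ :=
    (isEmbedding_klein_idealBoundary X).continuous.continuousAt
  filter_upwards [h0.eventually (Metric.ball_mem_nhds _ (show 0 < δ / 3 by linarith))] with η hη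
  have hb : ∀ ζ : idealBoundary X, ∀ᶠ z : X in idealFilter ζ,
      1 - δ < ‖kl z‖ ∧ dist (kl z) (klein ζ) < δ / 3 ∧
      dist (kl (J z)) (klein (f ζ)) < ε / 4 := fun ζ =>
    ((tendsto_norm_kl_idealFilter ζ).eventually (lt_mem_nhds (by linarith))).and
      (((tendsto_kl_idealFilter ζ).eventually (Metric.ball_mem_nhds _ (by linarith))).and
      ((hf ζ).eventually (Metric.ball_mem_nhds _ (by linarith))))
  obtain ⟨z, hz1, hz2, hz3⟩ := (hb ξ).exists
  obtain ⟨w, -, hw2, hw3⟩ := (hb η).exists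
  have hη' : dist (klein η) (klein ξ) < δ / 3 := hη
  have h1 := hv z w hz1 (by
    rw [← dist_eq_norm]
    have e1 := dist_triangle4 (kl z) (klein ξ) (klein η) (kl w)
    rw [dist_comm (klein ξ), dist_comm (klein η) (kl w)] at e1
    linarith)
  rw [← dist_eq_norm] at h1
  have e2 := dist_triangle4 (klein (f η)) (kl (J w)) (kl (J z)) (klein (f ξ))
  rw [dist_comm (klein (f η)) (kl (J w)), dist_comm (kl (J w)) (kl (J z))] at e2
  simp only [Function.comp_apply]
  linarith

/-- The visual estimate is applied to the inverse correspondence: points whose images have the same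
limit must themselves have the same limit. -/
theorem IsBoundaryExtension.injective_of_isCoarse {J : X → Y} {C : ℝ}
    {f : idealBoundary X → idealBoundary Y} (hf : IsBoundaryExtension J f)
    (h : IsCoarse (fun x : X => (J x : ℍ)) (fun x => (x : ℍ)) C) : Function.Injective f := by
  rw [isBoundaryExtension_iff] at hf
  intro ξ η he
  refine klein_idealBoundary_injective X ?_
  refine eq_of_forall_dist_le fun ε hε => ?_
  obtain ⟨δ, hδ, hv⟩ := h.visual (show 0 < ε / 3 by linarith)
  have hb : ∀ ζ : idealBoundary X, ∀ᶠ z : X in idealFilter ζ,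
      1 - δ < ‖kl (J z)‖ ∧ dist (kl z) (klein ζ) < ε / 3 ∧
      dist (kl (J z)) (klein (f ζ)) < δ / 2 := fun ζ => by
    have hn := (hf ζ).norm
    rw [norm_klein_idealBoundary] at hn
    exact (hn.eventually (lt_mem_nhds (by linarith))).and
      (((tendsto_kl_idealFilter ζ).eventually (Metric.ball_mem_nhds _ (by linarith))).and
      ((hf ζ).eventually (Metric.ball_mem_nhds _ (by linarith))))
  obtain ⟨z, hz1, hz2, hz3⟩ := (hb ξ).exists
  obtain ⟨w, -, hw2, hw3⟩ := (hb η).exists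
  rw [he] at hz3
  have h1 := hv z w hz1 (by
    rw [← dist_eq_norm]
    have := dist_triangle_right (kl (J z)) (kl (J w)) (klein (f η))
    linarith)
  rw [← dist_eq_norm] at h1
  have e2 := dist_triangle4 (klein ξ) (kl z) (kl w) (klein η)
  rw [dist_comm (klein ξ) (kl z)] at e2
  change dist (klein ξ) (klein η) ≤ ε
  linarith

end Extension

/-! ### Unordered pairs -/

theorem continuous_sym2_mk {α : Type*} [TopologicalSpace α] :
    Continuous fun p : α × α => s(p.1, p.2) := continuous_coinduced_rng

theorem continuous_sym2_map {α β : Type*} [TopologicalSpace α] [TopologicalSpace β] {f : α → β}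
    (hf : Continuous f) : Continuous (Sym2.map f) :=
  continuous_coinduced_dom.2
    ((continuous_sym2_mk (α := β)).comp ((hf.comp continuous_fst).prodMk (hf.comp continuous_snd)))

/-- Closedness in the quotient topology is tested on ordered pairs, where the relevant set is the
image of a compact set. -/
theorem isClosedMap_sym2_map {α β : Type*} [TopologicalSpace α] [CompactSpace α]
    [TopologicalSpace β] [T2Space β] {f : α → β} (hf : Continuous f) :
    IsClosedMap (Sym2.map f) := by
  intro A hA
  have h1 : IsClosed ((fun p : α × α => s(p.1, p.2)) ⁻¹' A) := hA.preimage continuous_sym2_mk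
  have h2 : IsClosed (Prod.map f f '' ((fun p : α × α => s(p.1, p.2)) ⁻¹' A)) :=
    (h1.isCompact.image (hf.prodMap hf)).isClosed
  refine isClosed_coinduced.2 ?_
  convert h2 using 1
  ext ⟨b, b'⟩
  constructor
  · rintro ⟨q, hq, he⟩
    induction q using Sym2.inductionOn with
    | hf a a' =>
      simp only [Sym2.map_mk] at he
      rcases Sym2.eq_iff.1 he with ⟨rfl, rfl⟩ | ⟨rfl, rfl⟩
      · exact ⟨(a, a'), hq, rfl⟩
      · exact ⟨(a', a), by rwa [mem_preimage, Sym2.eq_swap], rfl⟩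
  · rintro ⟨⟨a, a'⟩, hq, he⟩
    simp only [Prod.map_apply, Prod.mk.injEq] at he
    obtain ⟨rfl, rfl⟩ := he
    exact ⟨s(a, a'), hq, rfl⟩

theorem sym2_map_not_isDiag {α β : Type*} {f : α → β} (hf : Function.Injective f) {q : Sym2 α}
    (hq : ¬ q.IsDiag) : ¬ (Sym2.map f q).IsDiag := by
  induction q using Sym2.inductionOn with
  | hf a a' =>
    rw [Sym2.map_mk, Sym2.mk_isDiag_iff]
    rw [Sym2.mk_isDiag_iff] at hq
    exact fun h => hq (hf h)

/-- The map between spaces of geodesics induced by an injection of ideal boundaries. -/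
def geodesicMap {X Y : Set ℍ} (f : idealBoundary X → idealBoundary Y) (hf : Function.Injective f)
    (q : GeodesicSpace X) : GeodesicSpace Y :=
  ⟨Sym2.map f q.1, sym2_map_not_isDiag hf q.2⟩

theorem continuous_geodesicMap {X Y : Set ℍ} {f : idealBoundary X → idealBoundary Y}
    (hf : Function.Injective f) (hc : Continuous f) : Continuous (geodesicMap f hf) :=
  ((continuous_sym2_map hc).comp continuous_subtype_val).subtype_mk _

theorem injective_geodesicMap {X Y : Set ℍ} {f : idealBoundary X → idealBoundary Y}
    (hf : Function.Injective f) : Function.Injective (geodesicMap f hf) := fun _ _ h =>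
  Subtype.ext (Sym2.map.injective hf (congrArg Subtype.val h))

/-- The space of geodesics is not assumed compact; closedness is inherited from all unordered pairs,
because only off-diagonal pairs can have off-diagonal images. -/
theorem isClosedMap_geodesicMap {X Y : Set ℍ} {f : idealBoundary X → idealBoundary Y}
    (hf : Function.Injective f) (hc : Continuous f) : IsClosedMap (geodesicMap f hf) := by
  intro A hA
  obtain ⟨B, hB, rfl⟩ := isClosed_induced_iff.1 hA
  refine isClosed_induced_iff.2 ⟨Sym2.map f '' B, isClosedMap_sym2_map hc B hB, ?_⟩
  ext q
  constructor
  · rintro ⟨b, hb, he⟩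
    have hbd : ¬ b.IsDiag := by
      intro hd
      refine q.2 ?_
      rw [← he]
      induction b using Sym2.inductionOn with
      | hf a a' =>
        rw [Sym2.map_mk, Sym2.mk_isDiag_iff]
        rw [Sym2.mk_isDiag_iff] at hd
        rw [hd]
    exact ⟨⟨b, hbd⟩, hb, Subtype.ext he⟩
  · rintro ⟨b, hb, rfl⟩
    exact ⟨b.1, hb, rfl⟩

/-! ### Restriction to one component, and the interior of the universal cover -/

/-- A geodesic realization of a single surface. -/
structure IsRealization {R S : Type*} [TopologicalSpace R] [TopologicalSpace S]
    (hR : HyperbolicMetric R) {hS : HyperbolicMetric S} (US : UniversalCover hS) (I : R → S) :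
    Prop where
  continuous : Continuous I
  interior : IsEmbedding ((hR.boundary)ᶜ.domRestrict I)
  curve : ∀ x ∈ hR.boundary, ∃ β ⊆ hR.boundary, x ∈ β ∧ IsEmbedding (β.domRestrict I) ∧
    US.IsClosedGeodesic (I '' β)

theorem IsGeodesicRealization.isRealization {ι : Type*} {R : ι → Type*}
    [∀ i, TopologicalSpace (R i)] {S : Type*} [TopologicalSpace S]
    {hR : ∀ i, HyperbolicMetric (R i)} {hS : HyperbolicMetric S} {US : UniversalCover hS}
    {I : (Σ i, R i) → S} (hI : IsGeodesicRealization hR US I) (i : ι) :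
    IsRealization (hR i) US (fun x => I ⟨i, x⟩) := by
  refine ⟨hI.continuous.comp continuous_sigmaMk, ?_, fun x hx => ?_⟩
  · have h1 : IsEmbedding (fun x : ((hR i).boundaryᶜ : Set (R i)) =>
        (⟨⟨i, x⟩, x.2⟩ : ((sigmaBoundary hR)ᶜ : Set (Σ i, R i)))) :=
      (IsEmbedding.sigmaMk.comp IsEmbedding.subtypeVal).codRestrict (sigmaBoundary hR)ᶜ
        fun x => x.2
    exact hI.interior.comp h1
  · have hx' : (⟨i, x⟩ : Σ i, R i) ∈ sigmaBoundary hR := hx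
    obtain ⟨he, hg⟩ := hI.boundaryCurve _ ⟨⟨i, x⟩, hx', rfl⟩
    set β := connectedComponentIn (sigmaBoundary hR) ⟨i, x⟩ with hβ
    -- A boundary curve is connected, hence contained in a single clopen summand.
    have hmem : ∀ y ∈ β, ∃ y' : R i, y = ⟨i, y'⟩ := by
      have hp : IsPreconnected β := isPreconnected_connectedComponentIn
      have hclopen : IsClopen (range (Sigma.mk i : R i → Σ i, R i)) := isClopen_range_sigmaMk
      have hsub := hp.subset_isClopen hclopen ⟨_, mem_connectedComponentIn hx', ⟨x, rfl⟩⟩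
      intro y hy
      obtain ⟨y', rfl⟩ := hsub hy
      exact ⟨y', rfl⟩
    refine ⟨Sigma.mk i ⁻¹' β, fun y hy => ?_, mem_connectedComponentIn hx', ?_, ?_⟩
    · exact connectedComponentIn_subset (sigmaBoundary hR) ⟨i, x⟩ hy
    · have h1 : IsEmbedding (fun y : (Sigma.mk i ⁻¹' β : Set (R i)) => (⟨⟨i, y⟩, y.2⟩ : β)) :=
        (IsEmbedding.sigmaMk.comp IsEmbedding.subtypeVal).codRestrict β fun x => x.2
      exact he.comp h1
    · convert hg using 1
      ext s
      constructor
      · rintro ⟨y, hy, rfl⟩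
        exact ⟨_, hy, rfl⟩
      · rintro ⟨y, hy, rfl⟩
        obtain ⟨y', rfl⟩ := hmem y hy
        exact ⟨y', hy, rfl⟩

namespace UniversalCover

variable {S : Type*} [TopologicalSpace S] {h : HyperbolicMetric S} (U : UniversalCover h)

theorem subset_closure_interior : U.carrier ⊆ closure (interior U.carrier) := by
  intro z hz
  obtain ⟨φ, hφ, hs⟩ := h.cover (U.proj ⟨z, hz⟩)
  obtain ⟨A, -, hA⟩ := U.local_model ⟨z, hz⟩ hφ hs
  have hz0 : 0 ≤ (A • z).re := hA.self_of_nhds.1 hz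
  have hc : Continuous fun w : ℍ => (A • w).re :=
    UpperHalfPlane.continuous_re.comp (continuous_const_smul A)
  have ho : IsOpenMap fun w : ℍ => (A • w).re :=
    UpperHalfPlane.isOpenMap_re.comp (Homeomorph.smul A).isOpenMap
  rw [mem_closure_iff_nhds]
  intro V hV
  obtain ⟨V', hV', hVo, hzV⟩ := eventually_nhds_iff.1 (hA.and hV)
  obtain ⟨ε, hε, hb⟩ := Metric.isOpen_iff.1 (ho V' hVo) _ ⟨z, hzV, rfl⟩
  obtain ⟨w, hw, hw'⟩ := hb (show (A • z).re + ε / 2 ∈ Metric.ball _ ε by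
    rw [Metric.mem_ball, Real.dist_eq, add_sub_cancel_left, abs_of_pos] <;> linarith)
  refine ⟨w, (hV' w hw).2, ?_⟩
  refine mem_interior.2 ⟨V' ∩ {w | 0 < (A • w).re}, fun x hx => (hV' x hx.1).1.2 hx.2.le,
    hVo.inter (isOpen_lt continuous_const hc), hw, ?_⟩
  have : (A • w).re = (A • z).re + ε / 2 := hw'
  change 0 < (A • w).re
  linarith

theorem convex_interior [CompactSpace S] : Convex ℝ (kl '' interior U.carrier) := by
  have h1 := U.convex_carrier.interior
  have h2 : kl '' interior U.carrier = interior (kl '' U.carrier) := by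
    refine Subset.antisymm ?_ fun k hk => ?_
    · exact interior_maximal (image_mono interior_subset)
        (isOpenEmbedding_kl.isOpenMap _ isOpen_interior)
    · obtain ⟨w, hw, rfl⟩ := interior_subset hk
      refine ⟨w, ?_, rfl⟩
      rw [mem_interior_iff_mem_nhds] at hk ⊢
      exact isOpenEmbedding_kl.image_mem_nhds.1 hk
  rwa [h2]

theorem isPreconnected_interior [CompactSpace S] : IsPreconnected (interior U.carrier) :=
  isOpenEmbedding_kl.isInducing.isPreconnected_image.1 U.convex_interior.isPreconnected

/-- The interior of the universal cover, as a subset of the universal cover. -/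
def int : Set U.carrier := {z | (z : ℍ) ∈ interior U.carrier}

theorem mem_int_iff (z : U.carrier) : z ∈ U.int ↔ U.proj z ∉ h.boundary := U.mem_interior_iff z

theorem image_int : Subtype.val '' U.int = interior U.carrier := by
  ext z
  constructor
  · rintro ⟨z, hz, rfl⟩
    exact hz
  · exact fun hz => ⟨⟨z, interior_subset hz⟩, hz, rfl⟩

theorem isOpen_int : IsOpen U.int := isOpen_interior.preimage continuous_subtype_val

theorem isPreconnected_int [CompactSpace S] : IsPreconnected U.int := by
  rw [← IsInducing.subtypeVal.isPreconnected_image, image_int]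
  exact U.isPreconnected_interior

theorem dense_int : Dense U.int := by
  intro z
  rw [IsInducing.subtypeVal.closure_eq_preimage_closure_image, image_int]
  exact U.subset_closure_interior z.2

theorem nonempty_int : U.int.Nonempty := by
  have := U.simplyConnected
  have : Nonempty U.carrier := inferInstance
  exact U.dense_int.nonempty

theorem isClosed_boundary {h : HyperbolicMetric S} (U : UniversalCover h) : IsClosed h.boundary := by
  have h1 : h.boundaryᶜ = U.proj '' U.int := by
    ext s
    constructor
    · intro hs
      obtain ⟨z, rfl⟩ := U.surjective s
      exact ⟨z, (U.mem_int_iff z).2 hs, rfl⟩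
    · rintro ⟨z, hz, rfl⟩
      exact (U.mem_int_iff z).1 hz
  rw [← isOpen_compl_iff, h1]
  exact U.isCoveringMap.isOpenMap _ U.isOpen_int

/-- A closed geodesic lifts to a complete geodesic through each point above it. -/
theorem IsClosedGeodesic.exists_line [CompactSpace S] {C : Set S} (hC : U.IsClosedGeodesic C)
    {w : U.carrier} (hw : U.proj w ∈ C) : ∃ (c : ℝ → ℍ) (v u : ℂ), IsGeodesicLine c v u ∧
      (w : ℍ) ∈ range c ∧ ∀ t, ∃ ht : c t ∈ U.carrier, U.proj ⟨c t, ht⟩ ∈ C := by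
  obtain ⟨c, hc, -, rfl⟩ := hC
  obtain ⟨t, ht⟩ := hw
  obtain ⟨g, hg, hgt⟩ := U.exists_deck ht
  have hi : Isometry fun t => (g (c t) : ℍ) :=
    isometry_subtype_coe.comp ((U.isometry_of_deck g.continuous hg).comp hc)
  obtain ⟨v, u, hl⟩ := hi.exists_isGeodesicLine
  exact ⟨_, v, u, hl, ⟨t, congrArg Subtype.val hgt⟩,
    fun s => ⟨(g (c s)).2, s, (hg (c s)).symm⟩⟩

end UniversalCover

theorem image_mem_nhds_of_injOn_upperHalfPlane {X Y : Set ℍ} {J : X → Y} (hJ : Continuous J) {x : X}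
    (hx : (x : ℍ) ∈ interior X) {s : Set X} (hs : s ∈ 𝓝 x) (hinj : InjOn J s) :
    (fun y => (J y : ℍ)) '' s ∈ 𝓝 (J x : ℍ) := by
  let i : X → ℂ := fun y => ((y : ℍ) : ℂ)
  have hi : IsEmbedding i := UpperHalfPlane.isEmbedding_coe.comp IsEmbedding.subtypeVal
  -- The value 0 off the image of X plays no role: continuity and injectivity of g are only used on
  -- the image of s.
  let g : ℂ → ℂ := Function.extend i (fun y => ((J y : ℍ) : ℂ)) 0
  have hg : ∀ y, g (i y) = ((J y : ℍ) : ℂ) := fun y => hi.injective.extend_apply _ _ _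
  have hJc : Continuous fun y => ((J y : ℍ) : ℂ) :=
    UpperHalfPlane.continuous_coe.comp (continuous_subtype_val.comp hJ)
  have hs' : i '' s ∈ 𝓝 (i x) := by
    have h1 : Subtype.val '' s ∈ 𝓝 (x : ℍ) := by
      have h2 : X ∈ 𝓝 (x : ℍ) := mem_interior_iff_mem_nhds.1 hx
      rw [← map_nhds_subtype_coe_eq_nhds x.2 h2]
      exact image_mem_map hs
    have h3 := UpperHalfPlane.isOpenEmbedding_coe.image_mem_nhds.2 h1
    rwa [image_image] at h3
  have hcont : ContinuousOn g (i '' s) := by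
    refine ContinuousOn.mono (s := range i) ?_ (image_subset_range _ _)
    rintro _ ⟨y, rfl⟩
    rw [ContinuousWithinAt, ← hi.map_nhds_eq, tendsto_map'_iff, hg]
    exact (hJc.tendsto y).congr fun z => (hg z).symm
  have hin : InjOn g (i '' s) := by
    rintro _ ⟨y, hy, rfl⟩ _ ⟨z, hz, rfl⟩ he
    rw [hg, hg] at he
    rw [hinj hy hz (Subtype.ext (UpperHalfPlane.ext he))]
  have h4 := Complex.image_mem_nhds_of_injOn hs' hcont hin
  rw [hg] at h4
  refine UpperHalfPlane.isOpenEmbedding_coe.image_mem_nhds.1 (Filter.mem_of_superset h4 ?_)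
  rintro _ ⟨_, ⟨y, hy, rfl⟩, rfl⟩
  rw [hg]
  exact ⟨_, ⟨y, hy, rfl⟩, rfl⟩

theorem UniversalCover.image_proj_int {S : Type*} [TopologicalSpace S] {h : HyperbolicMetric S}
    (U : UniversalCover h) : U.proj '' U.int = h.boundaryᶜ := by
  ext s
  constructor
  · rintro ⟨z, hz, rfl⟩
    exact (U.mem_int_iff z).1 hz
  · intro hs
    obtain ⟨z, rfl⟩ := U.surjective s
    exact ⟨z, (U.mem_int_iff z).2 hs, rfl⟩

theorem UniversalCover.dense_compl_boundary {S : Type*} [TopologicalSpace S]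
    {h : HyperbolicMetric S} (U : UniversalCover h) : Dense h.boundaryᶜ := by
  rw [← U.image_proj_int]
  exact U.surjective.denseRange.dense_image U.isCoveringMap.continuous U.dense_int

/-! ### Lifts of a realization and the convex image of the interior -/

/-- `J` is a lift to the universal covers of the geodesic realization `I`. -/
structure IsRealizationLift {R S : Type*} [TopologicalSpace R] [TopologicalSpace S]
    {hR : HyperbolicMetric R} {hS : HyperbolicMetric S} (UR : UniversalCover hR)
    (US : UniversalCover hS) (I : R → S) (J : UR.carrier → US.carrier) : Prop where
  realization : IsRealization hR US I
  continuous : Continuous J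
  lifts : ∀ z, US.proj (J z) = I (UR.proj z)

namespace IsRealizationLift

variable {R S : Type*} [TopologicalSpace R] [TopologicalSpace S]
    {hR : HyperbolicMetric R} {hS : HyperbolicMetric S} {UR : UniversalCover hR}
    {US : UniversalCover hS} {I : R → S} {J : UR.carrier → US.carrier}
    (h : IsRealizationLift UR US I J)

/-- The preimage in the universal cover of `S` of the image of the boundary of `R`. -/
def wall (hR : HyperbolicMetric R) (US : UniversalCover hS) (I : R → S) : Set US.carrier :=
  US.proj ⁻¹' (I '' hR.boundary)

include h

theorem injOn : InjOn I hR.boundaryᶜ := injOn_iff_injective.2 h.realization.interior.injective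

/-- If an interior point x and a boundary point y had the same image, interior points near y would
have images near I x. The embedding property on the interior would then bring them near x, against
Hausdorffness. -/
theorem apply_ne [T2Space R] {x y : R} (hx : x ∉ hR.boundary) (hy : y ∈ hR.boundary) :
    I x ≠ I y := by
  intro he
  obtain ⟨U, V, hU, hV, hxU, hyV, hd⟩ := t2_separation (fun e : x = y => hx (e ▸ hy))
  have h1 : (Subtype.val ⁻¹' U : Set (hR.boundaryᶜ : Set R)) ∈ 𝓝 (⟨x, hx⟩ : (hR.boundaryᶜ : Set R)) :=
    (hU.preimage continuous_subtype_val).mem_nhds hxU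
  rw [h.realization.interior.isInducing.nhds_eq_comap, mem_comap] at h1
  obtain ⟨O, hO, hOU⟩ := h1
  have hO' : O ∈ 𝓝 (I y) := he ▸ hO
  have h2 := (h.realization.continuous.tendsto y) hO'
  obtain ⟨r, ⟨hr, hrV⟩, hri⟩ := mem_closure_iff_nhds.1 (UR.dense_compl_boundary y) _
    (inter_mem h2 (hV.mem_nhds hyV))
  have h3 : r ∈ U := @hOU ⟨r, hri⟩ hr
  exact disjoint_left.1 hd h3 hrV

/-- Near an interior point J is injective, because the projection is locally injective and I is
injective on the interior; invariance of domain applies. -/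
theorem image_mem_nhds {x : UR.carrier} (hx : x ∈ UR.int) {s : Set UR.carrier} (hs : s ∈ 𝓝 x) :
    (fun y => (J y : ℍ)) '' s ∈ 𝓝 (J x : ℍ) := by
  obtain ⟨V, hV, hxV, hinj⟩ := UR.isCoveringMap.isLocalHomeomorph.isLocallyInjective x
  refine Filter.mem_of_superset (image_mem_nhds_of_injOn_upperHalfPlane h.continuous (s := s ∩ V ∩ UR.int)
    hx (inter_mem (inter_mem hs (hV.mem_nhds hxV)) (UR.isOpen_int.mem_nhds hx)) ?_)
    (image_mono fun z hz => hz.1.1)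
  intro y hy z hz hyz
  refine hinj hy.1.2 hz.1.2 (h.injOn ((UR.mem_int_iff y).1 hy.2) ((UR.mem_int_iff z).1 hz.2) ?_)
  rw [← h.lifts, ← h.lifts, hyz]

/-- The interior of the universal cover of `R` has open image in the hyperbolic plane. -/
theorem isOpen_image_int : IsOpen ((fun y => (J y : ℍ)) '' UR.int) := by
  rw [isOpen_iff_mem_nhds]
  rintro _ ⟨x, hx, rfl⟩
  exact h.image_mem_nhds hx (UR.isOpen_int.mem_nhds hx)

theorem isOpen_image_int' : IsOpen (J '' UR.int) := by
  have h1 := h.isOpen_image_int.preimage (continuous_subtype_val (p := (· ∈ US.carrier)))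
  convert h1 using 1
  ext w
  constructor
  · rintro ⟨x, hx, rfl⟩
    exact ⟨x, hx, rfl⟩
  · rintro ⟨x, hx, hw⟩
    exact ⟨x, hx, Subtype.ext hw⟩

theorem isOpen_image_compl_boundary : IsOpen (I '' hR.boundaryᶜ) := by
  have : I '' hR.boundaryᶜ = US.proj '' (J '' UR.int) := by
    rw [← UR.image_proj_int, image_image, image_image]
    simp only [h.lifts]
  rw [this]
  exact US.isCoveringMap.isOpenMap _ h.isOpen_image_int'

theorem isClosed_wall [CompactSpace R] [T2Space S] : IsClosed (wall hR US I) :=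
  ((UR.isClosed_boundary.isCompact.image h.realization.continuous).isClosed).preimage
    US.isCoveringMap.continuous

theorem exists_line_of_mem_wall [CompactSpace S] {w : US.carrier} (hw : w ∈ wall hR US I) :
    ∃ (c : ℝ → ℍ) (v u : ℂ), IsGeodesicLine c v u ∧ (w : ℍ) ∈ range c ∧
      ∀ z ∈ range c, ∃ hz : z ∈ US.carrier, (⟨z, hz⟩ : US.carrier) ∈ wall hR US I := by
  obtain ⟨x, hx, hxw⟩ := hw
  obtain ⟨β, hβ, hxβ, -, hC⟩ := h.realization.curve x hx
  obtain ⟨c, v, u, hc, hwc, hall⟩ := UniversalCover.IsClosedGeodesic.exists_line US hC (w := w) ⟨x, hxβ, hxw⟩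
  refine ⟨c, v, u, hc, hwc, ?_⟩
  rintro _ ⟨t, rfl⟩
  obtain ⟨ht, hm⟩ := hall t
  exact ⟨ht, image_mono hβ hm⟩

theorem apply_notMem_wall [T2Space R] {x : UR.carrier} (hx : x ∈ UR.int) : J x ∉ wall hR US I := by
  rintro ⟨y, hy, he⟩
  rw [h.lifts] at he
  exact h.apply_ne ((UR.mem_int_iff x).1 hx) hy he.symm

theorem apply_mem_wall {x : UR.carrier} (hx : x ∉ UR.int) : J x ∈ wall hR US I :=
  ⟨UR.proj x, by_contra fun hn => hx ((UR.mem_int_iff x).2 hn), (h.lifts x).symm⟩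

/-- A chord between two points of W that met the wall would meet a complete geodesic contained in
the wall. W is connected and avoids that geodesic, so W lies strictly on one side of it and the
chord cannot reach it. -/
theorem convex_component [CompactSpace R] [CompactSpace S] [T2Space S] (w : US.carrier) :
    Convex ℝ (kl '' (Subtype.val '' connectedComponentIn (wall hR US I)ᶜ w)) := by
  set W := connectedComponentIn (wall hR US I)ᶜ w with hW
  have hWp : IsPreconnected W := isPreconnected_connectedComponentIn
  rw [convex_iff_segment_subset]
  rintro _ ⟨_, ⟨a, ha, rfl⟩, rfl⟩ _ ⟨_, ⟨b, hb, rfl⟩, rfl⟩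
  have hseg : segment ℝ (kl a) (kl b) ⊆ kl '' US.carrier :=
    US.convex_carrier.segment_subset ⟨a, a.2, rfl⟩ ⟨b, b.2, rfl⟩
  let T : Set US.carrier := {z | kl z ∈ segment ℝ (kl a) (kl b)}
  have hT : (fun z : US.carrier => kl z) '' T = segment ℝ (kl a) (kl b) := by
    refine Subset.antisymm (by rintro _ ⟨z, hz, rfl⟩; exact hz) fun k hk => ?_
    obtain ⟨z, hz, rfl⟩ := hseg hk
    exact ⟨⟨z, hz⟩, hk, rfl⟩
  have hTp : IsPreconnected T := by
    rw [← US.isEmbedding_kl_carrier.isInducing.isPreconnected_image, hT]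
    exact (convex_segment _ _).isPreconnected
  have hTΓ : T ⊆ (wall hR US I)ᶜ := by
    intro p hp hpΓ
    obtain ⟨c, v, u, hc, hpc, hall⟩ := h.exists_line_of_mem_wall hpΓ
    obtain ⟨L, m, -, hLm⟩ := hc.isometry.exists_functional
    have hcont : Continuous fun z : US.carrier => L (kl z) + m :=
      (L.continuous.comp US.isEmbedding_kl_carrier.continuous).add_const m
    have hne : ∀ z ∈ W, L (kl z) + m ≠ 0 := fun z hz h0 =>
      connectedComponentIn_subset _ _ hz (hall z ((hLm z).2 h0)).2
    have hp0 : L (kl p) + m = 0 := (hLm p).1 hpc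
    obtain ⟨s, t, hs, ht, hst, he⟩ : kl p ∈ segment ℝ (kl a) (kl b) := hp
    have he' : s * (L (kl a) + m) + t * (L (kl b) + m) = 0 := by
      rw [← hp0, ← he, map_add, map_smul, map_smul, smul_eq_mul, smul_eq_mul]
      linear_combination m * hst
    have hsub := hWp.image _ hcont.continuousOn
    have hna : ¬ (L (kl a) + m ≤ 0 ∧ 0 ≤ L (kl b) + m) := fun hab => by
      obtain ⟨z, hz, hz0⟩ := hsub.Icc_subset ⟨a, ha, rfl⟩ ⟨b, hb, rfl⟩ ⟨hab.1, hab.2⟩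
      exact hne z hz hz0
    have hnb : ¬ (L (kl b) + m ≤ 0 ∧ 0 ≤ L (kl a) + m) := fun hab => by
      obtain ⟨z, hz, hz0⟩ := hsub.Icc_subset ⟨b, hb, rfl⟩ ⟨a, ha, rfl⟩ ⟨hab.1, hab.2⟩
      exact hne z hz hz0
    rcases le_total (L (kl a) + m) 0 with ha0 | ha0
    · have hb0 : L (kl b) + m < 0 := lt_of_not_ge fun hb0 => hna ⟨ha0, hb0⟩
      have ha0' := lt_of_le_of_ne ha0 (hne a ha)
      rcases hs.eq_or_lt with rfl | hs
      · obtain rfl : t = 1 := by linarith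
        linarith
      · nlinarith
    · have hb0 : 0 < L (kl b) + m := lt_of_not_ge fun hb0 => hnb ⟨hb0, ha0⟩
      have ha0' := lt_of_le_of_ne ha0 (hne a ha).symm
      rcases hs.eq_or_lt with rfl | hs
      · obtain rfl : t = 1 := by linarith
        linarith
      · nlinarith
  have hTW : T ⊆ W := by
    have := hTp.subset_connectedComponentIn (x := a) (left_mem_segment ℝ _ _) hTΓ
    rwa [← connectedComponentIn_eq ha] at this
  rw [← hT]
  rintro _ ⟨z, hz, rfl⟩
  exact ⟨z, ⟨z, hTW hz, rfl⟩, rfl⟩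

/-- Off the wall, a point projects either into the open image of the interior of R or outside the
closed image of R; a connected set meeting the first alternative stays in it. -/
theorem component_subset [T2Space R] [CompactSpace R] [CompactSpace S] [T2Space S] {x₀ : UR.carrier} (hx₀ : x₀ ∈ UR.int)
    {w : US.carrier} (hw : w ∈ connectedComponentIn (wall hR US I)ᶜ (J x₀)) :
    US.proj w ∈ I '' hR.boundaryᶜ := by
  have hp : Continuous US.proj := US.isCoveringMap.continuous
  have hr : IsClosed (range I) := (isCompact_range h.realization.continuous).isClosed
  refine isPreconnected_connectedComponentIn.subset_left_of_subset_union
    (h.isOpen_image_compl_boundary.preimage hp) (hr.isOpen_compl.preimage hp) ?_ ?_ ?_ hw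
  · refine disjoint_left.2 fun z hz hz' => hz' ?_
    exact image_subset_range _ _ hz
  · intro z hz
    by_cases hzr : US.proj z ∈ range I
    · left
      obtain ⟨r, hr⟩ := hzr
      exact ⟨r, fun hrb => connectedComponentIn_subset _ _ hz ⟨r, hrb, hr⟩, hr⟩
    · exact Or.inr hzr
  · exact ⟨J x₀, mem_connectedComponentIn (h.apply_notMem_wall hx₀), UR.proj x₀,
      (UR.mem_int_iff x₀).1 hx₀, (h.lifts x₀).symm⟩

/-- The component W is convex, hence contractible, so the map k, projection followed by the inverse
of I on the interior, lifts to a map K into the cover of R. Uniqueness of lifts shows that K and J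
are mutually inverse between W and the interior. -/
theorem injOn_int_and_image_int_eq [T2Space R] [CompactSpace R] [CompactSpace S] [T2Space S] {x₀ : UR.carrier}
    (hx₀ : x₀ ∈ UR.int) : InjOn J UR.int ∧
      J '' UR.int = connectedComponentIn (wall hR US I)ᶜ (J x₀) := by
  have := US.locallyPathConnectedSpace
  set W := connectedComponentIn (wall hR US I)ᶜ (J x₀) with hW
  have hWo : IsOpen W := h.isClosed_wall.isOpen_compl.connectedComponentIn
  have hxW : J x₀ ∈ W := mem_connectedComponentIn (h.apply_notMem_wall hx₀)
  have hJW : J '' UR.int ⊆ W :=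
    (UR.isPreconnected_int.image _ h.continuous.continuousOn).subset_connectedComponentIn
      ⟨x₀, hx₀, rfl⟩ (by rintro _ ⟨x, hx, rfl⟩; exact h.apply_notMem_wall hx)
  have hconv := h.convex_component (J x₀)
  have : LocallyPathConnectedSpace W := hWo.locallyPathConnectedSpace
  have hemb : IsEmbedding fun w : W => kl (w : US.carrier) :=
    US.isEmbedding_kl_carrier.comp IsEmbedding.subtypeVal
  have hrange : range (fun w : W => kl (w : US.carrier)) = kl '' (Subtype.val '' W) := by
    rw [image_image, image_eq_range]
  have : ContractibleSpace W := by
    have := hconv.contractibleSpace ⟨_, J x₀, ⟨J x₀, hxW, rfl⟩, rfl⟩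
    exact (hemb.toHomeomorph.trans (Homeomorph.setCongr hrange)).contractibleSpace
  let e := h.realization.interior.toHomeomorph
  have hmem : ∀ w : W, US.proj w ∈ range (hR.boundaryᶜ.domRestrict I) := fun w => by
    obtain ⟨r, hr, he⟩ := h.component_subset hx₀ w.2
    exact ⟨⟨r, hr⟩, he⟩
  let k : C(W, R) := ⟨fun w => e.symm ⟨US.proj w, hmem w⟩, by
    have := US.isCoveringMap.continuous
    fun_prop⟩
  have hk : ∀ w, k w ∉ hR.boundary := fun w => (e.symm ⟨US.proj w, hmem w⟩).2
  have hIk : ∀ w, I (k w) = US.proj w := fun w =>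
    congrArg Subtype.val (e.apply_symm_apply ⟨US.proj w, hmem w⟩)
  have hkJ : ∀ x (hx : x ∈ UR.int), k ⟨J x, hJW ⟨x, hx, rfl⟩⟩ = UR.proj x := fun x hx =>
    h.injOn (hk _) ((UR.mem_int_iff x).1 hx) (by rw [hIk, ← h.lifts])
  obtain ⟨K, ⟨hK0, hK⟩, -⟩ := UR.isCoveringMap.existsUnique_continuousMap_lifts k ⟨J x₀, hxW⟩ x₀
    (hkJ x₀ hx₀).symm
  replace hK : ∀ w, UR.proj (K w) = k w := congr_fun hK
  have hJK : J ∘ K = Subtype.val := US.isCoveringMap.eq_of_comp_eq (h.continuous.comp K.continuous)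
    continuous_subtype_val (by funext w; simp [h.lifts, hK, hIk]) ⟨J x₀, hxW⟩ (by simp [hK0])
  have : PreconnectedSpace UR.int := isPreconnected_iff_preconnectedSpace.1 UR.isPreconnected_int
  have hKJ : (fun x : UR.int => K ⟨J x, hJW ⟨x, x.2, rfl⟩⟩) = Subtype.val := by
    have hc := h.continuous
    refine UR.isCoveringMap.eq_of_comp_eq (by fun_prop) continuous_subtype_val ?_ ⟨x₀, hx₀⟩ hK0
    funext x
    simp only [Function.comp, hK]
    exact hkJ x x.2
  refine ⟨fun x hx y hy hxy => ?_, hJW.antisymm fun w hw => ?_⟩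
  · have h1 := congr_fun hKJ ⟨x, hx⟩
    have h2 := congr_fun hKJ ⟨y, hy⟩
    simp only at h1 h2
    rw [← h1, ← h2]
    congr 2
  · refine ⟨K ⟨w, hw⟩, ?_, congr_fun hJK ⟨w, hw⟩⟩
    rw [UR.mem_int_iff, hK]
    exact hk _

variable [T2Space R] [CompactSpace R] [CompactSpace S] [T2Space S]

theorem injOn_int : InjOn J UR.int := by
  obtain ⟨x₀, hx₀⟩ := UR.nonempty_int
  exact (h.injOn_int_and_image_int_eq hx₀).1

theorem convex_image_int : Convex ℝ (kl '' ((fun y => (J y : ℍ)) '' UR.int)) := by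
  obtain ⟨x₀, hx₀⟩ := UR.nonempty_int
  have := h.convex_component (J x₀)
  rw [← (h.injOn_int_and_image_int_eq hx₀).2, image_image, image_image] at this
  rwa [image_image]

end IsRealizationLift

/-! ### Coarse maps from bounds at unit scale -/

section Coarse

variable {α : Type*} {P Q : α → ℍ}

/-- Convexity allows the geodesic between two values of P to be cut into unit steps whose ends are
again values of P. -/
theorem dist_le_of_step {C : ℝ} (hP : Convex ℝ (kl '' range P))
    (hs : ∀ a b, dist (P a) (P b) ≤ 1 → dist (Q a) (Q b) ≤ C) (a b : α) :
    dist (Q a) (Q b) ≤ C * dist (P a) (P b) + C := by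
  have hC : 0 ≤ C := dist_nonneg.trans (hs a a (by simp))
  have key : ∀ n : ℕ, ∀ a b, dist (P a) (P b) ≤ n + 1 → dist (Q a) (Q b) ≤ C * (n + 1) := by
    intro n
    induction n with
    | zero =>
      intro a b h
      simpa using hs a b (by simpa using h)
    | succ n ih =>
      intro a b h
      push_cast at h ⊢
      obtain ⟨c, hc, hc0, hc1, hcs⟩ := exists_geodesic_segment (P a) (P b)
      set d := dist (P a) (P b) with hd
      have hd0 : 0 ≤ d := dist_nonneg
      set t := min d (n + 1) with ht
      have ht0 : 0 ≤ t := le_min hd0 (by positivity)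
      have htd : t ≤ d := min_le_left _ _
      obtain ⟨_, ⟨x, rfl⟩, hx⟩ := hP.segment_subset ⟨_, ⟨a, rfl⟩, rfl⟩ ⟨_, ⟨b, rfl⟩, rfl⟩
        (hcs t ⟨ht0, htd⟩)
      have hx' : P x = c t := kl_injective hx
      have h1 : dist (P a) (P x) ≤ n + 1 := by
        rw [hx', ← hc0, hc.dist_eq, Real.dist_eq, zero_sub, abs_neg, abs_of_nonneg ht0]
        exact min_le_right _ _
      have h2 : dist (P x) (P b) ≤ 1 := by
        rw [hx', ← hc1, hc.dist_eq, Real.dist_eq, abs_sub_comm, abs_of_nonneg (by linarith)]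
        rcases min_choice d (n + 1) with h' | h' <;> rw [← ht] at h' <;> rw [h'] <;> linarith
      have := dist_triangle (Q a) (Q x) (Q b)
      have h3 := ih a x h1
      have h4 := hs x b h2
      linarith
  have h1 := key ⌊dist (P a) (P b)⌋₊ a b (Nat.lt_floor_add_one _).le
  have h2 := Nat.floor_le (dist_nonneg (x := P a) (y := P b))
  nlinarith

theorem exists_isCoarse [Nonempty α] (hP : Convex ℝ (kl '' range P)) (hQ : Convex ℝ (kl '' range Q))
    (h1 : ∃ C, ∀ a b, dist (P a) (P b) ≤ 1 → dist (Q a) (Q b) ≤ C)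
    (h2 : ∃ C, ∀ a b, dist (Q a) (Q b) ≤ 1 → dist (P a) (P b) ≤ C) : ∃ C, IsCoarse P Q C := by
  obtain ⟨C₁, h1⟩ := h1
  obtain ⟨C₂, h2⟩ := h2
  obtain ⟨o⟩ := ‹Nonempty α›
  have hC₂ : 0 ≤ C₂ := dist_nonneg.trans (h2 o o (by simp))
  set p := dist (P o) UpperHalfPlane.I
  set q := dist (Q o) UpperHalfPlane.I
  have hp : 0 ≤ p := dist_nonneg
  have hq : 0 ≤ q := dist_nonneg
  have hC₁ : 0 ≤ C₁ := dist_nonneg.trans (h1 o o (by simp))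
  -- The constant must dominate C₁ for single steps, and C₂, C₂q + C₂ + p for properness; the latter
  -- come from comparing a with the fixed parameter o.
  refine ⟨1 + C₁ + (C₂ * q + C₂ + p), by nlinarith [mul_nonneg hC₂ hq], hP,
    fun a b hab => (h1 a b hab).trans (by nlinarith [mul_nonneg hC₂ hq]), fun a => ?_⟩
  have h3 := dist_le_of_step hQ h2 a o
  have h4 := dist_triangle (P a) (P o) UpperHalfPlane.I
  have h5 := dist_triangle (Q a) UpperHalfPlane.I (Q o)
  rw [dist_comm UpperHalfPlane.I] at h5
  have h6 : 0 ≤ dist (Q a) UpperHalfPlane.I := dist_nonneg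
  have h7 := mul_le_mul_of_nonneg_left h5 hC₂
  have h8 : 0 ≤ (1 + C₁ + C₂ * q + p) * dist (Q a) UpperHalfPlane.I := by positivity
  nlinarith

end Coarse

theorem convex_kl_closure {W : Set ℍ} (hW : Convex ℝ (kl '' W)) : Convex ℝ (kl '' closure W) := by
  rw [isOpenEmbedding_kl.isInducing.closure_eq_preimage_closure_image,
    image_preimage_eq_inter_range, range_kl]
  exact hW.closure.inter (convex_ball _ _)

namespace UniversalCover

variable {S : Type*} [TopologicalSpace S] {h : HyperbolicMetric S} (U : UniversalCover h)

theorem nonempty_carrier : Nonempty U.carrier := by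
  have := U.simplyConnected
  infer_instance

theorem properSpace_carrier [CompactSpace S] : ProperSpace U.carrier :=
  .of_isClosed U.isClosed_carrier

theorem finite_fiber_inter [CompactSpace S] [T1Space S] (s : S) {B : Set U.carrier}
    (hB : IsCompact B) : (B ∩ U.proj ⁻¹' {s}).Finite := by
  have hd : DiscreteTopology (U.proj ⁻¹' {s}) := (U.isCoveringMap s).discreteTopology_fiber
  have hc : IsClosed (U.proj ⁻¹' {s}) := isClosed_singleton.preimage U.isCoveringMap.continuous
  refine (hB.inter_right hc).finite ?_
  exact IsDiscrete.mono ⟨hd⟩ inter_subset_right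

theorem exists_isCoarse_deck [CompactSpace S] {g : U.carrier ≃ₜ U.carrier}
    (hg : ∀ z, U.proj (g z) = U.proj z) :
    ∃ C, IsCoarse (fun z : U.carrier => (z : ℍ)) (fun z => (g z : ℍ)) C := by
  have := U.nonempty_carrier
  have hi : ∀ a b, dist (g a : ℍ) (g b) = dist (a : ℍ) b :=
    fun a b => (U.isometry_of_deck g.continuous hg).dist_eq a b
  have h1 : range (fun z => (g z : ℍ)) = U.carrier := by
    rw [show (fun z => (g z : ℍ)) = Subtype.val ∘ g from rfl, range_comp, g.surjective.range_eq,
      image_univ, Subtype.range_coe]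
  refine exists_isCoarse ?_ ?_ ⟨1, fun a b hab => (hi a b).trans_le hab⟩
    ⟨1, fun a b hab => (hi a b).symm.trans_le hab⟩
  · rw [Subtype.range_coe]
    exact U.convex_carrier
  · rw [h1]
    exact U.convex_carrier

theorem exists_isBoundaryExtension_deck [CompactSpace S] {g : U.carrier ≃ₜ U.carrier}
    (hg : ∀ z, U.proj (g z) = U.proj z) :
    ∃ f : idealBoundary U.carrier → idealBoundary U.carrier, IsBoundaryExtension g f := by
  obtain ⟨C, hC⟩ := U.exists_isCoarse_deck hg
  exact hC.exists_isBoundaryExtension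

end UniversalCover

/-! ### Lifts are coarse in both directions -/

namespace IsRealizationLift

variable {R S : Type*} [TopologicalSpace R] [TopologicalSpace S]
    {hR : HyperbolicMetric R} {hS : HyperbolicMetric S} {UR : UniversalCover hR}
    {US : UniversalCover hS} {I : R → S} {J : UR.carrier → US.carrier}
    (h : IsRealizationLift UR US I J)

include h

theorem exists_deck_comp {g : UR.carrier → UR.carrier} (hgc : Continuous g)
    (hg : ∀ z, UR.proj (g z) = UR.proj z) {g' : US.carrier → US.carrier} (hgc' : Continuous g')
    (hg' : ∀ z, US.proj (g' z) = US.proj z) {x : UR.carrier} (hx : J (g x) = g' (J x))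
    (z : UR.carrier) : J (g z) = g' (J z) := by
  have := UR.simplyConnected
  refine congr_fun (US.isCoveringMap.eq_of_comp_eq (g₁ := J ∘ g) (g₂ := g' ∘ J)
    (h.continuous.comp hgc) (hgc'.comp h.continuous) ?_ x hx) z
  funext w
  simp [hg', h.lifts, hg]

/-- The induced homomorphism of deck groups, one element at a time: the two sides lift the same map
and agree at one point. -/
theorem exists_equivariant {g : UR.carrier → UR.carrier} (hgc : Continuous g)
    (hg : ∀ z, UR.proj (g z) = UR.proj z) : ∃ g' : US.carrier ≃ₜ US.carrier,
      (∀ z, US.proj (g' z) = US.proj z) ∧ ∀ z, J (g z) = g' (J z) := by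
  obtain ⟨x⟩ := UR.nonempty_carrier
  obtain ⟨g', hg', hx⟩ := US.exists_deck (z := J x) (z' := J (g x))
    (by rw [h.lifts, h.lifts, hg])
  exact ⟨g', hg', h.exists_deck_comp hgc hg g'.continuous hg' hx.symm⟩

theorem dist_equivariant {g : UR.carrier → UR.carrier} (hgc : Continuous g)
    (hg : ∀ z, UR.proj (g z) = UR.proj z) (x y : UR.carrier) :
    dist (J (g x)) (J (g y)) = dist (J x) (J y) := by
  obtain ⟨g', hg', he⟩ := h.exists_equivariant hgc hg
  rw [he, he, (US.isometry_of_deck g'.continuous hg').dist_eq]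

variable [CompactSpace R]

/-- By equivariance x may be moved into a compact fundamental set; then y lies in a compact
neighbourhood of it, on whose image distances are bounded. -/
theorem exists_dist_le (D : ℝ) :
    ∃ C, ∀ x y : UR.carrier, dist x y ≤ D → dist (J x) (J y) ≤ C := by
  have := UR.properSpace_carrier
  obtain ⟨K, hK, -, hKg⟩ := UR.exists_compact_fundamental
  have hB := (hK.cthickening (r := D)).image h.continuous
  have hB' := hB.isBounded
  obtain ⟨C, hC⟩ := Metric.isBounded_iff.1 ((hK.image h.continuous).isBounded.union hB')
  refine ⟨C, fun x y hxy => ?_⟩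
  obtain ⟨g, hg, hgx⟩ := hKg x
  rw [← h.dist_equivariant g.continuous hg]
  refine hC (Or.inl ⟨_, hgx, rfl⟩) (Or.inr ⟨_, ?_, rfl⟩)
  refine Metric.mem_cthickening_of_dist_le _ _ _ _ hgx ?_
  rwa [dist_comm, (UR.isometry_of_deck g.continuous hg).dist_eq]

variable [T2Space R] [CompactSpace S] [T2Space S]

/-- After moving x near o, the point y is near some p in the orbit of o, and J p is at bounded
distance from J o. Only finitely many such p exist, because the fibre through J o is finite in balls
and J is injective on the interior; this is why o is taken interior. -/
theorem exists_dist_le' : ∃ C, ∀ x y : UR.carrier, dist (J x) (J y) ≤ 1 → dist x y ≤ C := by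
  have := US.properSpace_carrier
  obtain ⟨K, hK, -, hKg⟩ := UR.exists_compact_fundamental
  obtain ⟨o, ho⟩ := UR.nonempty_int
  obtain ⟨D, hD⟩ := hK.isBounded.subset_closedBall o
  obtain ⟨C, hC⟩ := h.exists_dist_le D
  -- The radius is the length of the path from J p through the images of g y and g x to J o.
  let F : Set UR.carrier := {p | UR.proj p = UR.proj o ∧ dist (J p) (J o) ≤ C + 1 + C}
  have hFint : F ⊆ UR.int := fun p hp => by
    rw [UR.mem_int_iff, hp.1, ← UR.mem_int_iff]
    exact ho
  have hF : F.Finite := by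
    refine Set.Finite.of_finite_image ((US.finite_fiber_inter (US.proj (J o))
      (isCompact_closedBall (J o) (C + 1 + C))).subset ?_) (h.injOn_int.mono hFint)
    rintro _ ⟨p, hp, rfl⟩
    refine ⟨hp.2, ?_⟩
    rw [mem_preimage, mem_singleton_iff, h.lifts, hp.1, h.lifts]
  obtain ⟨M, hM⟩ := (hF.isBounded).subset_closedBall o
  refine ⟨D + M + D, fun x y hxy => ?_⟩
  obtain ⟨g, hg, hgx⟩ := hKg x
  obtain ⟨k, hk, hky⟩ := hKg (g y)
  have hgi := UR.isometry_of_deck g.continuous hg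
  have hki := UR.isometry_of_deck k.continuous hk
  set p := k.symm o with hp
  have hkp : k p = o := k.apply_symm_apply o
  have h1 : dist (g x) o ≤ D := hD hgx
  have h2 : dist (g y) p ≤ D := by
    rw [← hki.dist_eq, hkp]
    exact hD hky
  have h3 : dist (J (g x)) (J (g y)) ≤ 1 := by rwa [h.dist_equivariant g.continuous hg]
  have h4 := hC _ _ h1
  have h5 := hC _ _ h2
  have hpF : p ∈ F := by
    refine ⟨by rw [← hk, hkp], ?_⟩
    have h6 := dist_triangle4 (J p) (J (g y)) (J (g x)) (J o)
    rw [dist_comm (J p) (J (g y)), dist_comm (J (g y)) (J (g x))] at h6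
    linarith
  have h7 : dist p o ≤ M := hM hpF
  have h8 := dist_triangle4 (g x) o p (g y)
  rw [dist_comm o p, dist_comm p (g y)] at h8
  rw [← hgi.dist_eq]
  linarith

/-- The lower bound makes preimages of small balls bounded, hence relatively compact, so limits of
images of interior points are attained. -/
theorem range_eq_closure : range (fun x => (J x : ℍ)) = closure ((fun x => (J x : ℍ)) '' UR.int) := by
  have := UR.properSpace_carrier
  have hJ : Continuous fun x => (J x : ℍ) := continuous_subtype_val.comp h.continuous
  refine Subset.antisymm ?_ fun w hw => ?_
  · rw [← image_univ, ← UR.dense_int.closure_eq]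
    exact image_closure_subset_closure_image hJ
  · obtain ⟨C, hC⟩ := h.exists_dist_le'
    obtain ⟨_, ⟨x, hx, rfl⟩, hxw⟩ := Metric.mem_closure_iff.1 hw (1 / 2) (by norm_num)
    have h2 : w ∈ closure (Metric.ball w (1 / 2) ∩ (fun x => (J x : ℍ)) '' UR.int) :=
      Metric.isOpen_ball.inter_closure ⟨Metric.mem_ball_self (by norm_num), hw⟩
    have h3 : Metric.ball w (1 / 2) ∩ (fun x => (J x : ℍ)) '' UR.int ⊆
        (fun x => (J x : ℍ)) '' Metric.closedBall x C := by
      rintro _ ⟨hyw, y, -, rfl⟩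
      refine ⟨y, hC _ _ ?_, rfl⟩
      have h4 := dist_triangle (J y : ℍ) w (J x)
      rw [Metric.mem_ball] at hyw
      change dist (J y : ℍ) (J x) ≤ 1
      linarith
    have h5 := closure_minimal h3 ((isCompact_closedBall x C).image hJ).isClosed h2
    exact image_subset_range _ _ h5

theorem convex_range : Convex ℝ (kl '' range fun x => (J x : ℍ)) := by
  rw [h.range_eq_closure]
  exact convex_kl_closure h.convex_image_int

theorem exists_isCoarse :
    ∃ C, IsCoarse (fun x : UR.carrier => (x : ℍ)) (fun x => (J x : ℍ)) C := by
  have := UR.nonempty_carrier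
  refine _root_.exists_isCoarse ?_ h.convex_range (h.exists_dist_le 1) h.exists_dist_le'
  rw [Subtype.range_coe]
  exact UR.convex_carrier

theorem exists_isCoarse' :
    ∃ C, IsCoarse (fun x => (J x : ℍ)) (fun x : UR.carrier => (x : ℍ)) C := by
  have := UR.nonempty_carrier
  refine _root_.exists_isCoarse h.convex_range ?_ h.exists_dist_le' (h.exists_dist_le 1)
  rw [Subtype.range_coe]
  exact UR.convex_carrier

theorem exists_extension : ∃ f : idealBoundary UR.carrier → idealBoundary US.carrier,
    IsBoundaryExtension J f ∧ Continuous f ∧ Function.Injective f := by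
  obtain ⟨C, hC⟩ := h.exists_isCoarse
  obtain ⟨C', hC'⟩ := h.exists_isCoarse'
  obtain ⟨f, hf⟩ := hC.exists_isBoundaryExtension
  exact ⟨f, hf, hf.continuous_of_isCoarse hC, hf.injective_of_isCoarse hC'⟩

end IsRealizationLift

/-! ### Boundary geodesics and their images -/

theorem tendsto_dist_I_of_isCoarse {α β : Type*} {P Q : α → ℍ} {C : ℝ} (h : IsCoarse P Q C)
    {l : Filter β} {ρ : β → α}
    (hP : Tendsto (fun t => dist (P (ρ t)) UpperHalfPlane.I) l atTop) :
    Tendsto (fun t => dist (Q (ρ t)) UpperHalfPlane.I) l atTop := by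
  have hC : 0 < C := by linarith [h.one_le]
  refine tendsto_atTop_mono (f := fun t => (dist (P (ρ t)) UpperHalfPlane.I - C) / C)
    (fun t => ?_) ((tendsto_atTop_add_const_right _ (-C) hP).atTop_div_const hC)
  rw [div_le_iff₀ hC]
  linarith [h.proper (ρ t)]

/-- As t leaves every compact set, properness drives ρ t to infinity along the line of q, hence
towards its endpoints, and f carries these to the endpoints of c. -/
theorem IsBoundaryExtension.line_eq_range {X Y : Set ℍ} {J : X → Y}
    {f : idealBoundary X → idealBoundary Y} (hf : IsBoundaryExtension J f) {C : ℝ}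
    (hJ : IsCoarse (fun x : X => (J x : ℍ)) (fun x => (x : ℍ)) C) {c : ℝ → ℍ} {v u : ℂ}
    (hc : IsGeodesicLine c v u) {ρ : ℝ → X} (hρ : ∀ t, (J (ρ t) : ℍ) = c t) {q : GeodesicSpace X}
    (hq : ∀ t, (ρ t : ℍ) ∈ q.line) {q' : GeodesicSpace Y} (hq' : q'.1 = Sym2.map f q.1) :
    q'.line = range c := by
  rw [isBoundaryExtension_iff] at hf
  obtain ⟨ξ, η, he, d, hd⟩ := q.exists_rep
  rw [GeodesicSpace.line_eq he hd] at hq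
  have key : ∀ (l : Filter ℝ) [l.NeBot] (w : ℂ), ‖w‖ = 1 → Tendsto (fun t => kl (c t)) l (𝓝 w) →
      w = klein (f ξ) ∨ w = klein (f η) := by
    intro l _ w hw hl
    -- Nothing prevents ρ from oscillating between the two ends, so a limit is selected by refining
    -- to an ultrafilter.
    let 𝒰 := Ultrafilter.of l
    have hle : (𝒰 : Filter ℝ) ≤ l := Ultrafilter.of_le l
    obtain ⟨k, -, hk⟩ := (isCompact_closedBall (0 : ℂ) 1).ultrafilter_le_nhds
      (𝒰.map fun t => kl (ρ t)) (by
        rw [le_principal_iff]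
        exact Filter.mem_map.2 (univ_mem' fun t : ℝ => by simpa using (norm_kl_lt_one (ρ t)).le))
    have hk : Tendsto (fun t => kl (ρ t)) 𝒰 (𝓝 k) := hk
    have h1 : Tendsto (fun t => ‖kl (c t)‖) l (𝓝 1) := hw ▸ hl.norm
    have h2 : Tendsto (fun t => dist (J (ρ t) : ℍ) UpperHalfPlane.I) l atTop := by
      simp only [hρ]
      exact tendsto_dist_I_iff.1 h1
    have h3 := tendsto_dist_I_iff.2 (tendsto_dist_I_of_isCoarse hJ h2)
    have hk1 : ‖k‖ = 1 := tendsto_nhds_unique hk.norm (h3.mono_left hle)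
    have h4 : ∀ ζ : idealBoundary X, k = klein ζ → w = klein (f ζ) := by
      intro ζ hζ
      have h5 : Tendsto ρ 𝒰 (idealFilter ζ) := tendsto_comap_iff.2
        ((tendsto_toSphere_iff (mem_closedDisc_of_mem_idealBoundary ζ.2)).2 (hζ ▸ hk))
      have h6 := (hf ζ).comp h5
      refine tendsto_nhds_unique (hl.mono_left hle) (h6.congr fun t => ?_)
      simp [hρ]
    exact (hd.endpoints_of_tendsto hk1 (Eventually.of_forall hq) hk).imp (h4 ξ) (h4 η)
  have h1 := key atBot v hc.norm_left hc.tendsto_left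
  have h2 := key atTop u hc.norm_right hc.tendsto_right
  have hq'' : q'.1 = s(f ξ, f η) := by rw [hq', he, Sym2.map_mk]
  rcases h1 with rfl | rfl <;> rcases h2 with rfl | rfl
  · exact absurd rfl hc.ne
  · exact GeodesicSpace.line_eq hq'' hc
  · exact GeodesicSpace.line_eq (hq''.trans Sym2.eq_swap) hc
  · exact absurd rfl hc.ne

namespace UniversalCover

variable {S : Type*} [TopologicalSpace S] {h : HyperbolicMetric S} (U : UniversalCover h)
  [CompactSpace S]

theorem line_subset (q : U.geodesics) : q.line ⊆ U.carrier :=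
  GeodesicSpace.line_subset U.isClosed_carrier U.convex_carrier q

theorem exists_geodesics_map {g : U.carrier ≃ₜ U.carrier} (hg : ∀ z, U.proj (g z) = U.proj z)
    {φ : idealBoundary U.carrier → idealBoundary U.carrier} (hφ : IsBoundaryExtension g φ)
    (q : U.geodesics) : ∃ q' : U.geodesics, q'.1 = Sym2.map φ q.1 ∧
      ∀ z : U.carrier, (g z : ℍ) ∈ q'.line ↔ (z : ℍ) ∈ q.line := by
  obtain ⟨ξ, η, he, c, hc⟩ := q.exists_rep
  have hl := GeodesicSpace.line_eq he hc
  have hcX : ∀ t, c t ∈ U.carrier := fun t => U.line_subset q (hl ▸ ⟨t, rfl⟩)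
  let γ : ℝ → U.carrier := fun t => ⟨c t, hcX t⟩
  have hγ : Isometry γ := hc.isometry
  have hi : Isometry fun t => (g (γ t) : ℍ) :=
    isometry_subtype_coe.comp ((U.isometry_of_deck g.continuous hg).comp hγ)
  obtain ⟨v, u, hgl⟩ := hi.exists_isGeodesicLine
  rw [isBoundaryExtension_iff] at hφ
  have key : ∀ (l : Filter ℝ) (ζ : idealBoundary U.carrier),
      Tendsto (fun t => kl (c t)) l (𝓝 (klein ζ)) →
      Tendsto (fun t => kl (g (γ t))) l (𝓝 (klein (φ ζ))) := fun l ζ hl =>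
    (hφ ζ).comp (tendsto_comap_iff.2
      ((tendsto_toSphere_iff (mem_closedDisc_of_mem_idealBoundary ζ.2)).2 hl))
  obtain rfl := tendsto_nhds_unique hgl.tendsto_left (key _ ξ hc.tendsto_left)
  obtain rfl := tendsto_nhds_unique hgl.tendsto_right (key _ η hc.tendsto_right)
  have hd : ¬ (s(φ ξ, φ η)).IsDiag := fun h => hgl.ne (by rw [Sym2.mk_isDiag_iff.1 h])
  refine ⟨⟨s(φ ξ, φ η), hd⟩, by rw [he, Sym2.map_mk], fun z => ?_⟩
  rw [GeodesicSpace.line_eq (q := ⟨s(φ ξ, φ η), hd⟩) rfl hgl, hl]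
  constructor
  · rintro ⟨t, ht⟩
    exact ⟨t, congrArg Subtype.val (g.injective (Subtype.ext ht))⟩
  · rintro ⟨t, ht⟩
    refine ⟨t, ?_⟩
    change (g (γ t) : ℍ) = g z
    rw [show γ t = z from Subtype.ext ht]

/-- Through each boundary point of the universal cover passes exactly one complete geodesic
of the universal cover; it consists of boundary points, and it contains all of the boundary of the
universal cover near each of its points. -/
theorem exists_boundary_geodesic {z : ℍ} (hz : z ∈ U.carrier) (hz' : z ∉ interior U.carrier) :
    ∃ q : U.geodesics, z ∈ q.line ∧ (∀ w ∈ q.line, w ∉ interior U.carrier) ∧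
      IsClosed q.line ∧ (∀ q' : U.geodesics, z ∈ q'.line → q' = q) ∧
      ∀ w ∈ q.line, ∀ᶠ y in 𝓝 w, y ∈ U.carrier → y ∉ interior U.carrier → y ∈ q.line := by
  obtain ⟨L, m, c, v, u, hL, hc, hr, hzc, hcX, hpos, hgerm⟩ := U.exists_boundary_line hz hz'
  obtain ⟨q, hq, -⟩ := hc.exists_geodesicSpace hcX
  have huniq : ∀ q' : U.geodesics, z ∈ q'.line → q' = q := by
    intro q' hq'
    obtain ⟨ξ, η, he, c', hc'⟩ := q'.exists_rep
    have hl := GeodesicSpace.line_eq he hc'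
    refine GeodesicSpace.eq_of_line_eq ?_
    rw [hl] at hq'
    rw [hq, hl]
    obtain ⟨t₀, rfl⟩ := hq'
    refine hc'.range_eq_of_subset hc ?_
    rintro _ ⟨t, rfl⟩
    exact (hr _).2 (hc'.eq_zero_of_nonneg_nhds ((hr _).1 hzc)
      (Eventually.of_forall fun t => hpos _ (U.line_subset q' (hl ▸ ⟨t, rfl⟩))) t)
  refine ⟨q, by rwa [hq], ?_, ?_, huniq, ?_⟩
  · obtain ⟨c', v', u', hc', hzc', hcX', hint⟩ := U.boundary_line_subset hz hz'
    obtain ⟨q', hq', -⟩ := hc'.exists_geodesicSpace hcX'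
    obtain rfl := huniq q' (by rwa [hq'])
    rwa [hq']
  · have : q.line = {w | L (kl w) + m = 0} := by
      rw [hq]
      ext w
      exact hr w
    rw [this]
    exact isClosed_eq ((L.continuous.comp continuous_kl).add_const m) continuous_const
  · rw [hq]
    intro w hw
    obtain ⟨O, hO, hOo, hwO⟩ := eventually_nhds_iff.1 (hgerm w hw)
    filter_upwards [continuous_kl.continuousAt (hOo.mem_nhds hwO)] with y hy hyX hyi
    by_contra hyr
    have h0 : 0 < L (kl y) + m := lt_of_le_of_ne (hpos y hyX) fun h => hyr ((hr y).2 h.symm)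
    refine hyi (mem_interior_iff_mem_nhds.2 ?_)
    have h1 : ∀ᶠ x in 𝓝 y, kl x ∈ O := continuous_kl.continuousAt (hOo.mem_nhds hy)
    have h2 : ∀ᶠ x in 𝓝 y, 0 < L (kl x) + m :=
      ((L.continuous.comp continuous_kl).add_const m).continuousAt (lt_mem_nhds h0)
    filter_upwards [h1, h2] with x hx hx'
    obtain ⟨x', hx'X, he⟩ := (hO _ hx).2 hx'.le
    exact kl_injective he ▸ hx'X

end UniversalCover

theorem GeodesicSpace.line_nonempty {X : Set ℍ} (q : GeodesicSpace X) : q.line.Nonempty := by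
  obtain ⟨ξ, η, he, c, hc⟩ := q.exists_rep
  rw [GeodesicSpace.line_eq he hc]
  exact range_nonempty c

namespace IsRealizationLift

variable {R S : Type*} [TopologicalSpace R] [TopologicalSpace S]
    {hR : HyperbolicMetric R} {hS : HyperbolicMetric S} {UR : UniversalCover hR}
    {US : UniversalCover hS} {I : R → S} {J : UR.carrier → US.carrier}
    (h : IsRealizationLift UR US I J)

include h

/-- Through the image of a boundary point passes a complete geodesic consisting of images of boundary
points. -/
theorem exists_path [CompactSpace S] {x : UR.carrier} (hx : x ∉ UR.int) :
    ∃ (c : ℝ → ℍ) (v u : ℂ), IsGeodesicLine c v u ∧ ∃ ρ : ℝ → UR.carrier, Continuous ρ ∧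
      (∀ t, ρ t ∉ UR.int) ∧ (∀ t, (J (ρ t) : ℍ) = c t) ∧ x ∈ range ρ := by
  have hxb : UR.proj x ∈ hR.boundary := by
    by_contra hn
    exact hx ((UR.mem_int_iff x).2 hn)
  obtain ⟨β, hβ, hxβ, hemb, hC⟩ := h.realization.curve _ hxb
  obtain ⟨c, v, u, hc, ⟨t₀, ht₀⟩, hall⟩ :=
    UniversalCover.IsClosedGeodesic.exists_line US hC (w := J x) ⟨_, hxβ, (h.lifts x).symm⟩
  choose hcX hcC using hall
  let γ : ℝ → US.carrier := fun t => ⟨c t, hcX t⟩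
  have hγ : Continuous γ := hc.isometry.continuous.subtype_mk _
  have hγ₀ : γ t₀ = J x := Subtype.ext ht₀
  let e := hemb.toHomeomorph
  have hmem : ∀ t, US.proj (γ t) ∈ range (β.domRestrict I) := fun t => by
    obtain ⟨r, hr, he⟩ := hcC t
    exact ⟨⟨r, hr⟩, he⟩
  -- The closed geodesic is pulled back to the boundary curve and lifted from x; uniqueness of lifts
  -- then identifies its image under J with γ.
  let k : C(ℝ, R) := ⟨fun t => e.symm ⟨US.proj (γ t), hmem t⟩, by
    have := US.isCoveringMap.continuous
    fun_prop⟩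
  have hk : ∀ t, k t ∈ β := fun t => (e.symm ⟨US.proj (γ t), hmem t⟩).2
  have hIk : ∀ t, I (k t) = US.proj (γ t) := fun t =>
    congrArg Subtype.val (e.apply_symm_apply ⟨US.proj (γ t), hmem t⟩)
  have hk₀ : UR.proj x = k t₀ := by
    have : (⟨k t₀, hk t₀⟩ : β) = ⟨UR.proj x, hxβ⟩ := hemb.injective (by
      change I (k t₀) = I (UR.proj x)
      rw [hIk, hγ₀, h.lifts])
    exact (congrArg Subtype.val this).symm
  obtain ⟨ρ, ⟨hρ₀, hρ⟩, -⟩ := UR.isCoveringMap.existsUnique_continuousMap_lifts k t₀ x hk₀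
  replace hρ : ∀ t, UR.proj (ρ t) = k t := congr_fun hρ
  have hJρ : J ∘ ρ = γ := US.isCoveringMap.eq_of_comp_eq (h.continuous.comp ρ.continuous) hγ
    (by funext t; simp [h.lifts, hρ, hIk]) t₀ (by simp [hρ₀, hγ₀])
  refine ⟨c, v, u, hc, ρ, ρ.continuous, fun t => ?_, fun t => ?_, t₀, hρ₀⟩
  · rw [UR.mem_int_iff, hρ, not_not]
    exact hβ (hk t)
  · exact congrArg Subtype.val (congr_fun hJρ t)

/-- The interior is connected and its image avoids the line, so it lies on one side; density extends
the weak inequality to all of the cover. -/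
theorem exists_side [CompactSpace R] {c : ℝ → ℍ} {v u : ℂ} (hc : IsGeodesicLine c v u)
    (hd : ∀ x ∈ UR.int, (J x : ℍ) ∉ range c) : ∃ (L : ℂ →L[ℝ] ℝ) (m : ℝ),
      (∀ z : ℍ, z ∈ range c ↔ L (kl z) + m = 0) ∧ ∀ x, 0 ≤ L (kl (J x)) + m := by
  obtain ⟨L, m, -, hL⟩ := hc.isometry.exists_functional
  have hJ : Continuous fun x => kl (J x) :=
    continuous_kl.comp (continuous_subtype_val.comp h.continuous)
  have hcont : Continuous fun x => L (kl (J x)) + m := (L.continuous.comp hJ).add_const m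
  have hne : ∀ x ∈ UR.int, L (kl (J x)) + m ≠ 0 := fun x hx h0 => hd x hx ((hL _).2 h0)
  obtain ⟨o, ho⟩ := UR.nonempty_int
  have hsub := UR.isPreconnected_int.image _ hcont.continuousOn
  have hall : ∀ (L' : ℂ →L[ℝ] ℝ) (m' : ℝ), (∀ x ∈ UR.int, 0 ≤ L' (kl (J x)) + m') →
      ∀ x, 0 ≤ L' (kl (J x)) + m' := fun L' m' h' x => by
    have hcl : IsClosed {x | 0 ≤ L' (kl (J x)) + m'} :=
      isClosed_le continuous_const ((L'.continuous.comp hJ).add_const m')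
    exact closure_minimal h' hcl (UR.dense_int x)
  rcases lt_or_gt_of_ne (hne o ho) with h0 | h0
  · refine ⟨-L, -m, fun z => ?_, hall _ _ fun x hx => ?_⟩
    · rw [hL, neg_apply, ← neg_add, neg_eq_zero]
    · by_contra! hlt
      rw [neg_apply, ← neg_add] at hlt
      obtain ⟨y, hy, hy0⟩ := hsub.Icc_subset ⟨o, ho, rfl⟩ ⟨x, hx, rfl⟩
        (show (0 : ℝ) ∈ Icc _ _ from ⟨h0.le, by linarith⟩)
      exact hne y hy hy0
  · refine ⟨L, m, hL, hall _ _ fun x hx => ?_⟩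
    by_contra! hlt
    obtain ⟨y, hy, hy0⟩ := hsub.Icc_subset ⟨x, hx, rfl⟩ ⟨o, ho, rfl⟩
      (show (0 : ℝ) ∈ Icc _ _ from ⟨hlt.le, h0.le⟩)
    exact hne y hy hy0

variable [CompactSpace R] [T2Space R] [CompactSpace S] [T2Space S]

variable {f : idealBoundary UR.carrier → idealBoundary US.carrier} (hf : IsBoundaryExtension J f)
  (hinj : Function.Injective f)

include hf in
-- The path provided by `exists_path` never leaves q: the line of q is closed, and near each of its
-- points it contains the whole boundary of the cover, so the set of times spent on it is clopen.
theorem exists_path_line {q : UR.geodesics} (hq : ∀ z ∈ q.line, z ∉ interior UR.carrier)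
    {x : UR.carrier} (hx : (x : ℍ) ∈ q.line) : ∃ ρ : ℝ → UR.carrier, (∀ t, (ρ t : ℍ) ∈ q.line) ∧
      ∃ v u, IsGeodesicLine (fun t => (J (ρ t) : ℍ)) v u ∧ x ∈ range ρ ∧
      (geodesicMap f hinj q).line = range fun t => (J (ρ t) : ℍ) := by
  have hxi : x ∉ UR.int := hq _ hx
  obtain ⟨c, v, u, hc, ρ, hρc, hρi, hρ, t₀, hxρ⟩ := h.exists_path hxi
  obtain ⟨q', hxq', -, hcl, huniq, hgerm⟩ := UR.exists_boundary_geodesic x.2 (hq _ hx)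
  obtain rfl := huniq q hx
  have hclopen : IsClopen {t | (ρ t : ℍ) ∈ q.line} := by
    have hρc' : Continuous fun t => (ρ t : ℍ) := continuous_subtype_val.comp hρc
    refine ⟨hcl.preimage hρc', isOpen_iff_mem_nhds.2 fun t ht => ?_⟩
    filter_upwards [hρc'.continuousAt (hgerm _ ht)] with s hs using hs (ρ s).2 (hρi s)
  have hall : ∀ t, (ρ t : ℍ) ∈ q.line := eq_univ_iff_forall.1
    (hclopen.eq_univ ⟨t₀, by rw [mem_ofPred_eq, hxρ]; exact hx⟩)
  obtain ⟨C, hC⟩ := h.exists_isCoarse'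
  have hl := hf.line_eq_range hC hc hρ hall (q' := geodesicMap f hinj q) rfl
  obtain rfl : (fun t => (J (ρ t) : ℍ)) = c := funext hρ
  exact ⟨ρ, hall, v, u, hc, ⟨t₀, hxρ⟩, hl⟩

include hf in
theorem line_geodesicMap {q : UR.geodesics} (hq : ∀ z ∈ q.line, z ∉ interior UR.carrier) (w : ℍ) :
    w ∈ (geodesicMap f hinj q).line ↔ ∃ x : UR.carrier, (x : ℍ) ∈ q.line ∧ (J x : ℍ) = w := by
  constructor
  · intro hw
    obtain ⟨x, hx⟩ := q.line_nonempty
    obtain ⟨ρ, hρ, -, -, -, -, hl⟩ :=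
      h.exists_path_line hf hinj hq (x := ⟨x, UR.line_subset q hx⟩) hx
    rw [hl] at hw
    obtain ⟨t, rfl⟩ := hw
    exact ⟨ρ t, hρ t, rfl⟩
  · rintro ⟨x, hx, rfl⟩
    obtain ⟨ρ, hρ, -, -, -, ⟨t, rfl⟩, hl⟩ := h.exists_path_line hf hinj hq hx
    rw [hl]
    exact ⟨t, rfl⟩

include hf in
/-- A complete geodesic through the image of a boundary geodesic that avoids the image of the
interior is the image of that boundary geodesic. -/
theorem eq_geodesicMap_of_mem {q : UR.geodesics} (hq : ∀ z ∈ q.line, z ∉ interior UR.carrier)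
    {x : UR.carrier} (hx : (x : ℍ) ∈ q.line) {q' : US.geodesics} (hxq' : (J x : ℍ) ∈ q'.line)
    (hd : ∀ y ∈ UR.int, (J y : ℍ) ∉ q'.line) : q' = geodesicMap f hinj q := by
  obtain ⟨ρ, hρ, v, u, hc, ⟨t₀, rfl⟩, hl⟩ := h.exists_path_line hf hinj hq hx
  obtain ⟨ξ, η, he, c', hc'⟩ := q'.exists_rep
  have hl' := GeodesicSpace.line_eq he hc'
  rw [hl'] at hd hxq'
  obtain ⟨L, m, hL, hpos⟩ := h.exists_side hc' hd
  refine GeodesicSpace.eq_of_line_eq ?_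
  rw [hl, hl']
  refine (hc.range_eq_of_subset hc' ?_).symm
  rintro _ ⟨t, rfl⟩
  exact (hL _).2 (hc.eq_zero_of_nonneg_nhds ((hL _).1 hxq')
    (Eventually.of_forall fun s => hpos (ρ s)) t)

include hf in
-- The endpoints lie in the closure of the range of J, which is convex in the Klein model and closed
-- in the hyperbolic plane.
theorem line_geodesicMap_subset (q : UR.geodesics) :
    (geodesicMap f hinj q).line ⊆ range fun x => (J x : ℍ) := by
  obtain ⟨ξ, η, he, -⟩ := q.exists_rep
  have he' : (geodesicMap f hinj q).1 = s(f ξ, f η) := by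
    change Sym2.map f q.1 = _
    rw [he, Sym2.map_mk]
  have hne : klein (f ξ : OnePoint ℂ) ≠ klein (f η) :=
    klein_ne_of_not_isDiag (he' ▸ (geodesicMap f hinj q).2)
  obtain ⟨c, hc⟩ := exists_isGeodesicLine (norm_klein_idealBoundary (f ξ))
    (norm_klein_idealBoundary (f η)) hne
  rw [GeodesicSpace.line_eq he' hc]
  intro z hz
  rw [isBoundaryExtension_iff] at hf
  have hcl : ∀ ζ, klein (f ζ) ∈ closure (kl '' range fun x => (J x : ℍ)) := fun ζ =>
    mem_closure_of_tendsto (hf ζ) (Eventually.of_forall fun x => ⟨_, ⟨x, rfl⟩, rfl⟩)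
  have hz' : z ∈ closure (range fun x => (J x : ℍ)) := mem_closure_of_kl_mem_closure
    (h.convex_range.closure.openSegment_subset (hcl ξ) (hcl η) (hc.mem_range_iff.1 hz))
  rwa [h.range_eq_closure, closure_closure, ← h.range_eq_closure] at hz'

include hf in
-- A point of the image line is J x with x on the boundary of the cover. The boundary geodesic
-- through x has the same image line by `eq_geodesicMap_of_mem`, and injectivity identifies it with
-- q.
theorem notMem_interior_of_disjoint {q : UR.geodesics}
    (hd : ∀ y ∈ UR.int, (J y : ℍ) ∉ (geodesicMap f hinj q).line) :
    ∀ z ∈ q.line, z ∉ interior UR.carrier := by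
  obtain ⟨p, hp⟩ := (geodesicMap f hinj q).line_nonempty
  obtain ⟨x, rfl⟩ := h.line_geodesicMap_subset hf hinj q hp
  have hx : x ∉ UR.int := fun hx => hd x hx hp
  obtain ⟨q', hxq', hq', -⟩ := UR.exists_boundary_geodesic x.2 hx
  have := h.eq_geodesicMap_of_mem hf hinj hq' hxq' hp hd
  rwa [injective_geodesicMap hinj this]

include hf in
-- The image of a boundary geodesic lies in the wall, which is invariant under maps over S and
-- disjoint from the image of the interior.
theorem image_line_disjoint {q : UR.geodesics} (hq : ∀ z ∈ q.line, z ∉ interior UR.carrier)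
    {g : US.carrier → US.carrier} (hg : ∀ z, US.proj (g z) = US.proj z) {w : US.carrier}
    (hw : (w : ℍ) ∈ (geodesicMap f hinj q).line) : g w ∉ J '' UR.int := by
  rintro ⟨y, hy, he⟩
  obtain ⟨x, hx, hxw⟩ := (h.line_geodesicMap hf hinj hq w).1 hw
  refine h.apply_notMem_wall hy ?_
  rw [he]
  have h1 : J x ∈ wall hR US I := h.apply_mem_wall (hq _ hx)
  rw [wall, mem_preimage, hg, ← Subtype.ext hxw]
  exact h1

end IsRealizationLift

theorem UniversalCover.image_subset_boundary_iff {S : Type*} [TopologicalSpace S] [CompactSpace S]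
    {h : HyperbolicMetric S} (U : UniversalCover h) (q : U.geodesics) :
    U.image q ⊆ h.boundary ↔ ∀ z ∈ q.line, z ∉ interior U.carrier := by
  constructor
  · intro hq z hz hzi
    exact (U.mem_int_iff ⟨z, U.line_subset q hz⟩).1 hzi (hq ⟨_, hz, rfl⟩)
  · rintro hq _ ⟨z, hz, rfl⟩
    by_contra hn
    exact hq z hz ((U.mem_int_iff z).2 hn)

theorem UniversalCover.image_eq_of_deck {S : Type*} [TopologicalSpace S] [CompactSpace S]
    {h : HyperbolicMetric S} (U : UniversalCover h) {g : U.carrier ≃ₜ U.carrier}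
    (hg : ∀ z, U.proj (g z) = U.proj z) {q q' : U.geodesics}
    (hq : ∀ z : U.carrier, (g z : ℍ) ∈ q'.line ↔ (z : ℍ) ∈ q.line) : U.image q = U.image q' := by
  ext s
  constructor
  · rintro ⟨z, hz, rfl⟩
    exact ⟨g z, (hq z).2 hz, hg z⟩
  · rintro ⟨z, hz, rfl⟩
    obtain ⟨w, rfl⟩ := g.surjective z
    exact ⟨w, (hq w).1 hz, (hg w).symm⟩

/-! ### Conjugacy of image geodesics -/

namespace IsRealizationLift

variable {R S : Type*} [TopologicalSpace R] [TopologicalSpace S]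
    {hR : HyperbolicMetric R} {hS : HyperbolicMetric S} {UR : UniversalCover hR}
    {US : UniversalCover hS} {I : R → S} {J : UR.carrier → US.carrier}
    (h : IsRealizationLift UR US I J)
    [CompactSpace R]
    {f : idealBoundary UR.carrier → idealBoundary US.carrier} (hf : IsBoundaryExtension J f)
    (hinj : Function.Injective f)

include h hf

/-- A deck transformation of the universal cover of `S` matching two interior points comes from the
universal cover of `R`. -/
theorem image_eq_of_not_disjoint {g : US.carrier ≃ₜ US.carrier}
    (hg : ∀ z, US.proj (g z) = US.proj z)
    {φ : idealBoundary US.carrier → idealBoundary US.carrier} (hφ : IsBoundaryExtension g φ)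
    {a b : UR.geodesics}
    (hab : Sym2.map φ (geodesicMap f hinj a).1 = (geodesicMap f hinj b).1) {x y : UR.carrier}
    (hx : x ∈ UR.int) (hy : y ∈ UR.int) (hxy : J y = g (J x)) : UR.image a = UR.image b := by
  have hproj : UR.proj x = UR.proj y :=
    h.injOn ((UR.mem_int_iff x).1 hx) ((UR.mem_int_iff y).1 hy)
      (by rw [← h.lifts, ← h.lifts, hxy, hg])
  obtain ⟨k, hk, hkx⟩ := UR.exists_deck hproj
  have hJk := h.exists_deck_comp k.continuous hk g.continuous hg (x := x) (by rw [hkx, hxy])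
  obtain ⟨ψ, hψ⟩ := UR.exists_isBoundaryExtension_deck hk
  -- The relation between J, k and g passes to infinity because boundary extensions are unique.
  have hcomp : f ∘ ψ = φ ∘ f := by
    have h1 := hf.comp hψ
    have h2 := hφ.comp hf
    rw [show J ∘ k = g ∘ J from funext hJk] at h1
    exact h1.unique h2
  obtain ⟨b', hb', hline⟩ := UR.exists_geodesics_map hk hψ a
  have hbb : b' = b := by
    refine Subtype.ext (Sym2.map.injective hinj ?_)
    rw [hb', Sym2.map_map, hcomp, ← Sym2.map_map]
    exact hab
  rw [← hbb]
  exact UR.image_eq_of_deck hk hline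

variable [T2Space R] [CompactSpace S] [T2Space S]

theorem image_geodesicMap {q : UR.geodesics} (hq : ∀ z ∈ q.line, z ∉ interior UR.carrier) :
    US.image (geodesicMap f hinj q) = I '' UR.image q := by
  ext s
  constructor
  · rintro ⟨w, hw, rfl⟩
    obtain ⟨x, hx, hxw⟩ := (h.line_geodesicMap hf hinj hq w).1 hw
    refine ⟨_, ⟨x, hx, rfl⟩, ?_⟩
    rw [← h.lifts, Subtype.ext hxw]
  · rintro ⟨_, ⟨x, hx, rfl⟩, rfl⟩
    exact ⟨J x, (h.line_geodesicMap hf hinj hq _).2 ⟨x, hx, rfl⟩, h.lifts x⟩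

/-- An interior image point on the line of b would be g (J x) for some x, possibly on the boundary.
Since J(interior) is open and interior points are dense, x could be perturbed into the interior,
contradicting `hd`. -/
theorem disjoint_of_disjoint {g : US.carrier ≃ₜ US.carrier}
    (hd : ∀ x ∈ UR.int, g (J x) ∉ J '' UR.int) {a b : UR.geodesics}
    (hline : ∀ z : US.carrier, (g z : ℍ) ∈ (geodesicMap f hinj b).line ↔
      (z : ℍ) ∈ (geodesicMap f hinj a).line) :
    ∀ y ∈ UR.int, (J y : ℍ) ∉ (geodesicMap f hinj b).line := by
  intro y hy hyb
  obtain ⟨w, hw⟩ := g.surjective (J y)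
  rw [← hw, hline] at hyb
  obtain ⟨x, hx⟩ := h.line_geodesicMap_subset hf hinj a hyb
  have hxw : g (J x) = J y := by rw [← hw, Subtype.ext hx]
  have hopen : IsOpen ((fun x => g (J x)) ⁻¹' (J '' UR.int)) :=
    h.isOpen_image_int'.preimage (g.continuous.comp h.continuous)
  obtain ⟨z, hz, hzi⟩ := mem_closure_iff_nhds.1 (UR.dense_int x) _
    (hopen.mem_nhds (show g (J x) ∈ J '' UR.int from ⟨y, hy, hxw.symm⟩))
  exact hd z hzi hz

theorem isConjugate_iff {a b : UR.geodesics} (hab : UR.image a ≠ UR.image b) :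
    US.IsConjugate (geodesicMap f hinj a) (geodesicMap f hinj b) ↔
      UR.image a ⊆ hR.boundary ∧ UR.image b ⊆ hR.boundary ∧
        I '' UR.image a = I '' UR.image b := by
  simp only [UniversalCover.image_subset_boundary_iff]
  constructor
  · rintro ⟨g, hg, φ, hφ, hmap⟩
    obtain ⟨b', hb', hline⟩ := US.exists_geodesics_map hg hφ (geodesicMap f hinj a)
    obtain rfl : b' = geodesicMap f hinj b := Subtype.ext (hb'.trans hmap)
    -- An overlap would make g descend to a deck transformation of R carrying a to b, so that a and
    -- b would have the same projection.
    have hd : ∀ x ∈ UR.int, g (J x) ∉ J '' UR.int := by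
      rintro x hx ⟨y, hy, hyx⟩
      exact hab (h.image_eq_of_not_disjoint hf hinj hg hφ hmap hx hy hyx)
    have hd' : ∀ x ∈ UR.int, g.symm (J x) ∉ J '' UR.int := by
      rintro x hx ⟨y, hy, hyx⟩
      exact hd y hy ⟨x, hx, by rw [hyx, g.apply_symm_apply]⟩
    have hb := h.notMem_interior_of_disjoint hf hinj
      (h.disjoint_of_disjoint hf hinj hd hline)
    have ha := h.notMem_interior_of_disjoint hf hinj
      (h.disjoint_of_disjoint hf hinj (a := b) (b := a) hd' fun z => by
        rw [← hline, g.apply_symm_apply])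
    refine ⟨ha, hb, ?_⟩
    rw [← h.image_geodesicMap hf hinj ha, ← h.image_geodesicMap hf hinj hb]
    exact US.image_eq_of_deck hg hline
  · rintro ⟨ha, hb, himg⟩
    rw [← h.image_geodesicMap hf hinj ha] at himg
    obtain ⟨w, hw⟩ := (geodesicMap f hinj a).line_nonempty
    obtain ⟨_, ⟨y, hy, rfl⟩, hyw⟩ := himg.subset
      ⟨⟨w, US.line_subset _ hw⟩, hw, rfl⟩
    rw [← h.lifts] at hyw
    -- Matching a single point suffices: the translated line passes through J y and avoids
    -- J(interior), and only the image of b does so.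
    obtain ⟨g, hg, hgw⟩ := US.exists_deck hyw.symm
    obtain ⟨φ, hφ⟩ := US.exists_isBoundaryExtension_deck hg
    obtain ⟨b', hb', hline⟩ := US.exists_geodesics_map hg hφ (geodesicMap f hinj a)
    refine ⟨g, hg, φ, hφ, ?_⟩
    rw [← hb']
    refine congrArg Subtype.val (h.eq_geodesicMap_of_mem hf hinj hb hy ?_ ?_)
    · rw [← hgw, hline]
      exact hw
    · intro x hx hxb
      obtain ⟨z, hz⟩ := g.surjective (J x)
      rw [← hz, hline] at hxb
      exact h.image_line_disjoint hf hinj ha hg hxb ⟨x, hx, hz.symm⟩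

end IsRealizationLift

/-- Finiteness of the index set enters here: the image is a finite union of closed sets. -/
theorem isClosedMap_of_forall_sigma {ι : Type*} [Finite ι] {X : ι → Type*}
    [∀ i, TopologicalSpace (X i)] {Y : Type*} [TopologicalSpace Y] {F : (Σ i, X i) → Y}
    (hF : ∀ i, IsClosedMap fun x => F ⟨i, x⟩) : IsClosedMap F := by
  intro A hA
  have : F '' A = ⋃ i, (fun x => F ⟨i, x⟩) '' (Sigma.mk i ⁻¹' A) := by
    ext y
    simp only [mem_iUnion]
    constructor
    · rintro ⟨⟨i, x⟩, hx, rfl⟩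
      exact ⟨i, x, hx, rfl⟩
    · rintro ⟨i, x, hx, rfl⟩
      exact ⟨_, hx, rfl⟩
  rw [this]
  exact isClosed_iUnion_of_finite fun i => hF i _ (hA.preimage continuous_sigmaMk)

theorem subsingleton_of_connectedSpace_sigma {ι : Type*} {X : ι → Type*}
    [∀ i, TopologicalSpace (X i)] [∀ i, Nonempty (X i)] [ConnectedSpace (Σ i, X i)] :
    Subsingleton ι := by
  refine ⟨fun i j => ?_⟩
  have h : IsClopen (range (Sigma.mk i : X i → Σ i, X i)) := isClopen_range_sigmaMk
  obtain ⟨y⟩ : Nonempty (X j) := inferInstance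
  obtain ⟨x, hx⟩ : (⟨j, y⟩ : Σ i, X i) ∈ range (Sigma.mk i) := by
    rw [h.eq_univ (range_nonempty _)]
    trivial
  exact congrArg Sigma.fst hx

theorem mainTheorem5
    {S : Type*} [TopologicalSpace S] [T2Space S] [CompactSpace S] [ConnectedSpace S]
    (hS : HyperbolicMetric S) (US : UniversalCover hS)
    {ι : Type*} [Finite ι] {R : ι → Type*} [∀ i, TopologicalSpace (R i)] [∀ i, T2Space (R i)]
    [∀ i, CompactSpace (R i)] [∀ i, ConnectedSpace (R i)]
    (hR : ∀ i, HyperbolicMetric (R i)) (UR : ∀ i, UniversalCover (hR i))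
    (I : (Σ i, R i) → S) (hI : IsGeodesicRealization hR US I) :
    (∃ J : ∀ i, (UR i).carrier → US.carrier, IsLift UR US I J) ∧
    ∀ J : ∀ i, (UR i).carrier → US.carrier, IsLift UR US I J →
      ∃ f : ∀ i, idealBoundary (UR i).carrier → idealBoundary US.carrier,
        (∀ i, IsBoundaryExtension (J i) (f i)) ∧
        ∃ F : (Σ i, (UR i).geodesics) → US.geodesics,
          (∀ a, (F a).1 = Sym2.map (f a.1) a.2.1) ∧
          Continuous F ∧ IsClosedMap F ∧
          (ConnectedSpace (Σ i, R i) →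
            Function.Injective F ∧
            ∀ a b : Σ i, (UR i).geodesics, sigmaImage UR a ≠ sigmaImage UR b →
              (US.IsConjugate (F a) (F b) ↔
                sigmaImage UR a ⊆ sigmaBoundary hR ∧ sigmaImage UR b ⊆ sigmaBoundary hR ∧
                I '' sigmaImage UR a = I '' sigmaImage UR b)) := by
  refine ⟨?_, fun J hJ => ?_⟩
  · have hlift : ∀ i, ∃ J : (UR i).carrier → US.carrier, Continuous J ∧
        ∀ z, US.proj (J z) = I ⟨i, (UR i).proj z⟩ := fun i => by
      have := (UR i).simplyConnected
      have := (UR i).locallyPathConnectedSpace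
      obtain ⟨z₀⟩ := (UR i).nonempty_carrier
      obtain ⟨e₀, he₀⟩ := US.surjective (I ⟨i, (UR i).proj z₀⟩)
      obtain ⟨J, ⟨-, hJ⟩, -⟩ := US.isCoveringMap.existsUnique_continuousMap_lifts
        ⟨fun z => I ⟨i, (UR i).proj z⟩, hI.continuous.comp
          (continuous_sigmaMk.comp (UR i).isCoveringMap.continuous)⟩ z₀ e₀ he₀
      exact ⟨J, J.continuous, congr_fun hJ⟩
    choose J hJ using hlift
    exact ⟨J, hJ⟩
  · have hl : ∀ i, IsRealizationLift (UR i) US (fun x => I ⟨i, x⟩) (J i) := fun i =>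
      ⟨hI.isRealization i, (hJ i).1, (hJ i).2⟩
    choose f hf hc hinj using fun i => (hl i).exists_extension
    refine ⟨f, hf, fun a => geodesicMap (f a.1) (hinj a.1) a.2, fun a => rfl,
      continuous_sigma fun i => continuous_geodesicMap (hinj i) (hc i),
      isClosedMap_of_forall_sigma fun i => isClosedMap_geodesicMap (hinj i) (hc i), fun hconn => ?_⟩
    -- Connectedness leaves a single summand, so both global claims reduce to one component.
    have : Subsingleton ι := subsingleton_of_connectedSpace_sigma (X := R)
    refine ⟨?_, ?_⟩
    · rintro ⟨i, a⟩ ⟨j, b⟩ hab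
      obtain rfl := Subsingleton.elim i j
      exact congrArg (Sigma.mk i) (injective_geodesicMap (hinj i) hab)
    · rintro ⟨i, a⟩ ⟨j, b⟩ hab
      obtain rfl := Subsingleton.elim i j
      have hab' : (UR i).image a ≠ (UR i).image b := fun h => hab (by simp only [sigmaImage, h])
      rw [(hl i).isConjugate_iff (hf i) (hinj i) hab']
      simp only [sigmaImage, image_subset_iff, image_image]
      rfl
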